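/- **Conventions.** Morphisms are composed in the order of the arrows ($\alpha\cdot\beta$ is first $\alpha$, then $\beta$). For a ring $R$, $\mathrm{Rows}_R$ is the category whose objects are the free left modules $R^{1\times n}$, $n\in\mathbb{N}_0$, and whose morphisms $R^{1\times m}\to R^{1\times n}$ are the matrices in $R^{m\times n}$, composed by the matrix product. For an additive category $\mathbf{P}$, the Freyd category $\mathcal{A}(\mathbf{P})$ has as objects the morphisms $(A\xleftarrow{\rho_A}R_A)$ of $\mathbf{P}$; a morphism from $(A\xleftarrow{\rho_A}R_A)$ to $(B\xleftarrow{\rho_B}R_B)$ is given by an $\alpha:A\to B$ (the datum) for which there is a $\rho_\alpha:R_A\to R_B$ (a witness) with $\rho_A\cdot\alpha=\rho_\alpha\cdot\rho_B$, and $\alpha,\alpha'$ give the same morphism if $\alpha-\alpha'=\lambda\cdot\rho_B$ for some $\lambda:A\to R_B$. Composition, identities and addition are inherited from $\mathbf{P}$. A ring $R$ is *left coherent* if for every matrix $A$ over $R$ there is a matrix $L$ with $LA=0$ such that every matrix $T$ with $TA=0$ has the form $T=UL$. *Algorithm* means a partial recursive function on codes that terminates on all valid inputs. A *field with decidable equality*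 is a field $k$ with a surjection $\nu:\mathbb{N}\to k$ such that addition, negation, multiplication and inversion of non-zero elements are computable on codes and the relation $\nu(a)=\nu(b)$ is decidable. An element of a quotient of a polynomial ring over $k$ is coded by a representing polynomial, given as a finite list of terms (a code of the coefficient and a list of variables); matrices are coded by lists of lists of codes; an object $(A\xleftarrow{\rho_A}R_A)$ of a Freyd category is coded by codes of $A$, $R_A$, $\rho_A$, and a morphism by codes of a datum and a witness; an opposite category has the same codes. A ring *has decidable lifts* if there is an algorithm that, for given matrices $A,B$ with the same number of columns, finds a matrix $X$ with $XA=B$ or reports that none exists. A *computable abelian category* is an abelian category with algorithms for composition, identities, addition, zero morphisms and additive inverses; for direct sums of finite lists of objects with their projections and injections; for kernels and cokernels with their universal morphisms; for the lift of $\tau$ along a monomorphism $\alpha$ if $\tau$ is killed by the cokernel projection of $\alpha$, and for the colift of $\tau$ along an epimorphism $\alpha$ if $\tau$ kills the kernel embedding of $\alpha$; and for deciding equality of two given parallel morphisms. An additive category *has decidable linear systems* if there is an algorithm that, for given objects $A_i,D_i$ ($1\le i\le m$), $B_j,C_j$ ($1\le j\le n$) and morphisms $\alpha_{ij}:A_i\to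 B_j$, $\beta_{ij}:C_j\to D_i$, $\gamma_i:A_i\to D_i$, finds morphisms $X_j:B_j\to C_j$ with $\sum_{j=1}^n\alpha_{ij}\cdot X_j\cdot\beta_{ij}=\gamma_i$ for all $i$, or reports that none exist. **Theorem.** Let $k$ be a field and set $$R:=k[z,x_i\mid i\in\mathbb{N}]/\langle zx_i\mid i\in\mathbb{N}\rangle .$$ Then $R$ is not left coherent, but $\mathcal{A}(\mathcal{A}(\mathrm{Rows}_R)^{\mathrm{op}})$ is an abelian category. If $k$ is a field with decidable equality, then moreover $R$ has decidable lifts, and $\mathcal{A}(\mathcal{A}(\mathrm{Rows}_R)^{\mathrm{op}})$ is a computable abelian category that has decidable linear systems. -/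

import Mathlib

open CategoryTheory CategoryTheory.Limits

universe u v

/-! ### The category of row modules -/

/-- The object `⟨n⟩` stands for the free left `R`-module `R^{1 × n}` of rows of length `n`. -/
structure RowsCat (R : Type u) where
  /-- The length of the rows. -/
  rank : ℕ

/-- A morphism `R^{1 × m} ⟶ R^{1 × n}` is an `m × n` matrix, acting on rows from the right, so that
composition is the matrix product in the order of the arrows. -/
instance RowsCat.instCategory (R : Type u) [Ring R] : Category (RowsCat R) where
  Hom X Y := Matrix (Fin X.rank) (Fin Y.rank) R
  id X := (1 : Matrix (Fin X.rank) (Fin X.rank) R)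
  comp {X Y Z} (f : Matrix (Fin X.rank) (Fin Y.rank) R) (g : Matrix (Fin Y.rank) (Fin Z.rank) R) :=
    f * g
  id_comp f := Matrix.one_mul f
  comp_id f := Matrix.mul_one f
  assoc f g h := Matrix.mul_assoc f g h

instance RowsCat.instPreadditive (R : Type u) [Ring R] : Preadditive (RowsCat R) where
  homGroup X Y := inferInstanceAs (AddCommGroup (Matrix (Fin X.rank) (Fin Y.rank) R))
  add_comp _ _ _ f f' g := Matrix.add_mul f f' g
  comp_add _ _ _ f g g' := Matrix.mul_add f g g'

/-! ### The Freyd category -/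

/-- An object of the Freyd category of `P` is a morphism `gen ⟵ rels` of `P`. -/
structure Freyd (P : Type u) [Category.{v} P] where
  /-- The range of the morphism. -/
  gen : P
  /-- The source of the morphism. -/
  rels : P
  /-- The morphism. -/
  ρ : rels ⟶ gen

namespace Freyd

variable {P : Type u} [Category.{v} P] [Preadditive P]

/-- The morphism data: those `α : X.gen ⟶ Y.gen` that admit a morphism witness. -/
def datum (X Y : Freyd P) : AddSubgroup (X.gen ⟶ Y.gen) where
  carrier := {α | ∃ w : X.rels ⟶ Y.rels, X.ρ ≫ α = w ≫ Y.ρ}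
  zero_mem' := ⟨0, by simp⟩
  add_mem' := by
    rintro a b ⟨w, hw⟩ ⟨w', hw'⟩
    exact ⟨w + w', by simp [hw, hw']⟩
  neg_mem' := by
    rintro a ⟨w, hw⟩
    exact ⟨-w, by simp [hw]⟩

/-- The morphisms `X.gen ⟶ Y.gen` that lift along `Y.ρ`. -/
def null (X Y : Freyd P) : AddSubgroup (X.gen ⟶ Y.gen) where
  carrier := {α | ∃ l : X.gen ⟶ Y.rels, l ≫ Y.ρ = α}
  zero_mem' := ⟨0, by simp⟩
  add_mem' := by
    rintro _ _ ⟨l, rfl⟩ ⟨l', rfl⟩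
    exact ⟨l + l', by simp⟩
  neg_mem' := by
    rintro _ ⟨l, rfl⟩
    exact ⟨-l, by simp⟩

/-- Morphisms of the Freyd category: two morphism data are equal if their difference lifts
along `Y.ρ`. -/
abbrev HomType (X Y : Freyd P) : Type v :=
  datum X Y ⧸ (null X Y).addSubgroupOf (datum X Y)

theorem comp_mem_datum {X Y Z : Freyd P} {α : X.gen ⟶ Y.gen} {β : Y.gen ⟶ Z.gen}
    (hα : α ∈ datum X Y) (hβ : β ∈ datum Y Z) : α ≫ β ∈ datum X Z := by
  obtain ⟨w, hw⟩ := hα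
  obtain ⟨w', hw'⟩ := hβ
  exact ⟨w ≫ w', by rw [← Category.assoc, hw, Category.assoc, hw', Category.assoc]⟩

/-- Composition, inherited from `P`. -/
def compHom {X Y Z : Freyd P} : HomType X Y → HomType Y Z → HomType X Z :=
  Quotient.map₂ (fun a b => ⟨a.1 ≫ b.1, comp_mem_datum a.2 b.2⟩) (by
    intro a a' ha b b' hb
    obtain ⟨l, hl⟩ := QuotientAddGroup.leftRel_apply.mp ha
    obtain ⟨m, hm⟩ := QuotientAddGroup.leftRel_apply.mp hb
    obtain ⟨x, hx⟩ := b'.2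
    refine QuotientAddGroup.leftRel_apply.mpr ⟨a.1 ≫ m + l ≫ x, ?_⟩
    change l ≫ Y.ρ = -a.1 + a'.1 at hl
    change m ≫ Z.ρ = -b.1 + b'.1 at hm
    change (a.1 ≫ m + l ≫ x) ≫ Z.ρ = -(a.1 ≫ b.1) + a'.1 ≫ b'.1
    rw [Preadditive.add_comp, Category.assoc, Category.assoc, hm, ← hx, ← Category.assoc l, hl]
    simp)

instance instCategory : Category (Freyd P) where
  Hom X Y := HomType X Y
  id X := QuotientAddGroup.mk ⟨𝟙 X.gen, 𝟙 X.rels, by simp⟩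
  comp f g := compHom f g
  id_comp f := by
    induction f using QuotientAddGroup.induction_on with | _ a =>
    exact congrArg QuotientAddGroup.mk (Subtype.ext (Category.id_comp _))
  comp_id f := by
    induction f using QuotientAddGroup.induction_on with | _ a =>
    exact congrArg QuotientAddGroup.mk (Subtype.ext (Category.comp_id _))
  assoc f g h := by
    induction f using QuotientAddGroup.induction_on with | _ a =>
    induction g using QuotientAddGroup.induction_on with | _ b =>
    induction h using QuotientAddGroup.induction_on with | _ c =>
    exact congrArg QuotientAddGroup.mk (Subtype.ext (Category.assoc _ _ _))

instance instPreadditive : Preadditive (Freyd P) where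
  homGroup X Y := inferInstanceAs (AddCommGroup (HomType X Y))
  add_comp _ _ _ f f' g := by
    induction f using QuotientAddGroup.induction_on with | _ a =>
    induction f' using QuotientAddGroup.induction_on with | _ a' =>
    induction g using QuotientAddGroup.induction_on with | _ b =>
    exact congrArg QuotientAddGroup.mk (Subtype.ext (Preadditive.add_comp _ _ _ _ _ _))
  comp_add _ _ _ f g g' := by
    induction f using QuotientAddGroup.induction_on with | _ a =>
    induction g using QuotientAddGroup.induction_on with | _ b =>
    induction g' using QuotientAddGroup.induction_on with | _ b' =>
    exact congrArg QuotientAddGroup.mk (Subtype.ext (Preadditive.comp_add _ _ _ _ _ _))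

/-- The morphism with a given morphism datum. -/
def homMk {X Y : Freyd P} (α : X.gen ⟶ Y.gen) (h : ∃ w : X.rels ⟶ Y.rels, X.ρ ≫ α = w ≫ Y.ρ) :
    X ⟶ Y :=
  QuotientAddGroup.mk (s := (null X Y).addSubgroupOf (datum X Y)) ⟨α, h⟩

theorem homMk_surj {X Y : Freyd P} (f : X ⟶ Y) :
    ∃ (α : X.gen ⟶ Y.gen) (w : X.rels ⟶ Y.rels) (h : X.ρ ≫ α = w ≫ Y.ρ),
      homMk α ⟨w, h⟩ = f := by
  induction f using QuotientAddGroup.induction_on with | _ a =>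
  obtain ⟨α, w, h⟩ := a
  exact ⟨α, w, h, rfl⟩

end Freyd

/-! ### Data types and algorithms

An algorithm is a partial recursive function (`Partrec`) between types of codes that terminates on
all valid inputs. -/

/-- A representation of a category by data types: a type of codes for the objects and one for the
morphisms. A morphism code is read relative to a source and a target. Different codes may
stand for the same object or for the same morphism. -/
structure CodedCategory (C : Type u) [Category.{v} C] where
  /-- Codes of objects. -/
  Ob : Type
  /-- Codes of morphisms. -/
  Mor : Type
  [primOb : Primcodable Ob]
  [primMor : Primcodable Mor]
  /-- `obj x X`: the code `x` stands for `X`. -/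
  obj : Ob → C → Prop
  /-- `hom a f`: the code `a` stands for `f : X ⟶ Y`. -/
  hom : Mor → ∀ {X Y : C}, (X ⟶ Y) → Prop
  obj_surj : ∀ X : C, ∃ x, obj x X
  obj_unique : ∀ {x : Ob} {X X' : C}, obj x X → obj x X' → X = X'
  hom_surj : ∀ {X Y : C} (f : X ⟶ Y), ∃ a, hom a f
  hom_unique : ∀ {a : Mor} {X Y : C} {f f' : X ⟶ Y}, hom a f → hom a f' → f = f'

attribute [instance] CodedCategory.primOb CodedCategory.primMor

/-- A representation of a ring by a data type. -/
structure CodedRing (R : Type u) where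
  /-- Codes of elements. -/
  Code : Type
  [prim : Primcodable Code]
  /-- The element that a code stands for. -/
  val : Code → R
  surj : Function.Surjective val

attribute [instance] CodedRing.prim

namespace CodedRing

variable {R : Type u} [Ring R] (c : CodedRing R)

/-- The `m × n` matrix that a list of rows of codes stands for; missing entries are zero and
superfluous ones are ignored. -/
def matrix (l : List (List c.Code)) (m n : ℕ) : Matrix (Fin m) (Fin n) R :=
  fun i j => ((l[(i : ℕ)]?.bind fun r => r[(j : ℕ)]?).map c.val).getD 0

theorem matrix_surj {m n : ℕ} (M : Matrix (Fin m) (Fin n) R) : ∃ l, c.matrix l m n = M := by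
  choose g hg using c.surj
  refine ⟨List.ofFn fun i => List.ofFn fun j => g (M i j), ?_⟩
  ext i j
  simp [matrix, hg]

/-- The ring has decidable lifts: there is an algorithm that, given matrices `A` and `B` with the
same number of columns, finds `X` with `X * A = B` or reports that there is none. -/
def HasDecidableLifts : Prop :=
  ∃ φ : (ℕ × ℕ × ℕ) × List (List c.Code) × List (List c.Code) →. Option (List (List c.Code)),
    Partrec φ ∧
    ∀ (p q r : ℕ) (a b : List (List c.Code)),
      (∃ x, some x ∈ φ ((p, q, r), a, b) ∧ c.matrix x p q * c.matrix a q r = c.matrix b p r) ∨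
      (none ∈ φ ((p, q, r), a, b) ∧
        ¬ ∃ X : Matrix (Fin p) (Fin q) R, X * c.matrix a q r = c.matrix b p r)

/-- The category of row modules over a coded ring: objects are natural numbers, morphisms are lists
of lists of codes of ring elements. -/
def rows : CodedCategory (RowsCat R) where
  Ob := ℕ
  Mor := List (List c.Code)
  obj n X := X.rank = n
  hom l {X Y} f := f = c.matrix l X.rank Y.rank
  obj_surj X := ⟨X.rank, rfl⟩
  obj_unique := by
    rintro x ⟨n⟩ ⟨n'⟩ h h'
    exact congrArg _ (Eq.trans h (Eq.symm h'))
  hom_surj f := (c.matrix_surj f).imp fun _ h => h.symm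
  hom_unique h h' := h.trans h'.symm

end CodedRing

namespace CodedCategory

/-- The opposite category, with the same codes. -/
def op {C : Type u} [Category.{v} C] (E : CodedCategory C) : CodedCategory Cᵒᵖ where
  Ob := E.Ob
  Mor := E.Mor
  obj x X := E.obj x X.unop
  hom a _ _ f := E.hom a f.unop
  obj_surj X := E.obj_surj X.unop
  obj_unique h h' := Opposite.unop_injective (E.obj_unique h h')
  hom_surj f := E.hom_surj f.unop
  hom_unique h h' := Quiver.Hom.unop_inj (E.hom_unique h h')

/-- The Freyd category: an object is coded by codes of `gen`, `rels` and `ρ`, a morphism by codes of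
a morphism datum and of a morphism witness. -/
def freyd {P : Type u} [Category.{v} P] [Preadditive P] (E : CodedCategory P) :
    CodedCategory (Freyd P) where
  Ob := E.Ob × E.Ob × E.Mor
  Mor := E.Mor × E.Mor
  obj x X := E.obj x.1 X.gen ∧ E.obj x.2.1 X.rels ∧ E.hom x.2.2 X.ρ
  hom a {X Y} f := ∃ (α : X.gen ⟶ Y.gen) (w : X.rels ⟶ Y.rels) (h : X.ρ ≫ α = w ≫ Y.ρ),
    E.hom a.1 α ∧ E.hom a.2 w ∧ Freyd.homMk α ⟨w, h⟩ = f
  obj_surj X := by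
    obtain ⟨x, hx⟩ := E.obj_surj X.gen
    obtain ⟨y, hy⟩ := E.obj_surj X.rels
    obtain ⟨a, ha⟩ := E.hom_surj X.ρ
    exact ⟨(x, y, a), hx, hy, ha⟩
  obj_unique := by
    rintro ⟨x, y, a⟩ ⟨A, B, f⟩ ⟨A', B', f'⟩ ⟨h1, h2, h3⟩ ⟨h1', h2', h3'⟩
    obtain rfl := E.obj_unique h1 h1'
    obtain rfl := E.obj_unique h2 h2'
    obtain rfl := E.hom_unique h3 h3'
    rfl
  hom_surj f := by
    obtain ⟨α, w, h, rfl⟩ := Freyd.homMk_surj f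
    obtain ⟨a, ha⟩ := E.hom_surj α
    obtain ⟨b, hb⟩ := E.hom_surj w
    exact ⟨(a, b), α, w, h, ha, hb, rfl⟩
  hom_unique := by
    rintro ⟨a, b⟩ X Y _ _ ⟨α, w, h, ha, hb, rfl⟩ ⟨α', w', h', ha', hb', rfl⟩
    obtain rfl := E.hom_unique ha ha'
    rfl

section Effective

variable {C : Type u} [Category.{v} C] (E : CodedCategory C)

/-- Composition and identities are computable. -/
def HasCategoryAlgorithms : Prop :=
  (∃ φ : (E.Ob × E.Ob × E.Ob) × E.Mor × E.Mor →. E.Mor, Partrec φ ∧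
    ∀ {X Y Z : C} (f : X ⟶ Y) (g : Y ⟶ Z) (x y z : E.Ob) (a b : E.Mor),
      E.obj x X → E.obj y Y → E.obj z Z → E.hom a f → E.hom b g →
      ∃ c ∈ φ ((x, y, z), a, b), E.hom c (f ≫ g)) ∧
  (∃ φ : E.Ob →. E.Mor, Partrec φ ∧
    ∀ (X : C) (x : E.Ob), E.obj x X → ∃ c ∈ φ x, E.hom c (𝟙 X))

/-- Equality of morphisms is decidable. -/
def HasDecidableEquality : Prop :=
  ∃ φ : (E.Ob × E.Ob) × E.Mor × E.Mor →. Bool, Partrec φ ∧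
    ∀ {X Y : C} (f g : X ⟶ Y) (x y : E.Ob) (a b : E.Mor),
      E.obj x X → E.obj y Y → E.hom a f → E.hom b g →
      ∃ c ∈ φ ((x, y), a, b), (c = true ↔ f = g)

variable [Preadditive C]

/-- Addition, zero morphisms and additive inverses are computable. -/
def HasAbAlgorithms : Prop :=
  (∃ φ : (E.Ob × E.Ob) × E.Mor × E.Mor →. E.Mor, Partrec φ ∧
    ∀ {X Y : C} (f g : X ⟶ Y) (x y : E.Ob) (a b : E.Mor),
      E.obj x X → E.obj y Y → E.hom a f → E.hom b g →
      ∃ c ∈ φ ((x, y), a, b), E.hom c (f + g)) ∧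
  (∃ φ : E.Ob × E.Ob →. E.Mor, Partrec φ ∧
    ∀ (X Y : C) (x y : E.Ob), E.obj x X → E.obj y Y →
      ∃ c ∈ φ (x, y), E.hom c (0 : X ⟶ Y)) ∧
  (∃ φ : (E.Ob × E.Ob) × E.Mor →. E.Mor, Partrec φ ∧
    ∀ {X Y : C} (f : X ⟶ Y) (x y : E.Ob) (a : E.Mor),
      E.obj x X → E.obj y Y → E.hom a f →
      ∃ c ∈ φ ((x, y), a), E.hom c (-f))

/-- Direct sums of finite lists of objects, with their projections and injections, are
computable. -/
def HasDirectSumAlgorithms : Prop :=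
  ∃ (σ : List E.Ob →. E.Ob) (φ ψ : List E.Ob × ℕ →. E.Mor), Partrec σ ∧ Partrec φ ∧ Partrec ψ ∧
    ∀ (n : ℕ) (A : Fin n → C) (x : Fin n → E.Ob), (∀ i, E.obj (x i) (A i)) →
      ∃ s ∈ σ (List.ofFn x), ∃ S : C, E.obj s S ∧
        ∃ (π : ∀ i, S ⟶ A i) (ι : ∀ i, A i ⟶ S),
          (∀ i : Fin n, ∃ p ∈ φ (List.ofFn x, (i : ℕ)), E.hom p (π i)) ∧
          (∀ i : Fin n, ∃ q ∈ ψ (List.ofFn x, (i : ℕ)), E.hom q (ι i)) ∧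
          ∑ i, π i ≫ ι i = 𝟙 S ∧
          (∀ i, ι i ≫ π i = 𝟙 (A i)) ∧
          (∀ i j, i ≠ j → ι i ≫ π j = 0)

/-- Kernel objects, kernel embeddings and kernel lifts are computable. -/
def HasKernelAlgorithms : Prop :=
  ∃ (κ : (E.Ob × E.Ob) × E.Mor →. E.Ob × E.Mor)
    (φ : (E.Ob × E.Ob × E.Ob) × E.Mor × E.Mor →. E.Mor), Partrec κ ∧ Partrec φ ∧
    ∀ {A B : C} (f : A ⟶ B) (x y : E.Ob) (a : E.Mor), E.obj x A → E.obj y B → E.hom a f →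
      ∃ r ∈ κ ((x, y), a), ∃ (K : C) (i : K ⟶ A), E.obj r.1 K ∧ E.hom r.2 i ∧ i ≫ f = 0 ∧
        ∀ {T : C} (τ : T ⟶ A) (t : E.Ob) (b : E.Mor), E.obj t T → E.hom b τ → τ ≫ f = 0 →
          ∃ c ∈ φ ((x, y, t), a, b), ∃ w : T ⟶ K, E.hom c w ∧ w ≫ i = τ ∧
            ∀ w' : T ⟶ K, w' ≫ i = τ → w' = w

/-- Cokernel objects, cokernel projections and cokernel colifts are computable. -/
def HasCokernelAlgorithms : Prop :=
  ∃ (κ : (E.Ob × E.Ob) × E.Mor →. E.Ob × E.Mor)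
    (φ : (E.Ob × E.Ob × E.Ob) × E.Mor × E.Mor →. E.Mor), Partrec κ ∧ Partrec φ ∧
    ∀ {A B : C} (f : A ⟶ B) (x y : E.Ob) (a : E.Mor), E.obj x A → E.obj y B → E.hom a f →
      ∃ r ∈ κ ((x, y), a), ∃ (Q : C) (p : B ⟶ Q), E.obj r.1 Q ∧ E.hom r.2 p ∧ f ≫ p = 0 ∧
        ∀ {T : C} (τ : B ⟶ T) (t : E.Ob) (b : E.Mor), E.obj t T → E.hom b τ → f ≫ τ = 0 →
          ∃ c ∈ φ ((x, y, t), a, b), ∃ w : Q ⟶ T, E.hom c w ∧ p ≫ w = τ ∧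
            ∀ w' : Q ⟶ T, p ≫ w' = τ → w' = w

/-- Lifts along a monomorphism of the morphisms killed by its cokernel projection are
computable. -/
def HasMonoLiftAlgorithm : Prop :=
  ∃ φ : (E.Ob × E.Ob × E.Ob) × E.Mor × E.Mor →. E.Mor, Partrec φ ∧
    ∀ {A B T : C} (f : A ⟶ B) (τ : T ⟶ B) (x y t : E.Ob) (a b : E.Mor), Mono f →
      E.obj x A → E.obj y B → E.obj t T → E.hom a f → E.hom b τ →
      ∀ s : CokernelCofork f, Nonempty (IsColimit s) → τ ≫ s.π = 0 →
      ∃ c ∈ φ ((x, y, t), a, b), ∃ w : T ⟶ A, E.hom c w ∧ w ≫ f = τ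

/-- Colifts along an epimorphism of the morphisms that kill its kernel embedding are
computable. -/
def HasEpiColiftAlgorithm : Prop :=
  ∃ φ : (E.Ob × E.Ob × E.Ob) × E.Mor × E.Mor →. E.Mor, Partrec φ ∧
    ∀ {A B T : C} (f : A ⟶ B) (τ : A ⟶ T) (x y t : E.Ob) (a b : E.Mor), Epi f →
      E.obj x A → E.obj y B → E.obj t T → E.hom a f → E.hom b τ →
      ∀ s : KernelFork f, Nonempty (IsLimit s) → s.ι ≫ τ = 0 →
      ∃ c ∈ φ ((x, y, t), a, b), ∃ w : B ⟶ T, E.hom c w ∧ f ≫ w = τ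

/-- A computable abelian category: all operations of an abelian category are given by algorithms,
and equality of morphisms is decidable. -/
structure IsComputableAbelian : Prop where
  category : E.HasCategoryAlgorithms
  ab : E.HasAbAlgorithms
  directSum : E.HasDirectSumAlgorithms
  kernel : E.HasKernelAlgorithms
  cokernel : E.HasCokernelAlgorithms
  monoLift : E.HasMonoLiftAlgorithm
  epiColift : E.HasEpiColiftAlgorithm
  decidableEquality : E.HasDecidableEquality

end Effective

end CodedCategory

/-! ### Linear systems -/

/-- A linear system with `m` equations `∑ j, α i j ≫ X j ≫ β i j = γ i` in `n` indeterminates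
`X j : S j ⟶ T j`. -/
structure LinearSystem (C : Type u) [Category.{v} C] (m n : ℕ) where
  /-- Sources of the equations. -/
  A : Fin m → C
  /-- Targets of the equations. -/
  D : Fin m → C
  /-- Sources of the indeterminates. -/
  S : Fin n → C
  /-- Targets of the indeterminates. -/
  T : Fin n → C
  /-- Left coefficients. -/
  α : ∀ i j, A i ⟶ S j
  /-- Right coefficients. -/
  β : ∀ i j, T j ⟶ D i
  /-- Right-hand sides. -/
  γ : ∀ i, A i ⟶ D i

/-- A family of morphisms solves a linear system. -/
def LinearSystem.IsSolution {C : Type u} [Category.{v} C] [Preadditive C] {m n : ℕ}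
    (L : LinearSystem C m n) (X : ∀ j, L.S j ⟶ L.T j) : Prop :=
  ∀ i, ∑ j, L.α i j ≫ X j ≫ L.β i j = L.γ i

/-- There is an algorithm that finds a solution of a given linear system or reports that there is
none. The input consists of the list of the codes of `(A i, D i)`, the list of those of
`(S j, T j)`, the coefficients `(α i j, β i j)` row by row, and the right-hand sides. -/
def CodedCategory.HasDecidableLinearSystems {C : Type u} [Category.{v} C] [Preadditive C]
    (E : CodedCategory C) : Prop :=
  ∃ φ : (List (E.Ob × E.Ob) × List (E.Ob × E.Ob)) × List (List (E.Mor × E.Mor)) × List E.Mor →.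
      Option (List E.Mor), Partrec φ ∧
    ∀ (m n : ℕ) (L : LinearSystem C m n) (x : Fin m → E.Ob × E.Ob) (y : Fin n → E.Ob × E.Ob)
      (a : Fin m → Fin n → E.Mor × E.Mor) (g : Fin m → E.Mor),
      (∀ i, E.obj (x i).1 (L.A i) ∧ E.obj (x i).2 (L.D i)) →
      (∀ j, E.obj (y j).1 (L.S j) ∧ E.obj (y j).2 (L.T j)) →
      (∀ i j, E.hom (a i j).1 (L.α i j) ∧ E.hom (a i j).2 (L.β i j)) →
      (∀ i, E.hom (g i) (L.γ i)) →
      (∃ s : Fin n → E.Mor,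
        some (List.ofFn s) ∈
          φ ((List.ofFn x, List.ofFn y), List.ofFn fun i => List.ofFn (a i), List.ofFn g) ∧
        ∃ X : ∀ j, L.S j ⟶ L.T j, (∀ j, E.hom (s j) (X j)) ∧ L.IsSolution X) ∨
      (none ∈ φ ((List.ofFn x, List.ofFn y), List.ofFn fun i => List.ofFn (a i), List.ofFn g) ∧
        ¬ ∃ X : ∀ j, L.S j ⟶ L.T j, L.IsSolution X)

/-- The category is abelian, with respect to its given addition of morphisms. -/
def IsAbelianCategory (C : Type u) [Category.{v} C] [h : Preadditive C] : Prop :=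
  ∃ a : Abelian C, a.toPreadditive = h

/-! ### The ring -/

/-- A ring is left coherent if the row syzygies of every matrix over it are generated by the rows
of a matrix. -/
def IsLeftCoherent (R : Type u) [Ring R] : Prop :=
  ∀ (m n : ℕ) (A : Matrix (Fin m) (Fin n) R),
    ∃ (l : ℕ) (L : Matrix (Fin l) (Fin m) R), L * A = 0 ∧
      ∀ (t : ℕ) (T : Matrix (Fin t) (Fin m) R), T * A = 0 →
        ∃ U : Matrix (Fin t) (Fin l) R, U * L = T

/-- `k[z, x_i | i ∈ ℕ] / ⟨z x_i | i ∈ ℕ⟩`, with `z = X none` and `x_i = X (some i)`. -/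
abbrev ZXRing (k : Type u) [Field k] : Type u :=
  MvPolynomial (Option ℕ) k ⧸
    Ideal.span (Set.range fun i : ℕ =>
      (MvPolynomial.X none * MvPolynomial.X (some i) : MvPolynomial (Option ℕ) k))

/-- A field with decidable equality: its elements are coded by natural numbers, the field
operations are computable on codes, and it is decidable whether two codes stand for the same
element. -/
structure IsComputableField {k : Type u} [Field k] (ν : ℕ → k) : Prop where
  surj : Function.Surjective ν
  decEq : ComputablePred fun p : ℕ × ℕ => ν p.1 = ν p.2
  add : ∃ f : ℕ → ℕ → ℕ, Computable₂ f ∧ ∀ a b, ν (f a b) = ν a + ν b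
  neg : ∃ f : ℕ → ℕ, Computable f ∧ ∀ a, ν (f a) = -ν a
  mul : ∃ f : ℕ → ℕ → ℕ, Computable₂ f ∧ ∀ a b, ν (f a b) = ν a * ν b
  inv : ∃ f : ℕ → ℕ, Computable f ∧ ∀ a, ν a ≠ 0 → ν (f a) = (ν a)⁻¹

/-- The polynomial given by a list of terms, each consisting of (the code of) a coefficient and the
list of the variables, with multiplicities, of a monomial. -/
noncomputable def polyOfTerms {k : Type u} [Field k] (ν : ℕ → k)
    (l : List (ℕ × List (Option ℕ))) : MvPolynomial (Option ℕ) k :=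
  (l.map fun t => MvPolynomial.C (ν t.1) * (t.2.map MvPolynomial.X).prod).sum

theorem polyOfTerms_surj {k : Type u} [Field k] {ν : ℕ → k} (hν : Function.Surjective ν) :
    Function.Surjective (polyOfTerms ν) := by
  have hadd : ∀ l l', polyOfTerms ν (l ++ l') = polyOfTerms ν l + polyOfTerms ν l' := by
    simp [polyOfTerms]
  intro p
  induction p using MvPolynomial.induction_on with
  | C a =>
    obtain ⟨n, rfl⟩ := hν a
    exact ⟨[(n, [])], by simp [polyOfTerms]⟩
  | add p q hp hq =>
    obtain ⟨l, rfl⟩ := hp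
    obtain ⟨l', rfl⟩ := hq
    exact ⟨l ++ l', hadd l l'⟩
  | mul_X p i hp =>
    obtain ⟨l, rfl⟩ := hp
    refine ⟨l.map fun t => (t.1, i :: t.2), ?_⟩
    simp only [polyOfTerms, List.map_map, ← List.sum_map_mul_right]
    congr 1
    refine List.map_congr_left fun t _ => ?_
    simp only [Function.comp, List.map_cons, List.prod_cons]
    ring

/-- Elements of `ZXRing k` are coded by polynomials that represent them. -/
noncomputable def ZXRing.coded {k : Type u} [Field k] (ν : ℕ → k) (hν : Function.Surjective ν) :
    CodedRing (ZXRing k) where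
  Code := List (ℕ × List (Option ℕ))
  val l := Ideal.Quotient.mk _ (polyOfTerms ν l)
  surj := Ideal.Quotient.mk_surjective.comp (polyOfTerms_surj hν)

/-! Coherence of a ring `R` matters for `Freyd (RowsCat R)` only because it gives `RowsCat R` weak
kernels. The second Freyd construction makes it superfluous. In the Freyd category of any additive
category, cokernels arise by adding relations (`Freyd.isCokernel_cokernelProj`). Such a cokernel,
read backwards, is a weak kernel in the opposite category (`Freyd.exists_isWeakKernel_op`), and weak
kernels suffice for the next Freyd category to be abelian (`Freyd.isAbelianCategory`). This part
works over every ring. Incoherence of this particular ring comes from the annihilator of `z`: its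
elements have no constant term, it contains every `x_n`, and finitely many generators involve only
finitely many variables.

The algorithms all rest on linear systems. A system in `Freyd P` becomes one in `P` once witnesses
and homotopies are taken as further indeterminates (`freydSystem`). Passing to the opposite category
swaps left and right coefficients. Over a commutative ring a system of matrices is a scalar system
in their entries, hence a lifting problem. So `SolvesFamilies` climbs from row modules to the double
Freyd category (`CodedRing.HasDecidableLifts.solvesFamilies`, `SolvesFamilies.freyd`,
`SolvesFamilies.op`). Direct sums, kernel and cokernel objects are given by formulas. Lifts, colifts
and equality tests are instances of linear systems.

Lifts over `ZXRing k` are decided by searching in parallel for a solution and for a refutation. A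
proposed solution can be checked, since membership in a monomial ideal is a condition on single
monomials (`polyOfTerms_mem_iff`). If there is no solution, let `S` be a finite type subalgebra
containing all entries. Some row `b` of the right-hand side is nonzero in `S ^ r` modulo the rows of
`A`. By Krull's intersection theorem and the Nullstellensatz, `b` survives in a quotient of finite
dimension over `k` (`exists_refutation`). Written in a basis, this quotient consists of commuting
matrices over `k`, one for each variable, that respect the relations `z * x_i = 0`, together with
vectors `w j` that kill the rows of `A` but not `b`. These are finite data that can be checked by
arithmetic in `k`, and they exclude a solution (`ZXRing.exists_refutes`,
`ZXRing.not_exists_of_refutes`). -/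

/-! ### Computable functions -/

section ComputableCalculus

attribute [fun_prop] Computable
attribute [fun_prop] Computable.id Computable.const Computable.comp Computable.cond

variable {α β γ δ σ : Type*} [Primcodable α] [Primcodable β] [Primcodable γ] [Primcodable δ]
  [Primcodable σ]

namespace Computable

-- The closure rules below are all stated for functions of a parameter, so that `fun_prop` can
-- decompose a program term by term.
@[fun_prop]
theorem prodMk {f : α → β} {g : α → γ} (hf : Computable f) (hg : Computable g) :
    Computable fun a => (f a, g a) := hf.pair hg

@[fun_prop]
theorem prodFst {f : α → β × γ} (hf : Computable f) : Computable fun a => (f a).1 :=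
  Computable.fst.comp hf

@[fun_prop]
theorem prodSnd {f : α → β × γ} (hf : Computable f) : Computable fun a => (f a).2 :=
  Computable.snd.comp hf

@[fun_prop]
theorem inl' {f : α → β} (hf : Computable f) : Computable fun a => (Sum.inl (f a) : β ⊕ γ) :=
  Computable.sumInl.comp hf

@[fun_prop]
theorem inr' {f : α → γ} (hf : Computable f) : Computable fun a => (Sum.inr (f a) : β ⊕ γ) :=
  Computable.sumInr.comp hf

@[fun_prop]
theorem some' {f : α → β} (hf : Computable f) : Computable fun a => some (f a) :=
  Computable.option_some.comp hf

@[fun_prop]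
theorem encode' {f : α → β} (hf : Computable f) : Computable fun a => Encodable.encode (f a) :=
  Computable.encode.comp hf

@[fun_prop]
theorem decode' {f : α → ℕ} (hf : Computable f) :
    Computable fun a => (Encodable.decode (f a) : Option β) :=
  Computable.decode.comp hf

@[fun_prop]
theorem natAdd {f g : α → ℕ} (hf : Computable f) (hg : Computable g) :
    Computable fun a => f a + g a := Primrec.nat_add.to_comp.comp hf hg

@[fun_prop]
theorem listCons {f : α → β} {g : α → List β} (hf : Computable f) (hg : Computable g) :
    Computable fun a => f a :: g a := Computable.list_cons.comp hf hg

@[fun_prop]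
theorem listAppend {f g : α → List β} (hf : Computable f) (hg : Computable g) :
    Computable fun a => f a ++ g a := Computable.list_append.comp hf hg

@[fun_prop]
theorem listLength {f : α → List β} (hf : Computable f) :
    Computable fun a => (f a).length := Computable.list_length.comp hf

@[fun_prop]
theorem listGetD {f : α → List β} {g : α → ℕ} (d : β) (hf : Computable f) (hg : Computable g) :
    Computable fun a => (f a).getD (g a) d := (Primrec.list_getD d).to_comp.comp hf hg

@[fun_prop]
theorem listIdxOf [DecidableEq β] {f : α → β} {g : α → List β} (hf : Computable f)
    (hg : Computable g) : Computable fun a => (g a).idxOf (f a) :=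
  Primrec.list_idxOf.to_comp.comp hf hg

@[fun_prop]
theorem listRange {f : α → ℕ} (hf : Computable f) :
    Computable fun a => List.range (f a) := Primrec.list_range.to_comp.comp hf

@[fun_prop]
theorem boolAnd {f g : α → Bool} (hf : Computable f) (hg : Computable g) :
    Computable fun a => f a && g a := Primrec.and.to_comp.comp hf hg

@[fun_prop]
theorem boolOr {f g : α → Bool} (hf : Computable f) (hg : Computable g) :
    Computable fun a => f a || g a := Primrec.or.to_comp.comp hf hg

@[fun_prop]
theorem boolNot {f : α → Bool} (hf : Computable f) :
    Computable fun a => !f a := Primrec.not.to_comp.comp hf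

@[fun_prop]
theorem decideEq [DecidableEq β] {f g : α → β} (hf : Computable f) (hg : Computable g) :
    Computable fun a => decide (f a = g a) :=
  Primrec.eq.decide.to_comp.comp hf hg

@[fun_prop]
theorem ite' {c : α → Prop} [∀ a, Decidable (c a)] {f g : α → β}
    (hc : Computable fun a => decide (c a)) (hf : Computable f) (hg : Computable g) :
    Computable fun a => if c a then f a else g a :=
  (Computable.cond hc hf hg).of_eq fun a => by by_cases h : c a <;> simp [h]

@[fun_prop]
theorem sumElim {s : α → β ⊕ γ} {f : α → β → σ} {g : α → γ → σ} (hs : Computable s)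
    (hf : Computable fun p : α × β => f p.1 p.2) (hg : Computable fun p : α × γ => g p.1 p.2) :
    Computable fun a => Sum.elim (f a) (g a) (s a) :=
  (Computable.sumCasesOn hs hf.to₂ hg.to₂).of_eq fun a => by cases s a <;> rfl

@[fun_prop]
theorem optElim {s : α → Option β} {f : α → σ} {g : α → β → σ} (hs : Computable s)
    (hf : Computable f) (hg : Computable fun p : α × β => g p.1 p.2) :
    Computable fun a => (s a).elim (f a) (g a) :=
  (Computable.option_casesOn hs hf hg.to₂).of_eq fun a => by cases s a <;> rfl

@[fun_prop]
theorem optMap {s : α → Option β} {g : α → β → σ} (hs : Computable s)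
    (hg : Computable fun p : α × β => g p.1 p.2) : Computable fun a => (s a).map (g a) :=
  Computable.option_map hs hg.to₂

@[fun_prop]
theorem optIsSome {s : α → Option β} (hs : Computable s) : Computable fun a => (s a).isSome :=
  Primrec.option_isSome.to_comp.comp hs

@[fun_prop]
-- A fold is primitive recursion on the length of the prefix already consumed. The other list
-- operations below reduce to folds.
theorem listFoldl {f : α → List β} {g : α → σ} {h : α → σ → β → σ} (hf : Computable f)
    (hg : Computable g) (hh : Computable fun p : α × σ × β => h p.1 p.2.1 p.2.2) :
    Computable fun a => (f a).foldl (h a) (g a) := by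
  have key : Computable fun a => Nat.rec (motive := fun _ => σ) (g a)
      (fun n acc => ((f a)[n]?).elim acc (fun b => h a acc b)) (f a).length := by
    refine Computable.nat_rec (h := fun a p => ((f a)[p.1]?).elim p.2 (fun b => h a p.2 b))
      (by fun_prop) hg ?_
    have : Computable fun q : α × ℕ × σ => (f q.1)[q.2.1]? :=
      Computable.list_getElem?.comp (by fun_prop) (by fun_prop)
    exact Computable.optElim this (by fun_prop) (by fun_prop)
  refine key.of_eq fun a => ?_
  -- After `n` rounds the recursion holds the fold over the first `n` entries; beyond the end of the
  -- list a round changes nothing.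
  have : ∀ n, Nat.rec (motive := fun _ => σ) (g a)
      (fun n acc => ((f a)[n]?).elim acc (fun b => h a acc b)) n =
      ((f a).take n).foldl (h a) (g a) := by
    intro n
    induction n with
    | zero => simp
    | succ n ih =>
      simp only [ih, List.take_add_one, List.foldl_append]
      cases (f a)[n]? <;> simp
  rw [this, List.take_length]

@[fun_prop]
theorem listFoldr {f : α → List β} {g : α → σ} {h : α → β → σ → σ} (hf : Computable f)
    (hg : Computable g) (hh : Computable fun p : α × β × σ => h p.1 p.2.1 p.2.2) :
    Computable fun a => (f a).foldr (h a) (g a) := by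
  have : Computable fun a => (f a).reverse := Computable.list_reverse.comp hf
  refine (Computable.listFoldl (h := fun a s b => h a b s) this hg (by fun_prop)).of_eq
    fun a => ?_
  simp

@[fun_prop]
theorem listMap {f : α → List β} {g : α → β → σ} (hf : Computable f)
    (hg : Computable fun p : α × β => g p.1 p.2) : Computable fun a => (f a).map (g a) := by
  refine (Computable.listFoldr (g := fun _ => []) (h := fun a b s => g a b :: s) hf (by fun_prop)
    (by fun_prop)).of_eq fun a => ?_
  induction f a <;> simp_all

@[fun_prop]
theorem listFlatMap {f : α → List β} {g : α → β → List σ} (hf : Computable f)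
    (hg : Computable fun p : α × β => g p.1 p.2) : Computable fun a => (f a).flatMap (g a) := by
  refine (Computable.listFoldr (g := fun _ => []) (h := fun a b s => g a b ++ s) hf (by fun_prop)
    (by fun_prop)).of_eq fun a => ?_
  induction f a <;> simp_all

@[fun_prop]
theorem listAll {f : α → List β} {g : α → β → Bool} (hf : Computable f)
    (hg : Computable fun p : α × β => g p.1 p.2) : Computable fun a => (f a).all (g a) := by
  refine (Computable.listFoldr (g := fun _ => true) (h := fun a b s => g a b && s) hf (by fun_prop)
    (by fun_prop)).of_eq fun a => ?_
  induction f a <;> simp_all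

@[fun_prop]
theorem listAny {f : α → List β} {g : α → β → Bool} (hf : Computable f)
    (hg : Computable fun p : α × β => g p.1 p.2) : Computable fun a => (f a).any (g a) := by
  refine (Computable.listFoldr (g := fun _ => false) (h := fun a b s => g a b || s) hf (by fun_prop)
    (by fun_prop)).of_eq fun a => ?_
  induction f a <;> simp_all

@[fun_prop]
theorem listFilter {f : α → List β} {g : α → β → Bool} (hf : Computable f)
    (hg : Computable fun p : α × β => g p.1 p.2) : Computable fun a => (f a).filter (g a) := by
  refine (Computable.listFoldr (g := fun _ => [])
    (h := fun a b s => if g a b = true then b :: s else s) hf (by fun_prop)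
    (by fun_prop)).of_eq fun a => ?_
  induction f a <;> simp_all [List.filter_cons]

end Computable

/-- Unbounded search: if a computable predicate has a solution for a given parameter, one can be
found. -/
theorem exists_partrec_search {f : α → β → Bool} (hf : Computable fun p : α × β => f p.1 p.2) :
    ∃ φ : α →. β, Partrec φ ∧ ∀ a, (∃ b, f a b = true) → ∃ b ∈ φ a, f a b = true := by
  -- All candidates are enumerated by decoding the natural numbers, and the search stops at the
  -- first one that passes the test.
  let F : α → ℕ → Option β := fun a n =>
    (Encodable.decode n : Option β).elim none fun b => if f a b = true then some b else none
  have hF : Computable₂ F := by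
    change Computable fun p : α × ℕ => F p.1 p.2
    simp only [F]
    fun_prop
  refine ⟨_, Partrec.rfindOpt hF, fun a ⟨b, hb⟩ => ?_⟩
  have hdom : (Nat.rfindOpt (F a)).Dom :=
    Nat.rfindOpt_dom.2 ⟨Encodable.encode b, b, by simp [F, hb]⟩
  obtain ⟨n, hn⟩ := Nat.rfindOpt_spec (Part.get_mem hdom)
  refine ⟨_, Part.get_mem hdom, ?_⟩
  simp only [F] at hn
  cases hd : (Encodable.decode n : Option β) with
  | none => simp [hd] at hn
  | some b' =>
    by_cases h : f a b' = true
    · simp [hd, h] at hn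
      rw [← hn]
      exact h
    · simp [hd, h] at hn

end ComputableCalculus

/-! ### Direct sums, kernels and weak kernels in preadditive categories -/

section Diagrams

variable {C : Type u} [Category.{v} C] [Preadditive C]

/-- A direct sum of two objects with its projections and injections. -/
structure SumDiagram (X Y : C) where
  /-- The direct sum. -/
  pt : C
  /-- The first projection. -/
  fst : pt ⟶ X
  /-- The second projection. -/
  snd : pt ⟶ Y
  /-- The first injection. -/
  inl : X ⟶ pt
  /-- The second injection. -/
  inr : Y ⟶ pt
  inl_fst : inl ≫ fst = 𝟙 X
  inr_snd : inr ≫ snd = 𝟙 Y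
  inl_snd : inl ≫ snd = 0
  inr_fst : inr ≫ fst = 0
  total : fst ≫ inl + snd ≫ inr = 𝟙 pt

namespace SumDiagram

attribute [simp] inl_fst inr_snd inl_snd inr_fst

variable {X Y : C} (b : SumDiagram X Y)

@[simp]
theorem inl_fst_assoc {T : C} (f : X ⟶ T) : b.inl ≫ b.fst ≫ f = f := by
  rw [← Category.assoc, b.inl_fst, Category.id_comp]

@[simp]
theorem inr_snd_assoc {T : C} (f : Y ⟶ T) : b.inr ≫ b.snd ≫ f = f := by
  rw [← Category.assoc, b.inr_snd, Category.id_comp]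

@[simp]
theorem inl_snd_assoc {T : C} (f : Y ⟶ T) : b.inl ≫ b.snd ≫ f = 0 := by
  rw [← Category.assoc, b.inl_snd, zero_comp]

@[simp]
theorem inr_fst_assoc {T : C} (f : X ⟶ T) : b.inr ≫ b.fst ≫ f = 0 := by
  rw [← Category.assoc, b.inr_fst, zero_comp]

/-- The morphism out of a direct sum with given components. -/
def desc {T : C} (f : X ⟶ T) (g : Y ⟶ T) : b.pt ⟶ T := b.fst ≫ f + b.snd ≫ g

/-- The direct sum in the opposite category. -/
def op : SumDiagram (Opposite.op X) (Opposite.op Y) where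
  pt := Opposite.op b.pt
  fst := b.inl.op
  snd := b.inr.op
  inl := b.fst.op
  inr := b.snd.op
  inl_fst := congrArg Quiver.Hom.op b.inl_fst
  inr_snd := congrArg Quiver.Hom.op b.inr_snd
  inl_snd := congrArg Quiver.Hom.op b.inr_fst
  inr_fst := congrArg Quiver.Hom.op b.inl_snd
  total := congrArg Quiver.Hom.op b.total

theorem hasBinaryBiproduct {X Y : C} (b : SumDiagram X Y) : HasBinaryBiproduct X Y :=
  hasBinaryBiproduct_of_total
    { pt := b.pt, fst := b.fst, snd := b.snd, inl := b.inl, inr := b.inr } b.total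

end SumDiagram

/-- `i` is a weak kernel of `f`. -/
structure IsWeakKernel {K A B : C} (i : K ⟶ A) (f : A ⟶ B) : Prop where
  zero : i ≫ f = 0
  lift : ∀ {T : C} (τ : T ⟶ A), τ ≫ f = 0 → ∃ w : T ⟶ K, w ≫ i = τ

/-- `i` is a kernel of `f`. -/
structure IsKernel {K A B : C} (i : K ⟶ A) (f : A ⟶ B) : Prop extends IsWeakKernel i f where
  mono : ∀ {T : C} (w : T ⟶ K), w ≫ i = 0 → w = 0

/-- `p` is a cokernel of `f`. -/
structure IsCokernel {A B Q : C} (p : B ⟶ Q) (f : A ⟶ B) : Prop where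
  zero : f ≫ p = 0
  colift : ∀ {T : C} (τ : B ⟶ T), f ≫ τ = 0 → ∃ w : Q ⟶ T, p ≫ w = τ
  epi : ∀ {T : C} (w : Q ⟶ T), p ≫ w = 0 → w = 0

theorem IsKernel.eq {K A B T : C} {i : K ⟶ A} {f : A ⟶ B} (h : IsKernel i f) {w w' : T ⟶ K}
    (hw : w ≫ i = w' ≫ i) : w = w' :=
  sub_eq_zero.1 (h.mono _ (by rw [Preadditive.sub_comp, hw, sub_self]))

theorem IsCokernel.eq {A B Q T : C} {p : B ⟶ Q} {f : A ⟶ B} (h : IsCokernel p f) {w w' : Q ⟶ T}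
    (hw : p ≫ w = p ≫ w') : w = w' :=
  sub_eq_zero.1 (h.epi _ (by rw [Preadditive.comp_sub, hw, sub_self]))

theorem IsKernel.nonempty_isLimit {K A B : C} {i : K ⟶ A} {f : A ⟶ B} (h : IsKernel i f) :
    Nonempty (IsLimit (KernelFork.ofι i h.zero)) :=
  ⟨KernelFork.IsLimit.ofι _ _ (fun τ hτ => (h.lift τ hτ).choose)
    (fun τ hτ => (h.lift τ hτ).choose_spec)
    (fun τ hτ _ hw => h.eq (hw.trans (h.lift τ hτ).choose_spec.symm))⟩

theorem IsCokernel.nonempty_isColimit {A B Q : C} {p : B ⟶ Q} {f : A ⟶ B} (h : IsCokernel p f) :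
    Nonempty (IsColimit (CokernelCofork.ofπ p h.zero)) :=
  ⟨CokernelCofork.IsColimit.ofπ _ _ (fun τ hτ => (h.colift τ hτ).choose)
    (fun τ hτ => (h.colift τ hτ).choose_spec)
    (fun τ hτ _ hw => h.eq (hw.trans (h.colift τ hτ).choose_spec.symm))⟩

/-- The hinge between the two Freyd constructions: cokernels, which the first one always has, supply
the weak kernels that the second one needs. -/
theorem IsCokernel.isWeakKernel_op {A B Q : C} {p : B ⟶ Q} {f : A ⟶ B} (h : IsCokernel p f) :
    IsWeakKernel p.op f.op where
  zero := congrArg Quiver.Hom.op h.zero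
  lift τ hτ := by
    obtain ⟨w, hw⟩ := h.colift τ.unop (congrArg Quiver.Hom.unop hτ)
    exact ⟨w.op, congrArg Quiver.Hom.op hw⟩

variable (C) in
/-- The category is additive. -/
structure IsAdditive : Prop where
  zero : ∃ Z : C, 𝟙 Z = 0
  sum : ∀ X Y : C, Nonempty (SumDiagram X Y)

theorem IsAdditive.op (h : IsAdditive C) : IsAdditive Cᵒᵖ where
  zero := h.zero.elim fun Z hZ => ⟨Opposite.op Z, congrArg Quiver.Hom.op hZ⟩
  sum X Y := (h.sum X.unop Y.unop).map SumDiagram.op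

/-- A criterion for a category to be abelian. -/
theorem isAbelianCategory_of (hC : IsAdditive C)
    (hker : ∀ {A B : C} (f : A ⟶ B), ∃ (K : C) (i : K ⟶ A), IsKernel i f)
    (hcoker : ∀ {A B : C} (f : A ⟶ B), ∃ (Q : C) (p : B ⟶ Q), IsCokernel p f)
    (hmono : ∀ {A B Q T : C} (f : A ⟶ B) (p : B ⟶ Q) (τ : T ⟶ B), Mono f → IsCokernel p f →
      τ ≫ p = 0 → ∃ w, w ≫ f = τ)
    (hepi : ∀ {A B K T : C} (f : A ⟶ B) (i : K ⟶ A) (τ : A ⟶ T), Epi f → IsKernel i f →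
      i ≫ τ = 0 → ∃ w, f ≫ w = τ) :
    IsAbelianCategory C := by
  have : HasZeroObject C := by
    obtain ⟨Z, hZ⟩ := hC.zero
    exact ⟨Z, (IsZero.iff_id_eq_zero Z).2 hZ⟩
  have : HasBinaryBiproducts C := ⟨fun X Y => (hC.sum X Y).elim SumDiagram.hasBinaryBiproduct⟩
  have : HasFiniteProducts C := hasFiniteProducts_of_has_binary_and_terminal
  have : HasKernels C := ⟨fun f => by
    obtain ⟨K, i, h⟩ := hker f
    exact ⟨⟨⟨_, h.nonempty_isLimit.some⟩⟩⟩⟩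
  have : HasCokernels C := ⟨fun f => by
    obtain ⟨K, i, h⟩ := hcoker f
    exact ⟨⟨⟨_, h.nonempty_isColimit.some⟩⟩⟩⟩
  -- By `hmono`, a monomorphism is a kernel of its own cokernel projection; uniqueness of lifts is
  -- the monomorphism property.
  have : IsNormalMonoCategory C := ⟨fun f hf => by
    obtain ⟨Q, p, h⟩ := hcoker f
    have hk : IsKernel f p :=
      { zero := h.zero, lift := fun τ hτ => hmono f p τ hf h hτ,
        mono := fun w hw => by rwa [← cancel_mono f, zero_comp] }
    exact ⟨⟨Q, p, h.zero, hk.nonempty_isLimit.some⟩⟩⟩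
  have : IsNormalEpiCategory C := ⟨fun f hf => by
    obtain ⟨K, i, h⟩ := hker f
    have hk : IsCokernel f i :=
      { zero := h.zero, colift := fun τ hτ => hepi f i τ hf h hτ,
        epi := fun w hw => by rwa [← cancel_epi f, comp_zero] }
    exact ⟨⟨K, i, h.zero, hk.nonempty_isColimit.some⟩⟩⟩
  -- All fields are found by instance search, so the underlying addition is the given one by
  -- definition.
  exact ⟨{}, rfl⟩

end Diagrams

/-! ### The Freyd category of an additive category -/

namespace Freyd

variable {P : Type u} [Category.{v} P] [Preadditive P]

section Hom

variable {X Y Z : Freyd P}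

theorem homMk_eq_zero_iff {α : X.gen ⟶ Y.gen} (h : ∃ w : X.rels ⟶ Y.rels, X.ρ ≫ α = w ≫ Y.ρ) :
    (homMk α h : X ⟶ Y) = 0 ↔ ∃ l : X.gen ⟶ Y.rels, l ≫ Y.ρ = α :=
  (QuotientAddGroup.eq_zero_iff (N := (null X Y).addSubgroupOf (datum X Y)) ⟨α, h⟩).trans Iff.rfl

theorem homMk_eq_iff {α β : X.gen ⟶ Y.gen} (hα : ∃ w : X.rels ⟶ Y.rels, X.ρ ≫ α = w ≫ Y.ρ)
    (hβ : ∃ w : X.rels ⟶ Y.rels, X.ρ ≫ β = w ≫ Y.ρ) :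
    (homMk α hα : X ⟶ Y) = homMk β hβ ↔ ∃ l : X.gen ⟶ Y.rels, l ≫ Y.ρ = α - β := by
  rw [← sub_eq_zero]
  exact homMk_eq_zero_iff ((datum X Y).sub_mem (x := α) (y := β) hα hβ)

theorem comp_witness {α : X.gen ⟶ Y.gen} {β : Y.gen ⟶ Z.gen}
    (hα : ∃ w : X.rels ⟶ Y.rels, X.ρ ≫ α = w ≫ Y.ρ)
    (hβ : ∃ w : Y.rels ⟶ Z.rels, Y.ρ ≫ β = w ≫ Z.ρ) :
    ∃ w : X.rels ⟶ Z.rels, X.ρ ≫ α ≫ β = w ≫ Z.ρ :=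
  comp_mem_datum hα hβ

theorem add_witness {α β : X.gen ⟶ Y.gen} (hα : ∃ w : X.rels ⟶ Y.rels, X.ρ ≫ α = w ≫ Y.ρ)
    (hβ : ∃ w : X.rels ⟶ Y.rels, X.ρ ≫ β = w ≫ Y.ρ) :
    ∃ w : X.rels ⟶ Y.rels, X.ρ ≫ (α + β) = w ≫ Y.ρ :=
  (datum X Y).add_mem hα hβ

theorem sum_witness {ι : Type*} (s : Finset ι) (α : ι → (X.gen ⟶ Y.gen))
    (h : ∀ i, ∃ w : X.rels ⟶ Y.rels, X.ρ ≫ α i = w ≫ Y.ρ) :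
    ∃ w : X.rels ⟶ Y.rels, X.ρ ≫ (∑ i ∈ s, α i) = w ≫ Y.ρ :=
  (datum X Y).sum_mem fun i _ => h i

theorem homMk_comp {α : X.gen ⟶ Y.gen} {β : Y.gen ⟶ Z.gen}
    (hα : ∃ w : X.rels ⟶ Y.rels, X.ρ ≫ α = w ≫ Y.ρ)
    (hβ : ∃ w : Y.rels ⟶ Z.rels, Y.ρ ≫ β = w ≫ Z.ρ) :
    homMk α hα ≫ homMk β hβ = homMk (α ≫ β) (comp_witness hα hβ) := rfl

theorem homMk_add {α β : X.gen ⟶ Y.gen} (hα : ∃ w : X.rels ⟶ Y.rels, X.ρ ≫ α = w ≫ Y.ρ)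
    (hβ : ∃ w : X.rels ⟶ Y.rels, X.ρ ≫ β = w ≫ Y.ρ) :
    (homMk α hα : X ⟶ Y) + homMk β hβ = homMk (α + β) (add_witness hα hβ) := rfl

theorem homMk_id : (homMk (𝟙 X.gen) ⟨𝟙 X.rels, by simp⟩ : X ⟶ X) = 𝟙 X := rfl

theorem homMk_sum {ι : Type*} (s : Finset ι) (α : ι → (X.gen ⟶ Y.gen))
    (h : ∀ i, ∃ w : X.rels ⟶ Y.rels, X.ρ ≫ α i = w ≫ Y.ρ) :
    ∑ i ∈ s, (homMk (α i) (h i) : X ⟶ Y) =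
      homMk (∑ i ∈ s, α i) (sum_witness s α h) := by
  classical
  induction s using Finset.induction_on with
  | empty => rfl
  | insert a s ha ih =>
    rw [Finset.sum_insert ha, ih, homMk_add]
    congr 1
    rw [Finset.sum_insert ha]

end Hom

/-- The zero object of a Freyd category. -/
def zeroObj (Z : P) : Freyd P := ⟨Z, Z, 𝟙 Z⟩

theorem id_zeroObj {Z : P} (hZ : 𝟙 Z = 0) : 𝟙 (zeroObj Z) = 0 := by
  rw [← homMk_id]
  exact (homMk_eq_zero_iff _).2 ⟨0, by rw [zero_comp]; exact hZ.symm⟩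

/-- Direct sums in a Freyd category. -/
def sumDiagram {X Y : Freyd P} (b : SumDiagram X.gen Y.gen) (c : SumDiagram X.rels Y.rels) :
    SumDiagram X Y where
  pt := ⟨b.pt, c.pt, c.desc (X.ρ ≫ b.inl) (Y.ρ ≫ b.inr)⟩
  fst := homMk b.fst ⟨c.fst, by simp [SumDiagram.desc]⟩
  snd := homMk b.snd ⟨c.snd, by simp [SumDiagram.desc]⟩
  inl := homMk b.inl ⟨c.inl, by simp [SumDiagram.desc]⟩
  inr := homMk b.inr ⟨c.inr, by simp [SumDiagram.desc]⟩
  inl_fst := by simp only [homMk_comp, b.inl_fst]; rfl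
  inr_snd := by simp only [homMk_comp, b.inr_snd]; rfl
  inl_snd := by simp only [homMk_comp, b.inl_snd]; rfl
  inr_fst := by simp only [homMk_comp, b.inr_fst]; rfl
  total := by simp only [homMk_comp, homMk_add, b.total]; rfl

theorem isAdditive (hP : IsAdditive P) : IsAdditive (Freyd P) where
  zero := hP.zero.elim fun _ hZ => ⟨_, id_zeroObj hZ⟩
  sum X Y := by
    obtain ⟨b⟩ := hP.sum X.gen Y.gen
    obtain ⟨c⟩ := hP.sum X.rels Y.rels
    exact ⟨sumDiagram b c⟩

/-! ### Cokernels by adding relations -/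

section Cokernel

variable {X Y : Freyd P} (α : X.gen ⟶ Y.gen) (b : SumDiagram Y.rels X.gen)

/-- The cokernel object of a morphism with datum `α`. -/
abbrev cokernelObj : Freyd P := ⟨Y.gen, b.pt, b.desc Y.ρ α⟩

/-- The cokernel projection. -/
def cokernelProj : Y ⟶ cokernelObj α b :=
  homMk (𝟙 Y.gen) ⟨b.inl, by simp [cokernelObj, SumDiagram.desc]⟩

/-- Only direct sums are needed. Since the generators stay the same, a colift has the same datum as
the given morphism; its witness combines the old witness with the homotopy that shows the composite
with `α` to vanish. -/
theorem isCokernel_cokernelProj (h : ∃ w : X.rels ⟶ Y.rels, X.ρ ≫ α = w ≫ Y.ρ) :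
    IsCokernel (cokernelProj α b) (homMk α h) where
  zero := by
    rw [cokernelProj, homMk_comp, homMk_eq_zero_iff]
    exact ⟨b.inr, by simp [cokernelObj, SumDiagram.desc]⟩
  colift {T} τ hτ := by
    obtain ⟨t, w, hw, rfl⟩ := homMk_surj τ
    rw [homMk_comp, homMk_eq_zero_iff] at hτ
    obtain ⟨l, hl⟩ := hτ
    refine ⟨homMk t ⟨b.desc w l, ?_⟩, ?_⟩
    · change b.desc Y.ρ α ≫ t = _
      simp only [SumDiagram.desc, Preadditive.add_comp, Category.assoc, hw, hl]
    · rw [cokernelProj, homMk_comp]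
      congr 1
      exact Category.id_comp t
  epi {T} τ hτ := by
    obtain ⟨t, w, hw, rfl⟩ := homMk_surj τ
    rw [cokernelProj, homMk_comp, homMk_eq_zero_iff] at hτ
    obtain ⟨l, hl⟩ := hτ
    refine (homMk_eq_zero_iff _).2 ⟨l, hl.trans (Category.id_comp t)⟩

end Cokernel

/-! ### Kernels from two successive weak kernels -/

section Kernel

variable {X Y : Freyd P} {α : X.gen ⟶ Y.gen} {b : SumDiagram X.gen Y.rels} {K : P} {i : K ⟶ b.pt}
  {c : SumDiagram K X.rels} {L : P} {j : L ⟶ c.pt}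

/-- The kernel object of a morphism with datum `α`, given by weak kernels in the underlying
category. -/
abbrev kernelObj (c : SumDiagram K X.rels) (j : L ⟶ c.pt) : Freyd P := ⟨K, L, j ≫ c.fst⟩

/-- The weak kernel of `(α, Y.ρ)` is a weak pullback up to sign: it absorbs the pair `(t, -l)`. -/
theorem exists_lift_of_isWeakKernel (hi : IsWeakKernel i (b.desc α Y.ρ)) {T : P} (t : T ⟶ X.gen)
    (l : T ⟶ Y.rels) (h : l ≫ Y.ρ = t ≫ α) : ∃ u : T ⟶ K, u ≫ i ≫ b.fst = t := by
  obtain ⟨u, hu⟩ := hi.lift (t ≫ b.inl - l ≫ b.inr)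
    (by simp [SumDiagram.desc, h])
  refine ⟨u, ?_⟩
  rw [← Category.assoc, hu]
  simp

theorem kernelEmb_witness (i : K ⟶ b.pt) (hj : IsWeakKernel j (c.desc (i ≫ b.fst) X.ρ)) :
    (kernelObj c j).ρ ≫ i ≫ b.fst = (-(j ≫ c.snd)) ≫ X.ρ := by
  have := hj.zero
  simp only [SumDiagram.desc, Preadditive.comp_add] at this
  simp only [kernelObj, Preadditive.neg_comp, Category.assoc]
  exact eq_neg_of_add_eq_zero_left this

/-- The kernel embedding. -/
def kernelEmb (i : K ⟶ b.pt) (hj : IsWeakKernel j (c.desc (i ≫ b.fst) X.ρ)) :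
    kernelObj c j ⟶ X :=
  homMk (i ≫ b.fst) ⟨-(j ≫ c.snd), kernelEmb_witness i hj⟩

/-- The first weak kernel yields generators: everything that `α` sends into the relations of `Y`
factors through `K`. Such factorizations need not be unique, so the second weak kernel takes as
relations everything in `K` that becomes a relation of `X`. This makes the embedding a monomorphism.
-/
theorem isKernel_kernelEmb (hi : IsWeakKernel i (b.desc α Y.ρ))
    (hj : IsWeakKernel j (c.desc (i ≫ b.fst) X.ρ))
    (h : ∃ w : X.rels ⟶ Y.rels, X.ρ ≫ α = w ≫ Y.ρ) :
    IsKernel (kernelEmb i hj) (homMk α h) where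
  zero := by
    rw [kernelEmb, homMk_comp, homMk_eq_zero_iff]
    refine ⟨-(i ≫ b.snd), ?_⟩
    have := hi.zero
    simp only [SumDiagram.desc, Preadditive.comp_add] at this
    simp only [Preadditive.neg_comp, Category.assoc]
    exact (eq_neg_of_add_eq_zero_left this).symm
  lift {T} τ hτ := by
    obtain ⟨t, w, hw, rfl⟩ := homMk_surj τ
    rw [homMk_comp, homMk_eq_zero_iff] at hτ
    obtain ⟨l, hl⟩ := hτ
    obtain ⟨u, hu⟩ := exists_lift_of_isWeakKernel hi t l hl
    -- The relations of `T`, moved to `K` by `u`, become relations of `X` by `w`; the second weak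
    -- kernel turns this into a witness for `u`.
    obtain ⟨v, hv⟩ := hj.lift (T.ρ ≫ u ≫ c.inl - w ≫ c.inr)
      (by simp [SumDiagram.desc, hu, hw])
    refine ⟨homMk u ⟨v, ?_⟩, ?_⟩
    · change T.ρ ≫ u = v ≫ j ≫ c.fst
      rw [← Category.assoc v, hv]
      simp
    · rw [kernelEmb, homMk_comp]
      congr 1
  mono {T} τ hτ := by
    obtain ⟨t, w, hw, rfl⟩ := homMk_surj τ
    rw [kernelEmb, homMk_comp, homMk_eq_zero_iff] at hτ
    obtain ⟨l, hl⟩ := hτ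
    obtain ⟨v, hv⟩ := hj.lift (t ≫ c.inl - l ≫ c.inr)
      (by simp [SumDiagram.desc, hl])
    refine (homMk_eq_zero_iff _).2 ⟨v, ?_⟩
    change v ≫ j ≫ c.fst = t
    rw [← Category.assoc v, hv]
    simp

end Kernel

/-- That `τ` dies in the cokernel means that its datum is a combination of `B.ρ` and `α`. The
coefficient of `α` is the datum of the lift. That it has a witness is where the monomorphism
property enters, tested on an object without relations. -/
theorem exists_lift_of_mono (hP : ∃ Z : P, 𝟙 Z = 0) (hs : ∀ X Y : P, Nonempty (SumDiagram X Y))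
    {A B Q T : Freyd P} (f : A ⟶ B) (p : B ⟶ Q) (τ : T ⟶ B) (hf : Mono f) (hp : IsCokernel p f)
    (hτ : τ ≫ p = 0) : ∃ w, w ≫ f = τ := by
  obtain ⟨α, w, hw, rfl⟩ := homMk_surj f
  obtain ⟨t, v, hv, rfl⟩ := homMk_surj τ
  obtain ⟨b⟩ := hs B.rels A.gen
  -- The explicit cokernel projection factors through the given one, so it kills `τ` as well.
  obtain ⟨c, hc⟩ := hp.colift (cokernelProj α b) (isCokernel_cokernelProj α b ⟨w, hw⟩).zero
  have h0 : homMk t ⟨v, hv⟩ ≫ cokernelProj α b = 0 := by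
    rw [← hc, ← Category.assoc, hτ, zero_comp]
  rw [cokernelProj, homMk_comp, homMk_eq_zero_iff] at h0
  obtain ⟨l, hl⟩ := h0
  obtain ⟨Z, hZ⟩ := hP
  have hl' : l ≫ b.fst ≫ B.ρ + l ≫ b.snd ≫ α = t := by
    simpa [cokernelObj, SumDiagram.desc] using hl
  have hT : ∃ u : T.rels ⟶ A.rels, T.ρ ≫ l ≫ b.snd = u ≫ A.ρ := by
    -- With zero as its relation morphism, every morphism out of `T.rels` is a datum on `D`. The one
    -- at issue vanishes after composition with `f`, hence is null, and a homotopy for it is the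
    -- desired witness.
    let D : Freyd P := ⟨T.rels, Z, 0⟩
    let g : D ⟶ A := homMk (T.ρ ≫ l ≫ b.snd) ⟨0, by simp [D]⟩
    have hg : g = 0 := by
      rw [← cancel_mono (homMk α ⟨w, hw⟩), zero_comp, homMk_comp, homMk_eq_zero_iff]
      refine ⟨v - T.ρ ≫ l ≫ b.fst, ?_⟩
      have := congrArg (T.ρ ≫ ·) hl'
      simp only [Preadditive.comp_add, hv] at this
      simp only [Preadditive.sub_comp, Category.assoc, ← this]
      simp
    obtain ⟨u, hu⟩ := (homMk_eq_zero_iff _).1 hg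
    exact ⟨u, hu.symm⟩
  refine ⟨homMk (l ≫ b.snd) hT, ?_⟩
  rw [homMk_comp, homMk_eq_iff]
  refine ⟨-(l ≫ b.fst), ?_⟩
  rw [← hl']
  simp

/-- For an epimorphism the cokernel projection is zero, so the identity of `B.gen` is a combination
`g₁ ≫ B.ρ + g₂ ≫ α`. The colift has the datum `g₂ ≫ t`: it lifts a generator of `B` to `A` and then
applies `τ`. The choice does not matter because `τ` kills the kernel. -/
theorem exists_colift_of_epi (hs : ∀ X Y : P, Nonempty (SumDiagram X Y))
    (hw : ∀ {A B : P} (f : A ⟶ B), ∃ (K : P) (i : K ⟶ A), IsWeakKernel i f)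
    {A B K T : Freyd P} (f : A ⟶ B) (i : K ⟶ A) (τ : A ⟶ T) (hf : Epi f) (hi : IsKernel i f)
    (hτ : i ≫ τ = 0) : ∃ w, f ≫ w = τ := by
  obtain ⟨α, w, hα, rfl⟩ := homMk_surj f
  obtain ⟨t, v, hv, rfl⟩ := homMk_surj τ
  obtain ⟨b⟩ := hs A.gen B.rels
  obtain ⟨N, n, hn⟩ := hw (b.desc α B.ρ)
  obtain ⟨c⟩ := hs N A.rels
  obtain ⟨M, m, hm⟩ := hw (c.desc (n ≫ b.fst) A.ρ)
  obtain ⟨e, he⟩ := hi.lift (kernelEmb n hm) (isKernel_kernelEmb hn hm ⟨w, hα⟩).zero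
  have h0 : kernelEmb n hm ≫ homMk t ⟨v, hv⟩ = 0 := by
    rw [← he, Category.assoc, hτ, comp_zero]
  rw [kernelEmb, homMk_comp, homMk_eq_zero_iff] at h0
  obtain ⟨l, hl⟩ := h0
  -- Whatever `α` sends into the relations of `B` is sent by `t` into those of `T`, because it
  -- factors through the weak kernel.
  have key : ∀ {S : P} (s : S ⟶ A.gen) (r : S ⟶ B.rels), r ≫ B.ρ = s ≫ α →
      ∃ x : S ⟶ T.rels, x ≫ T.ρ = s ≫ t := by
    intro S s r hr
    obtain ⟨u, hu⟩ := exists_lift_of_isWeakKernel hn s r hr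
    exact ⟨u ≫ l, by rw [Category.assoc, hl, ← hu]; simp⟩
  obtain ⟨d⟩ := hs B.rels A.gen
  have hp : cokernelProj α d = 0 := by
    rw [← cancel_epi (homMk α ⟨w, hα⟩), comp_zero]
    exact (isCokernel_cokernelProj α d ⟨w, hα⟩).zero
  rw [cokernelProj, homMk_eq_zero_iff] at hp
  obtain ⟨g, hg⟩ := hp
  have hg' : g ≫ d.fst ≫ B.ρ + g ≫ d.snd ≫ α = 𝟙 B.gen := by
    simpa [cokernelObj, SumDiagram.desc] using hg
  have hg'' : g ≫ d.snd ≫ α = 𝟙 B.gen - g ≫ d.fst ≫ B.ρ := eq_sub_of_add_eq' hg'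
  -- Composing the decomposition of the identity with `B.ρ` on the left gives the pair for the
  -- witness; composing it with `α` gives, in the next line, the pair for the homotopy between `f`
  -- followed by the colift and `τ`.
  obtain ⟨x, hx⟩ := key (B.ρ ≫ g ≫ d.snd) (𝟙 _ - B.ρ ≫ g ≫ d.fst) (by simp [hg''])
  obtain ⟨y, hy⟩ := key (α ≫ g ≫ d.snd - 𝟙 _) (-(α ≫ g ≫ d.fst)) (by simp [hg''])
  refine ⟨homMk (g ≫ d.snd ≫ t) ⟨x, by simpa using hx.symm⟩, ?_⟩
  rw [homMk_comp, homMk_eq_iff]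
  exact ⟨y, by simpa using hy⟩

theorem isAbelianCategory (hP : IsAdditive P)
    (hw : ∀ {A B : P} (f : A ⟶ B), ∃ (K : P) (i : K ⟶ A), IsWeakKernel i f) :
    IsAbelianCategory (Freyd P) := by
  refine isAbelianCategory_of (isAdditive hP) ?_ ?_
    (exists_lift_of_mono hP.zero hP.sum) (exists_colift_of_epi hP.sum hw)
  · intro X Y f
    obtain ⟨α, w, h, rfl⟩ := homMk_surj f
    obtain ⟨b⟩ := hP.sum X.gen Y.rels
    obtain ⟨N, n, hn⟩ := hw (b.desc α Y.ρ)
    obtain ⟨c⟩ := hP.sum N X.rels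
    obtain ⟨M, m, hm⟩ := hw (c.desc (n ≫ b.fst) X.ρ)
    exact ⟨_, _, isKernel_kernelEmb hn hm ⟨w, h⟩⟩
  · intro X Y f
    obtain ⟨α, w, h, rfl⟩ := homMk_surj f
    obtain ⟨b⟩ := hP.sum Y.rels X.gen
    exact ⟨_, _, isCokernel_cokernelProj α b ⟨w, h⟩⟩

/-- No assumption on weak kernels in `P` enters, which is why coherence of the ring plays no role.
-/
theorem exists_isWeakKernel_op (hP : IsAdditive P) {A B : (Freyd P)ᵒᵖ} (f : A ⟶ B) :
    ∃ (K : (Freyd P)ᵒᵖ) (i : K ⟶ A), IsWeakKernel i f := by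
  obtain ⟨α, w, h, hf⟩ := homMk_surj f.unop
  obtain ⟨b⟩ := hP.sum A.unop.rels B.unop.gen
  have := (isCokernel_cokernelProj α b ⟨w, h⟩).isWeakKernel_op
  rw [hf] at this
  exact ⟨_, _, this⟩

end Freyd

/-! ### Computable additive categories -/

namespace CodedCategory

section Ops

variable {C : Type u} [Category.{v} C] [Preadditive C] (E : CodedCategory C)

/-- Total algorithms for the operations of an additive category. -/
structure AdditiveOps where
  /-- Composition. -/
  comp : (E.Ob × E.Ob × E.Ob) × E.Mor × E.Mor → E.Mor
  /-- Identities. -/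
  idm : E.Ob → E.Mor
  /-- A code of all zero morphisms. -/
  zero : E.Mor
  /-- Addition. -/
  add : (E.Ob × E.Ob) × E.Mor × E.Mor → E.Mor
  /-- Additive inverses. -/
  neg : (E.Ob × E.Ob) × E.Mor → E.Mor
  /-- A zero object. -/
  zeroOb : E.Ob
  /-- Direct sums. -/
  sum : E.Ob × E.Ob → E.Ob
  /-- First projections. -/
  fst : E.Ob × E.Ob → E.Mor
  /-- Second projections. -/
  snd : E.Ob × E.Ob → E.Mor
  /-- First injections. -/
  inl : E.Ob × E.Ob → E.Mor
  /-- Second injections. -/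
  inr : E.Ob × E.Ob → E.Mor
  comp_computable : Computable comp
  idm_computable : Computable idm
  add_computable : Computable add
  neg_computable : Computable neg
  sum_computable : Computable sum
  fst_computable : Computable fst
  snd_computable : Computable snd
  inl_computable : Computable inl
  inr_computable : Computable inr
  hom_comp : ∀ {X Y Z : C} {f : X ⟶ Y} {g : Y ⟶ Z} {x y z : E.Ob} {a b : E.Mor},
    E.obj x X → E.obj y Y → E.obj z Z → E.hom a f → E.hom b g →
    E.hom (comp ((x, y, z), a, b)) (f ≫ g)
  hom_idm : ∀ {X : C} {x : E.Ob}, E.obj x X → E.hom (idm x) (𝟙 X)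
  hom_zero : ∀ X Y : C, E.hom zero (0 : X ⟶ Y)
  hom_add : ∀ {X Y : C} {f g : X ⟶ Y} {x y : E.Ob} {a b : E.Mor},
    E.obj x X → E.obj y Y → E.hom a f → E.hom b g → E.hom (add ((x, y), a, b)) (f + g)
  hom_neg : ∀ {X Y : C} {f : X ⟶ Y} {x y : E.Ob} {a : E.Mor},
    E.obj x X → E.obj y Y → E.hom a f → E.hom (neg ((x, y), a)) (-f)
  obj_zeroOb : ∃ Z : C, E.obj zeroOb Z ∧ 𝟙 Z = 0
  exists_sum : ∀ {X Y : C} {x y : E.Ob}, E.obj x X → E.obj y Y →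
    ∃ b : SumDiagram X Y, E.obj (sum (x, y)) b.pt ∧ E.hom (fst (x, y)) b.fst ∧
      E.hom (snd (x, y)) b.snd ∧ E.hom (inl (x, y)) b.inl ∧ E.hom (inr (x, y)) b.inr

/-- A total algorithm for weak kernels. -/
structure WeakKernelOps where
  /-- The weak kernel object and its embedding. -/
  ker : (E.Ob × E.Ob) × E.Mor → E.Ob × E.Mor
  computable : Computable ker
  spec : ∀ {A B : C} {f : A ⟶ B} {x y : E.Ob} {a : E.Mor}, E.obj x A → E.obj y B → E.hom a f →
    ∃ (K : C) (i : K ⟶ A), E.obj (ker ((x, y), a)).1 K ∧ E.hom (ker ((x, y), a)).2 i ∧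
      IsWeakKernel i f

/-- A total algorithm for kernels. -/
structure KernelOps where
  /-- The kernel object and its embedding. -/
  ker : (E.Ob × E.Ob) × E.Mor → E.Ob × E.Mor
  computable : Computable ker
  spec : ∀ {A B : C} {f : A ⟶ B} {x y : E.Ob} {a : E.Mor}, E.obj x A → E.obj y B → E.hom a f →
    ∃ (K : C) (i : K ⟶ A), E.obj (ker ((x, y), a)).1 K ∧ E.hom (ker ((x, y), a)).2 i ∧
      IsKernel i f

/-- A total algorithm for cokernels. -/
structure CokernelOps where
  /-- The cokernel object and its projection. -/
  coker : (E.Ob × E.Ob) × E.Mor → E.Ob × E.Mor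
  computable : Computable coker
  spec : ∀ {A B : C} {f : A ⟶ B} {x y : E.Ob} {a : E.Mor}, E.obj x A → E.obj y B → E.hom a f →
    ∃ (Q : C) (p : B ⟶ Q), E.obj (coker ((x, y), a)).1 Q ∧ E.hom (coker ((x, y), a)).2 p ∧
      IsCokernel p f

attribute [fun_prop] AdditiveOps.comp_computable AdditiveOps.idm_computable
  AdditiveOps.add_computable AdditiveOps.neg_computable AdditiveOps.sum_computable
  AdditiveOps.fst_computable AdditiveOps.snd_computable AdditiveOps.inl_computable
  AdditiveOps.inr_computable WeakKernelOps.computable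

variable {E}

/-- The code of a morphism out of a direct sum. -/
def AdditiveOps.desc (O : E.AdditiveOps) (q : (E.Ob × E.Ob × E.Ob) × E.Mor × E.Mor) : E.Mor :=
  O.add ((O.sum (q.1.1, q.1.2.1), q.1.2.2),
    O.comp ((O.sum (q.1.1, q.1.2.1), q.1.1, q.1.2.2), O.fst (q.1.1, q.1.2.1), q.2.1),
    O.comp ((O.sum (q.1.1, q.1.2.1), q.1.2.1, q.1.2.2), O.snd (q.1.1, q.1.2.1), q.2.2))

@[fun_prop]
theorem AdditiveOps.desc_computable (O : E.AdditiveOps) : Computable O.desc := by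
  change Computable fun q => O.desc q
  unfold AdditiveOps.desc
  fun_prop

theorem AdditiveOps.hom_desc (O : E.AdditiveOps) {X Y T : C} {f : X ⟶ T} {g : Y ⟶ T}
    {x y t : E.Ob} {a b : E.Mor} (hx : E.obj x X) (hy : E.obj y Y) (ht : E.obj t T)
    (ha : E.hom a f) (hb : E.hom b g) {d : SumDiagram X Y} (hd : E.obj (O.sum (x, y)) d.pt)
    (hf : E.hom (O.fst (x, y)) d.fst) (hs : E.hom (O.snd (x, y)) d.snd) :
    E.hom (O.desc ((x, y, t), a, b)) (d.desc f g) :=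
  O.hom_add hd ht (O.hom_comp hd hx ht hf ha) (O.hom_comp hd hy ht hs hb)

/-- The additive operations of the opposite category. -/
def AdditiveOps.op (O : E.AdditiveOps) : E.op.AdditiveOps where
  comp q := O.comp ((q.1.2.2, q.1.2.1, q.1.1), q.2.2, q.2.1)
  idm := O.idm
  zero := O.zero
  add q := O.add ((q.1.2, q.1.1), q.2)
  neg q := O.neg ((q.1.2, q.1.1), q.2)
  zeroOb := O.zeroOb
  sum := O.sum
  fst := O.inl
  snd := O.inr
  inl := O.fst
  inr := O.snd
  comp_computable := by
    change Computable fun q : (E.Ob × E.Ob × E.Ob) × E.Mor × E.Mor =>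
      O.comp ((q.1.2.2, q.1.2.1, q.1.1), q.2.2, q.2.1)
    fun_prop
  idm_computable := O.idm_computable
  add_computable := by
    change Computable fun q : (E.Ob × E.Ob) × E.Mor × E.Mor => O.add ((q.1.2, q.1.1), q.2)
    fun_prop
  neg_computable := by
    change Computable fun q : (E.Ob × E.Ob) × E.Mor => O.neg ((q.1.2, q.1.1), q.2)
    fun_prop
  sum_computable := O.sum_computable
  fst_computable := O.inl_computable
  snd_computable := O.inr_computable
  inl_computable := O.fst_computable
  inr_computable := O.snd_computable
  hom_comp hx hy hz ha hb := O.hom_comp hz hy hx hb ha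
  hom_idm hx := O.hom_idm hx
  hom_zero X Y := O.hom_zero Y.unop X.unop
  hom_add hx hy ha hb := O.hom_add hy hx ha hb
  hom_neg hx hy ha := O.hom_neg hy hx ha
  obj_zeroOb := O.obj_zeroOb.elim fun Z hZ => ⟨Opposite.op Z, hZ.1, congrArg Quiver.Hom.op hZ.2⟩
  exists_sum hx hy := by
    obtain ⟨b, h1, h2, h3, h4, h5⟩ := O.exists_sum hx hy
    exact ⟨b.op, h1, h4, h5, h2, h3⟩

/-- Cokernels yield weak kernels in the opposite category. -/
def CokernelOps.op (K : E.CokernelOps) : E.op.WeakKernelOps where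
  ker q := K.coker ((q.1.2, q.1.1), q.2)
  computable := by
    have := K.computable
    change Computable fun q : (E.Ob × E.Ob) × E.Mor => K.coker ((q.1.2, q.1.1), q.2)
    fun_prop
  spec hx hy ha := by
    obtain ⟨Q, p, h1, h2, h3⟩ := K.spec hy hx ha
    exact ⟨Opposite.op Q, p.op, h1, h2, h3.isWeakKernel_op⟩

end Ops

/-! ### Algorithms for a Freyd category from those of the underlying category -/

section FreydOps

variable {P : Type u} [Category.{v} P] [Preadditive P] {E : CodedCategory P}

/-- The additive operations of a Freyd category. -/
def AdditiveOps.freyd (O : E.AdditiveOps) : E.freyd.AdditiveOps where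
  comp := fun q : ((E.Ob × E.Ob × E.Mor) × (E.Ob × E.Ob × E.Mor) × (E.Ob × E.Ob × E.Mor)) ×
      (E.Mor × E.Mor) × (E.Mor × E.Mor) =>
    (O.comp ((q.1.1.1, q.1.2.1.1, q.1.2.2.1), q.2.1.1, q.2.2.1),
      O.comp ((q.1.1.2.1, q.1.2.1.2.1, q.1.2.2.2.1), q.2.1.2, q.2.2.2))
  idm := fun x : E.Ob × E.Ob × E.Mor => (O.idm x.1, O.idm x.2.1)
  zero := (O.zero, O.zero)
  add := fun q : ((E.Ob × E.Ob × E.Mor) × (E.Ob × E.Ob × E.Mor)) ×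
      (E.Mor × E.Mor) × (E.Mor × E.Mor) =>
    (O.add ((q.1.1.1, q.1.2.1), q.2.1.1, q.2.2.1),
      O.add ((q.1.1.2.1, q.1.2.2.1), q.2.1.2, q.2.2.2))
  neg := fun q : ((E.Ob × E.Ob × E.Mor) × (E.Ob × E.Ob × E.Mor)) × (E.Mor × E.Mor) =>
    (O.neg ((q.1.1.1, q.1.2.1), q.2.1), O.neg ((q.1.1.2.1, q.1.2.2.1), q.2.2))
  zeroOb := (O.zeroOb, O.zeroOb, O.idm O.zeroOb)
  sum := fun q : (E.Ob × E.Ob × E.Mor) × (E.Ob × E.Ob × E.Mor) =>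
    (O.sum (q.1.1, q.2.1), O.sum (q.1.2.1, q.2.2.1),
      O.desc ((q.1.2.1, q.2.2.1, O.sum (q.1.1, q.2.1)),
        O.comp ((q.1.2.1, q.1.1, O.sum (q.1.1, q.2.1)), q.1.2.2, O.inl (q.1.1, q.2.1)),
        O.comp ((q.2.2.1, q.2.1, O.sum (q.1.1, q.2.1)), q.2.2.2, O.inr (q.1.1, q.2.1))))
  fst := fun q : (E.Ob × E.Ob × E.Mor) × (E.Ob × E.Ob × E.Mor) =>
    (O.fst (q.1.1, q.2.1), O.fst (q.1.2.1, q.2.2.1))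
  snd := fun q : (E.Ob × E.Ob × E.Mor) × (E.Ob × E.Ob × E.Mor) =>
    (O.snd (q.1.1, q.2.1), O.snd (q.1.2.1, q.2.2.1))
  inl := fun q : (E.Ob × E.Ob × E.Mor) × (E.Ob × E.Ob × E.Mor) =>
    (O.inl (q.1.1, q.2.1), O.inl (q.1.2.1, q.2.2.1))
  inr := fun q : (E.Ob × E.Ob × E.Mor) × (E.Ob × E.Ob × E.Mor) =>
    (O.inr (q.1.1, q.2.1), O.inr (q.1.2.1, q.2.2.1))
  comp_computable := by
    change Computable fun q : ((E.Ob × E.Ob × E.Mor) × (E.Ob × E.Ob × E.Mor) ×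
      (E.Ob × E.Ob × E.Mor)) × (E.Mor × E.Mor) × (E.Mor × E.Mor) => (_, _)
    fun_prop
  idm_computable := by
    change Computable fun x : E.Ob × E.Ob × E.Mor => (_, _)
    fun_prop
  add_computable := by
    change Computable fun q : ((E.Ob × E.Ob × E.Mor) × (E.Ob × E.Ob × E.Mor)) ×
      (E.Mor × E.Mor) × (E.Mor × E.Mor) => (_, _)
    fun_prop
  neg_computable := by
    change Computable fun q : ((E.Ob × E.Ob × E.Mor) × (E.Ob × E.Ob × E.Mor)) ×
      (E.Mor × E.Mor) => (_, _)
    fun_prop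
  sum_computable := by
    change Computable fun q : (E.Ob × E.Ob × E.Mor) × (E.Ob × E.Ob × E.Mor) => (_, _, _)
    fun_prop
  fst_computable := by
    change Computable fun q : (E.Ob × E.Ob × E.Mor) × (E.Ob × E.Ob × E.Mor) => (_, _)
    fun_prop
  snd_computable := by
    change Computable fun q : (E.Ob × E.Ob × E.Mor) × (E.Ob × E.Ob × E.Mor) => (_, _)
    fun_prop
  inl_computable := by
    change Computable fun q : (E.Ob × E.Ob × E.Mor) × (E.Ob × E.Ob × E.Mor) => (_, _)
    fun_prop
  inr_computable := by
    change Computable fun q : (E.Ob × E.Ob × E.Mor) × (E.Ob × E.Ob × E.Mor) => (_, _)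
    fun_prop
  hom_comp := by
    rintro X Y Z _ _ x y z a b hx hy hz ⟨f, f', hf, h1, h2, rfl⟩ ⟨g, g', hg, h3, h4, rfl⟩
    exact ⟨f ≫ g, f' ≫ g', by rw [← Category.assoc, hf, Category.assoc, hg, Category.assoc],
      O.hom_comp hx.1 hy.1 hz.1 h1 h3, O.hom_comp hx.2.1 hy.2.1 hz.2.1 h2 h4, rfl⟩
  hom_idm := by
    rintro X x hx
    exact ⟨𝟙 _, 𝟙 _, by simp, O.hom_idm hx.1, O.hom_idm hx.2.1, rfl⟩
  hom_zero X Y := ⟨0, 0, by simp, O.hom_zero _ _, O.hom_zero _ _, rfl⟩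
  hom_add := by
    rintro X Y _ _ x y a b hx hy ⟨f, f', hf, h1, h2, rfl⟩ ⟨g, g', hg, h3, h4, rfl⟩
    exact ⟨f + g, f' + g', by simp [hf, hg], O.hom_add hx.1 hy.1 h1 h3,
      O.hom_add hx.2.1 hy.2.1 h2 h4, rfl⟩
  hom_neg := by
    rintro X Y _ x y a hx hy ⟨f, f', hf, h1, h2, rfl⟩
    exact ⟨-f, -f', by simp [hf], O.hom_neg hx.1 hy.1 h1, O.hom_neg hx.2.1 hy.2.1 h2, rfl⟩
  obj_zeroOb := by
    obtain ⟨Z, hZ, h⟩ := O.obj_zeroOb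
    exact ⟨Freyd.zeroObj Z, ⟨hZ, hZ, O.hom_idm hZ⟩, Freyd.id_zeroObj h⟩
  exists_sum := by
    rintro X Y x y ⟨hx1, hx2, hx3⟩ ⟨hy1, hy2, hy3⟩
    obtain ⟨b, b1, b2, b3, b4, b5⟩ := O.exists_sum hx1 hy1
    obtain ⟨c, c1, c2, c3, c4, c5⟩ := O.exists_sum hx2 hy2
    refine ⟨Freyd.sumDiagram b c, ⟨b1, c1, ?_⟩,
      ⟨b.fst, c.fst, by simp [Freyd.sumDiagram, SumDiagram.desc], b2, c2, rfl⟩,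
      ⟨b.snd, c.snd, by simp [Freyd.sumDiagram, SumDiagram.desc], b3, c3, rfl⟩,
      ⟨b.inl, c.inl, by simp [Freyd.sumDiagram, SumDiagram.desc], b4, c4, rfl⟩,
      ⟨b.inr, c.inr, by simp [Freyd.sumDiagram, SumDiagram.desc], b5, c5, rfl⟩⟩
    exact O.hom_desc hx2 hy2 b1 (O.hom_comp hx2 hx1 b1 hx3 b4) (O.hom_comp hy2 hy1 b1 hy3 b5)
      c1 c2 c3

/-- Cokernels in a Freyd category. -/
def AdditiveOps.freydCokernelOps (O : E.AdditiveOps) : E.freyd.CokernelOps where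
  coker := fun q : ((E.Ob × E.Ob × E.Mor) × (E.Ob × E.Ob × E.Mor)) × (E.Mor × E.Mor) =>
    ((q.1.2.1, O.sum (q.1.2.2.1, q.1.1.1),
      O.desc ((q.1.2.2.1, q.1.1.1, q.1.2.1), q.1.2.2.2, q.2.1)),
      (O.idm q.1.2.1, O.inl (q.1.2.2.1, q.1.1.1)))
  computable := by
    change Computable fun q : ((E.Ob × E.Ob × E.Mor) × (E.Ob × E.Ob × E.Mor)) ×
      (E.Mor × E.Mor) => ((_, _, _), (_, _))
    fun_prop
  spec := by
    rintro X Y _ x y a ⟨hx1, hx2, hx3⟩ ⟨hy1, hy2, hy3⟩ ⟨f, w, hf, h1, h2, rfl⟩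
    obtain ⟨b, b1, b2, b3, b4, b5⟩ := O.exists_sum hy2 hx1
    exact ⟨Freyd.cokernelObj f b, Freyd.cokernelProj f b,
      ⟨hy1, b1, O.hom_desc hy2 hx1 hy1 hy3 h1 b1 b2 b3⟩,
      ⟨𝟙 _, b.inl, by simp [SumDiagram.desc], O.hom_idm hy1, b4, rfl⟩,
      Freyd.isCokernel_cokernelProj f b ⟨w, hf⟩⟩

/-- The code of the kernel of a morphism in a Freyd category. -/
def AdditiveOps.freydKernel (O : E.AdditiveOps) (W : E.WeakKernelOps)
    (q : ((E.Ob × E.Ob × E.Mor) × (E.Ob × E.Ob × E.Mor)) × (E.Mor × E.Mor)) :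
    (E.Ob × E.Ob × E.Mor) × (E.Mor × E.Mor) :=
  let s := O.sum (q.1.1.1, q.1.2.2.1)
  let n := W.ker ((s, q.1.2.1), O.desc ((q.1.1.1, q.1.2.2.1, q.1.2.1), q.2.1, q.1.2.2.2))
  let e := O.comp ((n.1, s, q.1.1.1), n.2, O.fst (q.1.1.1, q.1.2.2.1))
  let t := O.sum (n.1, q.1.1.2.1)
  let m := W.ker ((t, q.1.1.1), O.desc ((n.1, q.1.1.2.1, q.1.1.1), e, q.1.1.2.2))
  ((n.1, m.1, O.comp ((m.1, t, n.1), m.2, O.fst (n.1, q.1.1.2.1))),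
    (e, O.neg ((m.1, q.1.1.2.1),
      O.comp ((m.1, t, q.1.1.2.1), m.2, O.snd (n.1, q.1.1.2.1)))))

theorem AdditiveOps.freydKernel_computable (O : E.AdditiveOps) (W : E.WeakKernelOps) :
    Computable (O.freydKernel W) := by
  change Computable fun q => O.freydKernel W q
  unfold AdditiveOps.freydKernel
  fun_prop

/-- Kernels in a Freyd category. -/
def AdditiveOps.freydKernelOps (O : E.AdditiveOps) (W : E.WeakKernelOps) :
    E.freyd.KernelOps where
  ker := O.freydKernel W
  computable := O.freydKernel_computable W
  spec := by
    rintro X Y _ x y a ⟨hx1, hx2, hx3⟩ ⟨hy1, hy2, hy3⟩ ⟨f, w, hf, h1, h2, rfl⟩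
    obtain ⟨b, b1, b2, b3, b4, b5⟩ := O.exists_sum hx1 hy2
    obtain ⟨N, n, n1, n2, hn⟩ := W.spec b1 hy1 (O.hom_desc hx1 hy2 hy1 h1 hy3 b1 b2 b3)
    obtain ⟨c, c1, c2, c3, c4, c5⟩ := O.exists_sum n1 hx2
    have he := O.hom_comp n1 b1 hx1 n2 b2
    obtain ⟨M, m, m1, m2, hm⟩ := W.spec c1 hx1 (O.hom_desc n1 hx2 hx1 he hx3 c1 c2 c3)
    exact ⟨Freyd.kernelObj c m, Freyd.kernelEmb n hm, ⟨n1, m1, O.hom_comp m1 c1 n1 m2 c2⟩,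
      ⟨n ≫ b.fst, -(m ≫ c.snd), Freyd.kernelEmb_witness n hm, he,
        O.hom_neg m1 hx2 (O.hom_comp m1 c1 hx2 m2 c3), rfl⟩,
      Freyd.isKernel_kernelEmb hn hm ⟨w, hf⟩⟩

end FreydOps

end CodedCategory

/-! ### Computable families of linear systems -/

/-- A linear system `∑ j, α i j ≫ X j ≫ β i j = γ i` with arbitrary index types. -/
structure IndexedSystem (C : Type u) [Category.{v} C] (I J : Type) where
  /-- Sources of the equations. -/
  A : I → C
  /-- Targets of the equations. -/
  D : I → C
  /-- Sources of the indeterminates. -/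
  S : J → C
  /-- Targets of the indeterminates. -/
  T : J → C
  /-- Left coefficients. -/
  α : ∀ i j, A i ⟶ S j
  /-- Right coefficients. -/
  β : ∀ i j, T j ⟶ D i
  /-- Right-hand sides. -/
  γ : ∀ i, A i ⟶ D i

/-- A family of morphisms solves a linear system. -/
def IndexedSystem.IsSolution {C : Type u} [Category.{v} C] [Preadditive C] {I J : Type}
    [Fintype J] (L : IndexedSystem C I J) (X : ∀ j, L.S j ⟶ L.T j) : Prop :=
  ∀ i, ∑ j, L.α i j ≫ X j ≫ L.β i j = L.γ i

namespace CodedCategory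

section Systems

variable {C : Type u} [Category.{v} C] [Preadditive C] (E : CodedCategory C)

/-- A family of codes of linear systems that depends computably on a parameter. The equations and
the indeterminates have names in `ι` and `κ`. -/
structure SystemFamily (α ι κ : Type) [Primcodable α] [Primcodable ι] [Primcodable κ] where
  /-- The names of the equations. -/
  eqs : α → List ι
  /-- The names of the indeterminates. -/
  vars : α → List κ
  /-- Source and target of an equation. -/
  eqOb : α → ι → E.Ob × E.Ob
  /-- Source and target of an indeterminate. -/
  varOb : α → κ → E.Ob × E.Ob
  /-- The coefficients. -/
  coeff : α → ι → κ → E.Mor × E.Mor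
  /-- The right-hand sides. -/
  rhs : α → ι → E.Mor
  eqs_computable : Computable eqs
  vars_computable : Computable vars
  eqOb_computable : Computable fun q : α × ι => eqOb q.1 q.2
  varOb_computable : Computable fun q : α × κ => varOb q.1 q.2
  coeff_computable : Computable fun q : α × ι × κ => coeff q.1 q.2.1 q.2.2
  rhs_computable : Computable fun q : α × ι => rhs q.1 q.2

variable {E}

/-- The family stands at the parameter `p` for the linear system `L`, whose equations and
indeterminates are named by `c` and `d`. -/
structure SystemFamily.Codes {α ι κ : Type} [Primcodable α] [Primcodable ι] [Primcodable κ]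
    (F : E.SystemFamily α ι κ) (p : α) {I J : Type} (L : IndexedSystem C I J) (c : I → ι)
    (d : J → κ) : Prop where
  inj_eqs : Function.Injective c
  inj_vars : Function.Injective d
  nodup_eqs : (F.eqs p).Nodup
  nodup_vars : (F.vars p).Nodup
  mem_eqs : ∀ i, i ∈ F.eqs p ↔ ∃ i', c i' = i
  mem_vars : ∀ j, j ∈ F.vars p ↔ ∃ j', d j' = j
  obj_A : ∀ i, E.obj (F.eqOb p (c i)).1 (L.A i)
  obj_D : ∀ i, E.obj (F.eqOb p (c i)).2 (L.D i)
  obj_S : ∀ j, E.obj (F.varOb p (d j)).1 (L.S j)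
  obj_T : ∀ j, E.obj (F.varOb p (d j)).2 (L.T j)
  hom_α : ∀ i j, E.hom (F.coeff p (c i) (d j)).1 (L.α i j)
  hom_β : ∀ i j, E.hom (F.coeff p (c i) (d j)).2 (L.β i j)
  hom_γ : ∀ i, E.hom (F.rhs p (c i)) (L.γ i)

variable (E)

/-- Every computable family of linear systems can be solved by an algorithm. A solution is coded by
a natural number, from which the codes of the morphisms are read off by `get`. -/
def SolvesFamilies : Prop :=
  ∀ (α ι κ : Type) [Primcodable α] [Primcodable ι] [Primcodable κ] (F : E.SystemFamily α ι κ),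
    ∃ (φ : α →. Option ℕ) (get : (α × ℕ) × κ → E.Mor), Partrec φ ∧ Computable get ∧
      ∀ (p : α) {I J : Type} [Fintype J] (L : IndexedSystem C I J) (c : I → ι) (d : J → κ),
        F.Codes p L c d →
        (∃ s, some s ∈ φ p ∧ ∃ X : ∀ j, L.S j ⟶ L.T j, (∀ j, E.hom (get ((p, s), d j)) (X j)) ∧
          L.IsSolution X) ∨
        (none ∈ φ p ∧ ¬ ∃ X : ∀ j, L.S j ⟶ L.T j, L.IsSolution X)

end Systems

section Op

variable {C : Type u} [Category.{v} C] [Preadditive C] {E : CodedCategory C}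

/-- Reversing arrows exchanges sources with targets and left with right coefficients, so the same
solver applies to swapped codes. -/
theorem SolvesFamilies.op (hE : E.SolvesFamilies) : E.op.SolvesFamilies := by
  intro α ι κ _ _ _ F
  obtain ⟨φ, get, hφ, hget, h⟩ := hE α ι κ
    { eqs := F.eqs
      vars := F.vars
      eqOb := fun p i => ((F.eqOb p i).2, (F.eqOb p i).1)
      varOb := fun p j => ((F.varOb p j).2, (F.varOb p j).1)
      coeff := fun p i j => ((F.coeff p i j).2, (F.coeff p i j).1)
      rhs := F.rhs
      eqs_computable := F.eqs_computable
      vars_computable := F.vars_computable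
      eqOb_computable := (Computable.snd.comp F.eqOb_computable).pair
        (Computable.fst.comp F.eqOb_computable)
      varOb_computable := (Computable.snd.comp F.varOb_computable).pair
        (Computable.fst.comp F.varOb_computable)
      coeff_computable := (Computable.snd.comp F.coeff_computable).pair
        (Computable.fst.comp F.coeff_computable)
      rhs_computable := F.rhs_computable }
  refine ⟨φ, get, hφ, hget, fun p I J _ L c d hL => ?_⟩
  let L' : IndexedSystem C I J :=
    { A := fun i => (L.D i).unop
      D := fun i => (L.A i).unop
      S := fun j => (L.T j).unop
      T := fun j => (L.S j).unop
      α := fun i j => (L.β i j).unop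
      β := fun i j => (L.α i j).unop
      γ := fun i => (L.γ i).unop }
  have key : ∀ X : ∀ j, L.S j ⟶ L.T j, L'.IsSolution (fun j => (X j).unop) ↔ L.IsSolution X := by
    intro X
    refine forall_congr' fun i => ?_
    rw [← Quiver.Hom.unop_inj.eq_iff, unop_sum]
    simp [L']
  rcases h p L' c d ⟨hL.inj_eqs, hL.inj_vars, hL.nodup_eqs, hL.nodup_vars, hL.mem_eqs,
    hL.mem_vars, hL.obj_D, hL.obj_A, hL.obj_T, hL.obj_S, hL.hom_β, hL.hom_α, hL.hom_γ⟩ with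
    ⟨s, hs, X, hX, hsol⟩ | ⟨hn, hsol⟩
  · exact Or.inl ⟨s, hs, fun j => (X j).op, hX, (key fun j => (X j).op).1 hsol⟩
  · exact Or.inr ⟨hn, fun ⟨X, hX⟩ => hsol ⟨_, (key X).2 hX⟩⟩

end Op

section FreydSystems

variable {P : Type u} [Category.{v} P] [Preadditive P]

/-- A morphism between the members of a family at equal indices. -/
noncomputable def diagonal {I : Type} {A B : I → P} (f : ∀ i, A i ⟶ B i) (i j : I) : A i ⟶ B j :=
  open Classical in if h : i = j then f i ≫ eqToHom (by rw [h]) else 0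

@[simp]
theorem diagonal_self {I : Type} {A B : I → P} (f : ∀ i, A i ⟶ B i) (i : I) :
    diagonal f i i = f i := by
  simp [diagonal]

theorem diagonal_of_ne {I : Type} {A B : I → P} (f : ∀ i, A i ⟶ B i) {i j : I} (h : i ≠ j) :
    diagonal f i j = 0 := by
  simp [diagonal, h]

/-- Diagonal coefficients let an auxiliary indeterminate occur only in the equation to which it
belongs. -/
theorem sum_diagonal {I : Type} [Fintype I] {A B C D : I → P} (f : ∀ i, A i ⟶ B i)
    (X : ∀ i, B i ⟶ C i) (g : ∀ i, C i ⟶ D i) (i : I) :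
    ∑ j, diagonal f i j ≫ X j ≫ diagonal g j i = f i ≫ X i ≫ g i := by
  rw [Finset.sum_eq_single i]
  · simp
  · intro j _ hj
    rw [diagonal_of_ne f hj.symm, zero_comp]
  · simp

/-- The linear system in the underlying category for the data, the witnesses and the homotopies
of a solution in the Freyd category. -/
noncomputable def freydSystem {I J : Type} (L : IndexedSystem (Freyd P) I J)
    (a : ∀ i j, (L.A i).gen ⟶ (L.S j).gen) (b : ∀ i j, (L.T j).gen ⟶ (L.D i).gen)
    (g : ∀ i, (L.A i).gen ⟶ (L.D i).gen) : IndexedSystem P (I ⊕ J) (J ⊕ J ⊕ I) where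
  A := Sum.elim (fun i => (L.A i).gen) (fun j => (L.S j).rels)
  D := Sum.elim (fun i => (L.D i).gen) (fun j => (L.T j).gen)
  S := Sum.elim (fun j => (L.S j).gen) (Sum.elim (fun j => (L.S j).rels) (fun i => (L.A i).gen))
  T := Sum.elim (fun j => (L.T j).gen) (Sum.elim (fun j => (L.T j).rels) (fun i => (L.D i).rels))
  α
    | .inl i, .inl j => a i j
    | .inl _, .inr (.inl _) => 0
    | .inl i, .inr (.inr i') => diagonal (fun i => 𝟙 (L.A i).gen) i i'
    | .inr j, .inl j' => diagonal (fun j => (L.S j).ρ) j j'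
    | .inr j, .inr (.inl j') => diagonal (fun j => -𝟙 (L.S j).rels) j j'
    | .inr _, .inr (.inr _) => 0
  β
    | .inl i, .inl j => b i j
    | .inl _, .inr (.inl _) => 0
    | .inl i, .inr (.inr i') => diagonal (fun i => (L.D i).ρ) i' i
    | .inr j, .inl j' => diagonal (fun j => 𝟙 (L.T j).gen) j' j
    | .inr j, .inr (.inl j') => diagonal (fun j => (L.T j).ρ) j' j
    | .inr _, .inr (.inr _) => 0
  γ
    | .inl i => g i
    | .inr _ => 0

/-- The indeterminates of the system of data, witnesses and homotopies. -/
def freydSolution {I J : Type} (L : IndexedSystem (Freyd P) I J)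
    (a : ∀ i j, (L.A i).gen ⟶ (L.S j).gen) (b : ∀ i j, (L.T j).gen ⟶ (L.D i).gen)
    (g : ∀ i, (L.A i).gen ⟶ (L.D i).gen) (x : ∀ j, (L.S j).gen ⟶ (L.T j).gen)
    (w : ∀ j, (L.S j).rels ⟶ (L.T j).rels) (l : ∀ i, (L.A i).gen ⟶ (L.D i).rels) :
    ∀ j, (freydSystem L a b g).S j ⟶ (freydSystem L a b g).T j
  | .inl j => x j
  | .inr (.inl j) => w j
  | .inr (.inr i) => l i

/-- The two groups of equations separate: those from `I` are the original ones up to a homotopy `l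
i`, and those from `J` say that `w j` is a witness for `x j`. -/
theorem freydSystem_isSolution_iff {I J : Type} [Fintype I] [Fintype J]
    (L : IndexedSystem (Freyd P) I J)
    (a : ∀ i j, (L.A i).gen ⟶ (L.S j).gen) (b : ∀ i j, (L.T j).gen ⟶ (L.D i).gen)
    (g : ∀ i, (L.A i).gen ⟶ (L.D i).gen) (x : ∀ j, (L.S j).gen ⟶ (L.T j).gen)
    (w : ∀ j, (L.S j).rels ⟶ (L.T j).rels) (l : ∀ i, (L.A i).gen ⟶ (L.D i).rels) :
    (freydSystem L a b g).IsSolution (freydSolution L a b g x w l) ↔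
      (∀ i, ∑ j, a i j ≫ x j ≫ b i j + l i ≫ (L.D i).ρ = g i) ∧
      ∀ j, (L.S j).ρ ≫ x j = w j ≫ (L.T j).ρ := by
  refine Sum.forall.trans (and_congr (forall_congr' fun i => ?_) (forall_congr' fun j => ?_))
  · simp only [Fintype.sum_sum_type]
    change ∑ j, a i j ≫ x j ≫ b i j + (∑ j, (0 : (L.A i).gen ⟶ (L.S j).rels) ≫ w j ≫
      (0 : (L.T j).rels ⟶ (L.D i).gen) + ∑ i', diagonal (fun i => 𝟙 (L.A i).gen) i i' ≫ l i' ≫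
        diagonal (fun i => (L.D i).ρ) i' i) = g i ↔ _
    rw [sum_diagonal]
    simp
  · simp only [Fintype.sum_sum_type]
    change ∑ j', diagonal (fun j => (L.S j).ρ) j j' ≫ x j' ≫
        diagonal (fun j => 𝟙 (L.T j).gen) j' j +
      (∑ j', diagonal (fun j => -𝟙 (L.S j).rels) j j' ≫ w j' ≫ diagonal (fun j => (L.T j).ρ) j' j +
        ∑ i, (0 : (L.S j).rels ⟶ (L.A i).gen) ≫ l i ≫ (0 : (L.D i).rels ⟶ (L.T j).gen)) = 0 ↔ _
    rw [sum_diagonal, sum_diagonal]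
    simp [← sub_eq_add_neg, sub_eq_zero]

/-- Equality in the Freyd category is equality of data up to something that factors through the
relations of the target; this term becomes a further indeterminate. -/
theorem isSolution_homMk_iff {I J : Type} [Fintype I] [Fintype J]
    (L : IndexedSystem (Freyd P) I J)
    (a : ∀ i j, (L.A i).gen ⟶ (L.S j).gen) (b : ∀ i j, (L.T j).gen ⟶ (L.D i).gen)
    (g : ∀ i, (L.A i).gen ⟶ (L.D i).gen)
    (ha : ∀ i j, ∃ h, Freyd.homMk (a i j) h = L.α i j)
    (hb : ∀ i j, ∃ h, Freyd.homMk (b i j) h = L.β i j)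
    (hg : ∀ i, ∃ h, Freyd.homMk (g i) h = L.γ i)
    (x : ∀ j, (L.S j).gen ⟶ (L.T j).gen) (w : ∀ j, (L.S j).rels ⟶ (L.T j).rels)
    (h : ∀ j, (L.S j).ρ ≫ x j = w j ≫ (L.T j).ρ) :
    L.IsSolution (fun j => Freyd.homMk (x j) ⟨w j, h j⟩) ↔
      ∀ i, ∃ l : (L.A i).gen ⟶ (L.D i).rels, ∑ j, a i j ≫ x j ≫ b i j + l ≫ (L.D i).ρ = g i := by
  refine forall_congr' fun i => ?_
  choose ha' ha using ha
  choose hb' hb using hb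
  choose hg' hg using hg
  simp only [← ha, ← hb, ← hg, Freyd.homMk_comp]
  rw [Freyd.homMk_sum, Freyd.homMk_eq_iff]
  refine ⟨fun ⟨l, hl⟩ => ⟨-l, ?_⟩, fun ⟨l, hl⟩ => ⟨-l, ?_⟩⟩
  · rw [Preadditive.neg_comp, hl]
    abel
  · rw [Preadditive.neg_comp, ← hl]
    abel

variable {E : CodedCategory P}

section Family

variable {α ι κ : Type} [Primcodable α] [Primcodable ι] [Primcodable κ]

/-- Codes of the system of data, witnesses and homotopies. -/
def AdditiveOps.freydFamily (O : E.AdditiveOps) [DecidableEq ι] [DecidableEq κ]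
    (F : E.freyd.SystemFamily α ι κ) : E.SystemFamily α (ι ⊕ κ) (κ ⊕ κ ⊕ ι) :=
  let eqOb : α → ι → (E.Ob × E.Ob × E.Mor) × (E.Ob × E.Ob × E.Mor) := F.eqOb
  let varOb : α → κ → (E.Ob × E.Ob × E.Mor) × (E.Ob × E.Ob × E.Mor) := F.varOb
  let coeff : α → ι → κ → (E.Mor × E.Mor) × (E.Mor × E.Mor) := F.coeff
  let rhs : α → ι → E.Mor × E.Mor := F.rhs
  have eqs_computable := F.eqs_computable
  have vars_computable := F.vars_computable
  have eqOb_computable : Computable fun q : α × ι => eqOb q.1 q.2 := F.eqOb_computable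
  have varOb_computable : Computable fun q : α × κ => varOb q.1 q.2 := F.varOb_computable
  have coeff_computable : Computable fun q : α × ι × κ => coeff q.1 q.2.1 q.2.2 :=
    F.coeff_computable
  have rhs_computable : Computable fun q : α × ι => rhs q.1 q.2 := F.rhs_computable
  { eqs := fun p => (F.eqs p).map Sum.inl ++ (F.vars p).map Sum.inr
    vars := fun p => (F.vars p).map Sum.inl ++
      ((F.vars p).map (fun j => Sum.inr (Sum.inl j)) ++
        (F.eqs p).map (fun i => Sum.inr (Sum.inr i)))
    eqOb := fun p => Sum.elim (fun i => ((eqOb p i).1.1, (eqOb p i).2.1))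
      (fun j => ((varOb p j).1.2.1, (varOb p j).2.1))
    varOb := fun p => Sum.elim (fun j => ((varOb p j).1.1, (varOb p j).2.1))
      (Sum.elim (fun j => ((varOb p j).1.2.1, (varOb p j).2.2.1))
        (fun i => ((eqOb p i).1.1, (eqOb p i).2.2.1)))
    coeff := fun p i j => Sum.elim
      (fun i => Sum.elim (fun j => ((coeff p i j).1.1, (coeff p i j).2.1))
        (Sum.elim (fun _ => (O.zero, O.zero))
          (fun i' => if i = i' then (O.idm (eqOb p i).1.1, (eqOb p i).2.2.2)
            else (O.zero, O.zero))) j)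
      (fun j' => Sum.elim (fun j => if j' = j then ((varOb p j).1.2.2, O.idm (varOb p j).2.1)
          else (O.zero, O.zero))
        (Sum.elim (fun j => if j' = j then
            (O.neg (((varOb p j).1.2.1, (varOb p j).1.2.1), O.idm (varOb p j).1.2.1),
              (varOb p j).2.2.2) else (O.zero, O.zero))
          (fun _ => (O.zero, O.zero))) j) i
    rhs := fun p => Sum.elim (fun i => (rhs p i).1) (fun _ => O.zero)
    eqs_computable := by fun_prop
    vars_computable := by fun_prop
    eqOb_computable := by fun_prop
    varOb_computable := by fun_prop
    coeff_computable := by fun_prop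
    rhs_computable := by fun_prop }

/-- The program tests equality of names where the system tests equality of indices. The two agree
since the naming is injective. -/
theorem AdditiveOps.freydFamily_codes (O : E.AdditiveOps) [DecidableEq ι] [DecidableEq κ]
    {F : E.freyd.SystemFamily α ι κ} {p : α} {I J : Type} {L : IndexedSystem (Freyd P) I J}
    {c : I → ι} {d : J → κ} (hF : F.Codes p L c d)
    {a : ∀ i j, (L.A i).gen ⟶ (L.S j).gen} {b : ∀ i j, (L.T j).gen ⟶ (L.D i).gen}
    {g : ∀ i, (L.A i).gen ⟶ (L.D i).gen}
    (ha : ∀ i j, E.hom (F.coeff p (c i) (d j)).1.1 (a i j))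
    (hb : ∀ i j, E.hom (F.coeff p (c i) (d j)).2.1 (b i j))
    (hg : ∀ i, E.hom (F.rhs p (c i)).1 (g i)) :
    (O.freydFamily F).Codes p (freydSystem L a b g) (Sum.map c d)
      (Sum.map d (Sum.map d c)) where
  inj_eqs := hF.inj_eqs.sumMap hF.inj_vars
  inj_vars := hF.inj_vars.sumMap (hF.inj_vars.sumMap hF.inj_eqs)
  nodup_eqs := by
    refine List.Nodup.append (hF.nodup_eqs.map Sum.inl_injective)
      (hF.nodup_vars.map Sum.inr_injective) ?_
    simp [List.disjoint_left]
  nodup_vars := by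
    refine List.Nodup.append (hF.nodup_vars.map Sum.inl_injective) (List.Nodup.append
      (hF.nodup_vars.map (Sum.inr_injective.comp Sum.inl_injective))
      (hF.nodup_eqs.map (Sum.inr_injective.comp Sum.inr_injective)) ?_) ?_
    · simp [List.disjoint_left]
    · simp [List.disjoint_left]
  mem_eqs := by
    rintro (i | j)
    · simp [freydFamily, hF.mem_eqs]
    · simp [freydFamily, hF.mem_vars]
  mem_vars := by
    rintro (j | j | i)
    · simp [freydFamily, hF.mem_vars]
    · simp [freydFamily, hF.mem_vars]
    · simp [freydFamily, hF.mem_eqs]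
  obj_A := by
    rintro (i | j)
    · exact (hF.obj_A i).1
    · exact (hF.obj_S j).2.1
  obj_D := by
    rintro (i | j)
    · exact (hF.obj_D i).1
    · exact (hF.obj_T j).1
  obj_S := by
    rintro (j | j | i)
    · exact (hF.obj_S j).1
    · exact (hF.obj_S j).2.1
    · exact (hF.obj_A i).1
  obj_T := by
    rintro (j | j | i)
    · exact (hF.obj_T j).1
    · exact (hF.obj_T j).2.1
    · exact (hF.obj_D i).2.1
  hom_α := by
    rintro (i | j) (j' | j' | i')
    · exact ha i j'
    · exact O.hom_zero _ _
    · by_cases h : i = i'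
      · subst h
        simpa [freydFamily, freydSystem] using O.hom_idm (hF.obj_A i).1
      · simpa [freydFamily, freydSystem, hF.inj_eqs.ne h, diagonal_of_ne _ h]
          using O.hom_zero _ _
    · by_cases h : j = j'
      · subst h
        simpa [freydFamily, freydSystem] using (hF.obj_S j).2.2
      · simpa [freydFamily, freydSystem, hF.inj_vars.ne h, diagonal_of_ne _ h]
          using O.hom_zero _ _
    · by_cases h : j = j'
      · subst h
        simpa [freydFamily, freydSystem] using O.hom_neg (hF.obj_S j).2.1 (hF.obj_S j).2.1
          (O.hom_idm (hF.obj_S j).2.1)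
      · simpa [freydFamily, freydSystem, hF.inj_vars.ne h, diagonal_of_ne _ h]
          using O.hom_zero _ _
    · exact O.hom_zero _ _
  hom_β := by
    rintro (i | j) (j' | j' | i')
    · exact hb i j'
    · exact O.hom_zero _ _
    · by_cases h : i = i'
      · subst h
        simpa [freydFamily, freydSystem] using (hF.obj_D i).2.2
      · simpa [freydFamily, freydSystem, hF.inj_eqs.ne h, diagonal_of_ne _ (Ne.symm h)]
          using O.hom_zero _ _
    · by_cases h : j = j'
      · subst h
        simpa [freydFamily, freydSystem] using O.hom_idm (hF.obj_T j).1
      · simpa [freydFamily, freydSystem, hF.inj_vars.ne h, diagonal_of_ne _ (Ne.symm h)]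
          using O.hom_zero _ _
    · by_cases h : j = j'
      · subst h
        simpa [freydFamily, freydSystem] using (hF.obj_T j).2.2
      · simpa [freydFamily, freydSystem, hF.inj_vars.ne h, diagonal_of_ne _ (Ne.symm h)]
          using O.hom_zero _ _
    · exact O.hom_zero _ _
  hom_γ := by
    rintro (i | j)
    · exact hg i
    · exact O.hom_zero _ _

end Family

/-- The indeterminates read off are the data and the witnesses; the homotopies only certify the
equations. Names in `ι` and `κ` need no renumbering when the new equations and indeterminates are
formed as sums of types, so the construction can be iterated. -/
theorem SolvesFamilies.freyd (hE : E.SolvesFamilies) (O : E.AdditiveOps) :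
    E.freyd.SolvesFamilies := by
  intro α ι κ _ _ _ F
  classical
  obtain ⟨φ, get, hφ, hget, h⟩ := hE _ _ _ (O.freydFamily F)
  refine ⟨φ, fun q => (get (q.1, Sum.inl q.2), get (q.1, Sum.inr (Sum.inl q.2))), hφ, ?_, ?_⟩
  · change Computable fun q : (α × ℕ) × κ => (_, _)
    fun_prop
  intro p I J _ L c d hF
  -- The equations are named injectively by members of a list.
  have : Finite I := by
    refine Finite.of_injective (fun i => (⟨c i, (hF.mem_eqs _).2 ⟨i, rfl⟩⟩ : {i // i ∈ F.eqs p}))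
      fun i j hij => hF.inj_eqs (congrArg Subtype.val hij)
  have := Fintype.ofFinite I
  choose a wa ha ha1 _ ha2 using hF.hom_α
  choose b wb hb hb1 _ hb2 using hF.hom_β
  choose g wg hg hg1 _ hg2 using hF.hom_γ
  have key := isSolution_homMk_iff L a b g (fun i j => ⟨_, ha2 i j⟩) (fun i j => ⟨_, hb2 i j⟩)
    (fun i => ⟨_, hg2 i⟩)
  rcases h p (freydSystem L a b g) (Sum.map c d) (Sum.map d (Sum.map d c))
    (O.freydFamily_codes hF ha1 hb1 hg1) with ⟨s, hs, X, hX, hsol⟩ | ⟨hn, hsol⟩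
  · left
    have hXe : X = freydSolution L a b g (fun j => X (.inl j)) (fun j => X (.inr (.inl j)))
        (fun i => X (.inr (.inr i))) := by
      funext k
      rcases k with j | j | i <;> rfl
    rw [hXe] at hsol
    replace hsol := (freydSystem_isSolution_iff L a b g _ _ _).1 hsol
    refine ⟨s, hs, fun j => Freyd.homMk (X (.inl j)) ⟨X (.inr (.inl j)), hsol.2 j⟩,
      fun j => ⟨X (.inl j), X (.inr (.inl j)), hsol.2 j, hX (.inl j), hX (.inr (.inl j)), rfl⟩,
      (key _ _ hsol.2).2 fun i => ⟨_, hsol.1 i⟩⟩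
  · right
    refine ⟨hn, fun ⟨Y, hY⟩ => hsol ?_⟩
    choose x w hw hxw using fun j => Freyd.homMk_surj (Y j)
    obtain rfl : (fun j => Freyd.homMk (x j) ⟨w j, hw j⟩) = Y := funext hxw
    choose l hl using (key x w hw).1 hY
    exact ⟨_, (freydSystem_isSolution_iff L a b g x w l).2 ⟨hl, hw⟩⟩

end FreydSystems

end CodedCategory

/-! ### Computable abelian categories -/

namespace CodedCategory

variable {C : Type u} [Category.{v} C] [Preadditive C] {E : CodedCategory C}

variable (E) in
/-- Codes of linear systems. -/
abbrev SystemCode : Type :=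
  (List (E.Ob × E.Ob) × List (E.Ob × E.Ob)) × List (List (E.Mor × E.Mor)) × List E.Mor

variable (E) in
/-- Codes of equations with one indeterminate. -/
abbrev EquationCode : Type :=
  ((E.Ob × E.Ob) × (E.Ob × E.Ob)) × (E.Mor × E.Mor) × E.Mor

theorem SolvesFamilies.hasDecidableLinearSystems (hE : E.SolvesFamilies) (O : E.AdditiveOps) :
    E.HasDecidableLinearSystems := by
  obtain ⟨φ, get, hφ, hget, h⟩ := hE E.SystemCode ℕ ℕ
    -- Equations and indeterminates are named by their positions in the input lists; on valid inputs
    -- the default values are never read.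
    { eqs := fun p => List.range p.1.1.length
      vars := fun p => List.range p.1.2.length
      eqOb := fun p i => p.1.1.getD i (O.zeroOb, O.zeroOb)
      varOb := fun p j => p.1.2.getD j (O.zeroOb, O.zeroOb)
      coeff := fun p i j => (p.2.1.getD i []).getD j (O.zero, O.zero)
      rhs := fun p i => p.2.2.getD i O.zero
      eqs_computable := by fun_prop
      vars_computable := by fun_prop
      eqOb_computable := by fun_prop
      varOb_computable := by fun_prop
      coeff_computable := by fun_prop
      rhs_computable := by fun_prop }
  refine ⟨fun p => (φ p).map fun o => o.map fun s =>
    (List.range p.1.2.length).map fun j => get ((p, s), j), ?_, ?_⟩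
  · refine Partrec.map hφ ?_
    change Computable fun q : E.SystemCode × Option ℕ => q.2.map fun s =>
      (List.range q.1.1.2.length).map fun j => get ((q.1, s), j)
    fun_prop
  intro m n L x y a g hx hy ha hg
  set p : E.SystemCode := ((List.ofFn x, List.ofFn y), List.ofFn fun i => List.ofFn (a i),
    List.ofFn g) with hp
  have key := h p (I := Fin m) (J := Fin n)
    { A := L.A, D := L.D, S := L.S, T := L.T, α := L.α, β := L.β, γ := L.γ }
    (fun i => (i : ℕ)) (fun j => (j : ℕ))
    { inj_eqs := Fin.val_injective
      inj_vars := Fin.val_injective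
      nodup_eqs := List.nodup_range
      nodup_vars := List.nodup_range
      mem_eqs := fun i => by
        simpa [hp] using ⟨fun hi => ⟨⟨i, hi⟩, rfl⟩, fun ⟨j, hj⟩ => hj ▸ j.2⟩
      mem_vars := fun i => by
        simpa [hp] using ⟨fun hi => ⟨⟨i, hi⟩, rfl⟩, fun ⟨j, hj⟩ => hj ▸ j.2⟩
      obj_A := fun i => by simpa [hp] using (hx i).1
      obj_D := fun i => by simpa [hp] using (hx i).2
      obj_S := fun j => by simpa [hp] using (hy j).1
      obj_T := fun j => by simpa [hp] using (hy j).2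
      hom_α := fun i j => by simpa [hp] using (ha i j).1
      hom_β := fun i j => by simpa [hp] using (ha i j).2
      hom_γ := fun i => by simpa [hp] using hg i }
  rcases key with ⟨s, hs, X, hX, hsol⟩ | ⟨hn, hsol⟩
  · refine Or.inl ⟨fun j => get ((p, s), (j : ℕ)), ?_, X, hX, hsol⟩
    refine (Part.mem_map_iff _).2 ⟨some s, hs, ?_⟩
    simp only [Option.map_some, Option.some.injEq]
    refine List.ext_getElem (by simp [hp]) fun i h1 h2 => by simp
  · exact Or.inr ⟨(Part.mem_map_iff _).2 ⟨none, hn, rfl⟩, hsol⟩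

/-- Equations with one indeterminate can be solved. -/
theorem SolvesFamilies.exists_solve_option (hE : E.SolvesFamilies) :
    ∃ φ : E.EquationCode →. Option E.Mor, Partrec φ ∧
      ∀ {A D S T : C} {f : A ⟶ S} {g : T ⟶ D} {r : A ⟶ D} {x y : E.Ob × E.Ob} {a : E.Mor × E.Mor}
        {b : E.Mor}, E.obj x.1 A → E.obj x.2 D → E.obj y.1 S → E.obj y.2 T → E.hom a.1 f →
        E.hom a.2 g → E.hom b r →
        (∃ c, some c ∈ φ ((x, y), a, b) ∧ ∃ w : S ⟶ T, E.hom c w ∧ f ≫ w ≫ g = r) ∨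
        (none ∈ φ ((x, y), a, b) ∧ ¬ ∃ w : S ⟶ T, f ≫ w ≫ g = r) := by
  obtain ⟨φ, get, hφ, hget, h⟩ := hE E.EquationCode Unit Unit
    { eqs := fun _ => [()]
      vars := fun _ => [()]
      eqOb := fun p _ => p.1.1
      varOb := fun p _ => p.1.2
      coeff := fun p _ _ => p.2.1
      rhs := fun p _ => p.2.2
      eqs_computable := by fun_prop
      vars_computable := by fun_prop
      eqOb_computable := by fun_prop
      varOb_computable := by fun_prop
      coeff_computable := by fun_prop
      rhs_computable := by fun_prop }
  refine ⟨fun p => (φ p).map fun o => o.map fun s => get ((p, s), ()), ?_, ?_⟩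
  · refine Partrec.map hφ ?_
    change Computable fun q : E.EquationCode × Option ℕ => q.2.map fun s => get ((q.1, s), ())
    fun_prop
  intro A D S T f g r x y a b h1 h2 h3 h4 h5 h6 h7
  rcases h ((x, y), a, b) (I := Unit) (J := Unit)
    { A := fun _ => A, D := fun _ => D, S := fun _ => S, T := fun _ => T, α := fun _ _ => f,
      β := fun _ _ => g, γ := fun _ => r } id id
    { inj_eqs := Function.injective_id
      inj_vars := Function.injective_id
      nodup_eqs := by simp
      nodup_vars := by simp
      mem_eqs := by simp
      mem_vars := by simp
      obj_A := fun _ => h1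
      obj_D := fun _ => h2
      obj_S := fun _ => h3
      obj_T := fun _ => h4
      hom_α := fun _ _ => h5
      hom_β := fun _ _ => h6
      hom_γ := fun _ => h7 } with ⟨s, hs, X, hX, hsol⟩ | ⟨hn, hsol⟩
  · refine Or.inl ⟨_, (Part.mem_map_iff _).2 ⟨some s, hs, rfl⟩, X (), hX (), ?_⟩
    simpa [IndexedSystem.IsSolution] using hsol ()
  · refine Or.inr ⟨(Part.mem_map_iff _).2 ⟨none, hn, rfl⟩, fun ⟨w, hw⟩ => hsol ⟨fun _ => w, ?_⟩⟩
    simpa [IndexedSystem.IsSolution] using hw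

/-- The variant for equations known to be solvable; the default code is returned only when the
solver reports failure. -/
theorem SolvesFamilies.exists_solve (hE : E.SolvesFamilies) (O : E.AdditiveOps) :
    ∃ φ : E.EquationCode →. E.Mor, Partrec φ ∧
      ∀ {A D S T : C} {f : A ⟶ S} {g : T ⟶ D} {r : A ⟶ D} {x y : E.Ob × E.Ob} {a : E.Mor × E.Mor}
        {b : E.Mor}, E.obj x.1 A → E.obj x.2 D → E.obj y.1 S → E.obj y.2 T → E.hom a.1 f →
        E.hom a.2 g → E.hom b r → (∃ w : S ⟶ T, f ≫ w ≫ g = r) →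
        ∃ c ∈ φ ((x, y), a, b), ∃ w : S ⟶ T, E.hom c w ∧ f ≫ w ≫ g = r := by
  obtain ⟨φ, hφ, h⟩ := hE.exists_solve_option
  refine ⟨fun p => (φ p).map fun o => o.getD O.zero, ?_, ?_⟩
  · exact Partrec.map hφ (Computable.option_getD Computable.snd (Computable.const _)).to₂
  intro A D S T f g r x y a b h1 h2 h3 h4 h5 h6 h7 hw
  rcases h h1 h2 h3 h4 h5 h6 h7 with ⟨c, hc, hX⟩ | ⟨_, hsol⟩
  · exact ⟨c, (Part.mem_map_iff _).2 ⟨some c, hc, rfl⟩, hX⟩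
  · exact absurd hw hsol

theorem SolvesFamilies.exists_lift (hE : E.SolvesFamilies) (O : E.AdditiveOps) :
    ∃ φ : (E.Ob × E.Ob × E.Ob) × E.Mor × E.Mor →. E.Mor, Partrec φ ∧
      ∀ {A B T : C} {f : A ⟶ B} {τ : T ⟶ B} {x y t : E.Ob} {a b : E.Mor}, E.obj x A → E.obj y B →
        E.obj t T → E.hom a f → E.hom b τ → (∃ w, w ≫ f = τ) →
        ∃ c ∈ φ ((x, y, t), a, b), ∃ w : T ⟶ A, E.hom c w ∧ w ≫ f = τ := by
  obtain ⟨φ, hφ, h⟩ := hE.exists_solve O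
  refine ⟨fun q => φ (((q.1.2.2, q.1.2.1), (q.1.2.2, q.1.1)), (O.idm q.1.2.2, q.2.1), q.2.2),
    hφ.comp (by fun_prop), fun {A B T f τ x y t a b} hx hy ht ha hb hw => ?_⟩
  have := h (x := (t, y)) (y := (t, x)) (a := (O.idm t, a)) ht hy ht hx (O.hom_idm ht) ha hb
  simp only [Category.id_comp] at this
  exact this hw

theorem SolvesFamilies.exists_colift (hE : E.SolvesFamilies) (O : E.AdditiveOps) :
    ∃ φ : (E.Ob × E.Ob × E.Ob) × E.Mor × E.Mor →. E.Mor, Partrec φ ∧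
      ∀ {A B T : C} {f : A ⟶ B} {τ : A ⟶ T} {x y t : E.Ob} {a b : E.Mor}, E.obj x A → E.obj y B →
        E.obj t T → E.hom a f → E.hom b τ → (∃ w, f ≫ w = τ) →
        ∃ c ∈ φ ((x, y, t), a, b), ∃ w : B ⟶ T, E.hom c w ∧ f ≫ w = τ := by
  obtain ⟨φ, hφ, h⟩ := hE.exists_solve O
  refine ⟨fun q => φ (((q.1.1, q.1.2.2), (q.1.2.1, q.1.2.2)), (q.2.1, O.idm q.1.2.2), q.2.2),
    hφ.comp (by fun_prop), fun {A B T f τ x y t a b} hx hy ht ha hb hw => ?_⟩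
  have := h (x := (x, t)) (y := (y, t)) (a := (a, O.idm t)) hx ht hy ht ha (O.hom_idm ht) hb
  simp only [Category.comp_id] at this
  exact this hw

theorem AdditiveOps.hasCategoryAlgorithms (O : E.AdditiveOps) : E.HasCategoryAlgorithms :=
  ⟨⟨_, O.comp_computable, fun _ _ _ _ _ _ _ hx hy hz ha hb =>
      ⟨_, Part.mem_some _, O.hom_comp hx hy hz ha hb⟩⟩,
    ⟨_, O.idm_computable, fun _ _ hx => ⟨_, Part.mem_some _, O.hom_idm hx⟩⟩⟩

theorem AdditiveOps.hasAbAlgorithms (O : E.AdditiveOps) : E.HasAbAlgorithms :=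
  ⟨⟨_, O.add_computable, fun _ _ _ _ _ _ hx hy ha hb =>
      ⟨_, Part.mem_some _, O.hom_add hx hy ha hb⟩⟩,
    ⟨_, Computable.const O.zero, fun X Y _ _ _ _ => ⟨_, Part.mem_some _, O.hom_zero X Y⟩⟩,
    ⟨_, O.neg_computable, fun _ _ _ _ hx hy ha => ⟨_, Part.mem_some _, O.hom_neg hx hy ha⟩⟩⟩

/-- The code of the direct sum of a list of objects, together with the codes of the summands, the
projections and the injections. -/
def AdditiveOps.listSum (O : E.AdditiveOps) (l : List E.Ob) :
    E.Ob × List (E.Ob × E.Mor × E.Mor) :=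
  l.foldr (fun x r => (O.sum (x, r.1), (x, O.fst (x, r.1), O.inl (x, r.1)) :: r.2.map fun e =>
    (e.1, O.comp ((O.sum (x, r.1), r.1, e.1), O.snd (x, r.1), e.2.1),
      O.comp ((e.1, r.1, O.sum (x, r.1)), e.2.2, O.inr (x, r.1))))) (O.zeroOb, [])

@[fun_prop]
theorem AdditiveOps.listSum_computable (O : E.AdditiveOps) : Computable O.listSum := by
  change Computable fun l => O.listSum l
  unfold AdditiveOps.listSum
  fun_prop

/-- Adding a summand in front replaces each earlier projection and injection by its composite with
the second projection or injection. The codes of the summands are carried along because composition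
requires them. -/
theorem AdditiveOps.listSum_spec (O : E.AdditiveOps) (n : ℕ) (A : Fin n → C) (x : Fin n → E.Ob)
    (hx : ∀ i, E.obj (x i) (A i)) :
    ∃ (S : C) (π : ∀ i, S ⟶ A i) (ι : ∀ i, A i ⟶ S) (p q : Fin n → E.Mor),
      E.obj (O.listSum (List.ofFn x)).1 S ∧
      (O.listSum (List.ofFn x)).2 = List.ofFn (fun i => (x i, p i, q i)) ∧
      (∀ i, E.hom (p i) (π i)) ∧ (∀ i, E.hom (q i) (ι i)) ∧
      ∑ i, π i ≫ ι i = 𝟙 S ∧ (∀ i, ι i ≫ π i = 𝟙 (A i)) ∧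
      (∀ i j, i ≠ j → ι i ≫ π j = 0) := by
  induction n with
  | zero =>
    obtain ⟨Z, hZ, h⟩ := O.obj_zeroOb
    refine ⟨Z, fun i => i.elim0, fun i => i.elim0, fun i => i.elim0, fun i => i.elim0, ?_, ?_,
      fun i => i.elim0, fun i => i.elim0, ?_, fun i => i.elim0, fun i => i.elim0⟩
    · simpa [listSum] using hZ
    · simp [listSum]
    · simp [h]
  | succ n ih =>
    obtain ⟨S, π, ι, p, q, hS, hl, hp, hq, h1, h2, h3⟩ :=
      ih (fun i => A i.succ) (fun i => x i.succ) (fun i => hx i.succ)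
    obtain ⟨b, b1, b2, b3, b4, b5⟩ := O.exists_sum (hx 0) hS
    set s := (O.listSum (List.ofFn fun i => x i.succ)).1 with hs
    refine ⟨b.pt, Fin.cons (α := fun i => b.pt ⟶ A i) b.fst (fun i => b.snd ≫ π i),
      Fin.cons (α := fun i => A i ⟶ b.pt) b.inl (fun i => ι i ≫ b.inr),
      Fin.cons (O.fst (x 0, s))
        (fun i => O.comp ((O.sum (x 0, s), s, x i.succ), O.snd (x 0, s), p i)),
      Fin.cons (O.inl (x 0, s))
        (fun i => O.comp ((x i.succ, s, O.sum (x 0, s)), q i, O.inr (x 0, s))),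
      ?_, ?_, ?_, ?_, ?_, ?_, ?_⟩
    · rw [List.ofFn_succ]
      exact b1
    · rw [List.ofFn_succ, List.ofFn_succ]
      change _ :: List.map _ (O.listSum (List.ofFn fun i => x i.succ)).2 = _
      rw [hl, List.map_ofFn]
      rfl
    · refine Fin.cases b2 fun i => ?_
      exact O.hom_comp b1 hS (hx i.succ) b3 (hp i)
    · refine Fin.cases b4 fun i => ?_
      exact O.hom_comp (hx i.succ) hS b1 (hq i) b5
    · rw [Fin.sum_univ_succ]
      simp only [Fin.cons_zero, Fin.cons_succ, Category.assoc]
      rw [← b.total, ← Preadditive.comp_sum]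
      congr 2
      simp only [← Category.assoc]
      rw [← Preadditive.sum_comp, h1, Category.id_comp]
    · refine Fin.cases b.inl_fst fun i => ?_
      simp [h2]
    · refine Fin.cases (Fin.cases (fun h => absurd rfl h) fun j _ => ?_)
        (fun i => Fin.cases (fun _ => ?_) fun j hij => ?_)
      · simp
      · simp
      · have : i ≠ j := fun h => hij (congrArg Fin.succ h)
        simp [h3 i j this]

theorem AdditiveOps.hasDirectSumAlgorithms (O : E.AdditiveOps) : E.HasDirectSumAlgorithms := by
  refine ⟨fun l => Part.some (O.listSum l).1,
    fun q => Part.some ((O.listSum q.1).2.getD q.2 (O.zeroOb, O.zero, O.zero)).2.1,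
    fun q => Part.some ((O.listSum q.1).2.getD q.2 (O.zeroOb, O.zero, O.zero)).2.2,
    Computable.partrec (by fun_prop), Computable.partrec (by fun_prop),
    Computable.partrec (by fun_prop), fun n A x hx => ?_⟩
  obtain ⟨S, π, ι, p, q, hS, hl, hp, hq, h1, h2, h3⟩ := O.listSum_spec n A x hx
  refine ⟨_, Part.mem_some _, S, hS, π, ι, fun i => ⟨_, Part.mem_some _, ?_⟩,
    fun i => ⟨_, Part.mem_some _, ?_⟩, h1, h2, h3⟩
  · simpa [hl] using hp i
  · simpa [hl] using hq i

/-- The equation `0 ≫ X ≫ 0 = f - g` is solvable exactly if `f = g`. -/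
theorem SolvesFamilies.hasDecidableEquality (hE : E.SolvesFamilies) (O : E.AdditiveOps) :
    E.HasDecidableEquality := by
  obtain ⟨φ, hφ, h⟩ := hE.exists_solve_option
  refine ⟨fun q => (φ ((q.1, q.1), (O.zero, O.zero),
    O.add (q.1, q.2.1, O.neg (q.1, q.2.2)))).map Option.isSome, ?_, ?_⟩
  · refine Partrec.map (hφ.comp (by fun_prop)) ?_
    exact (Primrec.option_isSome.to_comp.comp Computable.snd).to₂
  intro X Y f g x y a b hx hy ha hb
  have := h (x := (x, y)) (y := (x, y)) (a := (O.zero, O.zero)) hx hy hx hy (O.hom_zero X X)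
    (O.hom_zero Y Y) (O.hom_add hx hy ha (O.hom_neg hx hy hb))
  simp only [zero_comp, exists_const, ← sub_eq_add_neg] at this
  rcases this with ⟨c, hc, w, _, hw⟩ | ⟨hn, hw⟩
  · exact ⟨_, (Part.mem_map_iff _).2 ⟨_, hc, rfl⟩, by simp [sub_eq_zero.1 hw.symm]⟩
  · refine ⟨_, (Part.mem_map_iff _).2 ⟨_, hn, rfl⟩, ?_⟩
    simpa using fun hfg => hw (by rw [hfg, sub_self])

/-- The universal morphism exists and is unique, so any solution of its defining equation is the
right one. -/
theorem KernelOps.hasKernelAlgorithms (K : E.KernelOps) (hE : E.SolvesFamilies)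
    (O : E.AdditiveOps) : E.HasKernelAlgorithms := by
  obtain ⟨φ, hφ, h⟩ := hE.exists_lift O
  have := K.computable
  refine ⟨_, fun q => φ (((K.ker ((q.1.1, q.1.2.1), q.2.1)).1, q.1.1, q.1.2.2),
    (K.ker ((q.1.1, q.1.2.1), q.2.1)).2, q.2.2), K.computable, hφ.comp (by fun_prop), ?_⟩
  intro A B f x y a hx hy ha
  obtain ⟨N, i, h1, h2, h3⟩ := K.spec hx hy ha
  refine ⟨_, Part.mem_some _, N, i, h1, h2, h3.zero, fun {T} τ t b ht hb hτ => ?_⟩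
  obtain ⟨c, hc, w, hw, hwi⟩ := h h1 hx ht h2 hb (h3.lift τ hτ)
  exact ⟨c, hc, w, hw, hwi, fun w' hw' => h3.eq (hw'.trans hwi.symm)⟩

theorem CokernelOps.hasCokernelAlgorithms (K : E.CokernelOps) (hE : E.SolvesFamilies)
    (O : E.AdditiveOps) : E.HasCokernelAlgorithms := by
  obtain ⟨φ, hφ, h⟩ := hE.exists_colift O
  have := K.computable
  refine ⟨_, fun q => φ ((q.1.2.1, (K.coker ((q.1.1, q.1.2.1), q.2.1)).1, q.1.2.2),
    (K.coker ((q.1.1, q.1.2.1), q.2.1)).2, q.2.2), K.computable, hφ.comp (by fun_prop), ?_⟩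
  intro A B f x y a hx hy ha
  obtain ⟨N, i, h1, h2, h3⟩ := K.spec hx hy ha
  refine ⟨_, Part.mem_some _, N, i, h1, h2, h3.zero, fun {T} τ t b ht hb hτ => ?_⟩
  obtain ⟨c, hc, w, hw, hwi⟩ := h hy h1 ht h2 hb (h3.colift τ hτ)
  exact ⟨c, hc, w, hw, hwi, fun w' hw' => h3.eq (hw'.trans hwi.symm)⟩

theorem SolvesFamilies.hasMonoLiftAlgorithm (hE : E.SolvesFamilies) (O : E.AdditiveOps)
    (K : E.CokernelOps)
    (hmono : ∀ {A B Q T : C} (f : A ⟶ B) (p : B ⟶ Q) (τ : T ⟶ B), Mono f → IsCokernel p f →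
      τ ≫ p = 0 → ∃ w, w ≫ f = τ) : E.HasMonoLiftAlgorithm := by
  obtain ⟨φ, hφ, h⟩ := hE.exists_lift O
  refine ⟨φ, hφ, fun {A B T} f τ x y t a b hf hx hy ht ha hb s hs hτ =>
    h hx hy ht ha hb ?_⟩
  obtain ⟨Q, p, -, -, hp⟩ := K.spec hx hy ha
  -- The computed cokernel factors through the given one, so it kills `τ` too, and `hmono` shows
  -- that the equation for the lift is solvable.
  obtain ⟨l, hl⟩ := CokernelCofork.IsColimit.desc' hs.some p hp.zero
  exact hmono f p τ hf hp (by rw [← hl, ← Category.assoc, hτ, zero_comp])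

theorem SolvesFamilies.hasEpiColiftAlgorithm (hE : E.SolvesFamilies) (O : E.AdditiveOps)
    (K : E.KernelOps)
    (hepi : ∀ {A B K T : C} (f : A ⟶ B) (i : K ⟶ A) (τ : A ⟶ T), Epi f → IsKernel i f →
      i ≫ τ = 0 → ∃ w, f ≫ w = τ) : E.HasEpiColiftAlgorithm := by
  obtain ⟨φ, hφ, h⟩ := hE.exists_colift O
  refine ⟨φ, hφ, fun {A B T} f τ x y t a b hf hx hy ht ha hb s hs hτ =>
    h hx hy ht ha hb ?_⟩
  obtain ⟨Q, p, -, -, hp⟩ := K.spec hx hy ha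
  obtain ⟨l, hl⟩ := KernelFork.IsLimit.lift' hs.some p hp.zero
  exact hepi f p τ hf hp (by rw [← hl, Category.assoc, hτ, comp_zero])

theorem AdditiveOps.isAdditive (O : E.AdditiveOps) : IsAdditive C where
  zero := O.obj_zeroOb.imp fun _ h => h.2
  sum X Y := by
    obtain ⟨x, hx⟩ := E.obj_surj X
    obtain ⟨y, hy⟩ := E.obj_surj Y
    exact ⟨(O.exists_sum hx hy).choose⟩

/-- The Freyd category of a computable additive category with weak kernels and decidable linear
systems is a computable abelian category. -/
theorem SolvesFamilies.isComputableAbelian_freyd (hE : E.SolvesFamilies) (O : E.AdditiveOps)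
    (W : E.WeakKernelOps) : E.freyd.IsComputableAbelian where
  category := O.freyd.hasCategoryAlgorithms
  ab := O.freyd.hasAbAlgorithms
  directSum := O.freyd.hasDirectSumAlgorithms
  kernel := (O.freydKernelOps W).hasKernelAlgorithms (hE.freyd O) O.freyd
  cokernel := O.freydCokernelOps.hasCokernelAlgorithms (hE.freyd O) O.freyd
  monoLift := (hE.freyd O).hasMonoLiftAlgorithm O.freyd O.freydCokernelOps
    (Freyd.exists_lift_of_mono O.isAdditive.zero O.isAdditive.sum)
  epiColift := (hE.freyd O).hasEpiColiftAlgorithm O.freyd (O.freydKernelOps W)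
    (Freyd.exists_colift_of_epi O.isAdditive.sum fun {A B} f => by
      obtain ⟨x, hx⟩ := E.obj_surj A
      obtain ⟨y, hy⟩ := E.obj_surj B
      obtain ⟨a, ha⟩ := E.hom_surj f
      obtain ⟨K, i, -, -, h⟩ := W.spec hx hy ha
      exact ⟨K, i, h⟩)
  decidableEquality := (hE.freyd O).hasDecidableEquality O.freyd

end CodedCategory

/-! ### Row modules over a computable ring -/

namespace CodedRing

/-- Total algorithms for the operations of a ring. -/
structure Ops {R : Type u} [Ring R] (c : CodedRing R) where
  /-- A code of zero. -/
  zero : c.Code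
  /-- A code of one. -/
  one : c.Code
  /-- Addition. -/
  add : c.Code × c.Code → c.Code
  /-- Additive inverses. -/
  neg : c.Code → c.Code
  /-- Multiplication. -/
  mul : c.Code × c.Code → c.Code
  add_computable : Computable add
  neg_computable : Computable neg
  mul_computable : Computable mul
  val_zero : c.val zero = 0
  val_one : c.val one = 1
  val_add : ∀ a b, c.val (add (a, b)) = c.val a + c.val b
  val_neg : ∀ a, c.val (neg a) = -c.val a
  val_mul : ∀ a b, c.val (mul (a, b)) = c.val a * c.val b

attribute [fun_prop] Ops.add_computable Ops.neg_computable Ops.mul_computable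

namespace Ops

section Tabulate

variable {R : Type u} {c : CodedRing R}

/-- The code of the matrix with given entries. -/
def tabulate (m n : ℕ) (e : ℕ → ℕ → c.Code) : List (List c.Code) :=
  (List.range m).map fun i => (List.range n).map fun j => e i j

@[fun_prop]
theorem tabulate_computable {α : Type*} [Primcodable α] {m n : α → ℕ} {e : α → ℕ → ℕ → c.Code}
    (hm : Computable m) (hn : Computable n)
    (he : Computable fun q : α × ℕ × ℕ => e q.1 q.2.1 q.2.2) :
    Computable fun a => tabulate (m a) (n a) (e a) := by
  unfold tabulate
  fun_prop

end Tabulate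

variable {R : Type u} [Ring R] {c : CodedRing R} (O : c.Ops)

/-- The code of an entry of a matrix. -/
def entry (l : List (List c.Code)) (i j : ℕ) : c.Code := (l.getD i []).getD j O.zero

theorem matrix_apply (l : List (List c.Code)) {m n : ℕ} (i : Fin m) (j : Fin n) :
    c.matrix l m n i j = c.val (O.entry l i j) := by
  simp only [matrix, entry, List.getD_eq_getElem?_getD]
  cases h : l[(i : ℕ)]? with
  | none => simp [O.val_zero]
  | some r =>
    cases h' : r[(j : ℕ)]? with
    | none => simp [h', O.val_zero]
    | some a => simp [h']

theorem entry_tabulate {m n : ℕ} (e : ℕ → ℕ → c.Code) {i j : ℕ} (hi : i < m) (hj : j < n) :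
    O.entry (tabulate m n e) i j = e i j := by
  simp [entry, tabulate, hi, hj]

theorem matrix_tabulate (O : c.Ops) (m n : ℕ) (e : ℕ → ℕ → c.Code) :
    c.matrix (tabulate m n e) m n = Matrix.of fun (i : Fin m) (j : Fin n) => c.val (e i j) := by
  ext i j
  rw [O.matrix_apply, O.entry_tabulate e i.2 j.2, Matrix.of_apply]

/-- The code of a sum over a list. -/
def sum {β : Type*} (l : List β) (f : β → c.Code) : c.Code :=
  l.foldr (fun b s => O.add (f b, s)) O.zero

theorem val_sum {β : Type*} (l : List β) (f : β → c.Code) :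
    c.val (O.sum l f) = (l.map fun b => c.val (f b)).sum := by
  induction l with
  | nil => simp [sum, O.val_zero]
  | cons b l ih => simpa [sum, O.val_add] using ih

section Computability

variable {α β : Type*} [Primcodable α] [Primcodable β]

@[fun_prop]
theorem entry_computable {l : α → List (List c.Code)} {i j : α → ℕ} (hl : Computable l)
    (hi : Computable i) (hj : Computable j) : Computable fun a => O.entry (l a) (i a) (j a) := by
  unfold entry
  fun_prop

@[fun_prop]
theorem sum_computable {l : α → List β} {f : α → β → c.Code} (hl : Computable l)
    (hf : Computable fun q : α × β => f q.1 q.2) : Computable fun a => O.sum (l a) (f a) := by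
  unfold sum
  fun_prop

end Computability

end Ops

end CodedRing

theorem List.sum_map_range_eq {M : Type*} [AddCommMonoid M] (n : ℕ) (f : ℕ → M) :
    ((List.range n).map f).sum = ∑ i : Fin n, f i := by
  rw [← Finset.sum_range]
  rfl

namespace RowsCat

/-- The direct sum of two free modules. -/
def sumDiagram {R : Type u} [Ring R] (X Y : RowsCat R) : SumDiagram X Y where
  pt := ⟨X.rank + Y.rank⟩
  fst := (1 : Matrix (Fin (X.rank + Y.rank)) (Fin (X.rank + Y.rank)) R).submatrix id
    (Fin.castAdd Y.rank)
  snd := (1 : Matrix (Fin (X.rank + Y.rank)) (Fin (X.rank + Y.rank)) R).submatrix id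
    (Fin.natAdd X.rank)
  inl := (1 : Matrix (Fin (X.rank + Y.rank)) (Fin (X.rank + Y.rank)) R).submatrix
    (Fin.castAdd Y.rank) id
  inr := (1 : Matrix (Fin (X.rank + Y.rank)) (Fin (X.rank + Y.rank)) R).submatrix
    (Fin.natAdd X.rank) id
  inl_fst := by
    refine (Matrix.submatrix_mul _ _ _ _ _ Function.bijective_id).symm.trans ?_
    rw [Matrix.one_mul]
    exact Matrix.submatrix_one _ (Fin.castAdd_injective _ _)
  inr_snd := by
    refine (Matrix.submatrix_mul _ _ _ _ _ Function.bijective_id).symm.trans ?_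
    rw [Matrix.one_mul]
    exact Matrix.submatrix_one _ (Fin.natAdd_injective _ _)
  inl_snd := by
    refine (Matrix.submatrix_mul _ _ _ _ _ Function.bijective_id).symm.trans ?_
    rw [Matrix.one_mul]
    ext i j
    refine Matrix.one_apply_ne fun h => ?_
    have := congrArg Fin.val h
    simp only [Fin.val_castAdd, Fin.val_natAdd] at this
    have := i.2
    omega
  inr_fst := by
    refine (Matrix.submatrix_mul _ _ _ _ _ Function.bijective_id).symm.trans ?_
    rw [Matrix.one_mul]
    ext i j
    refine Matrix.one_apply_ne fun h => ?_
    have := congrArg Fin.val h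
    simp only [Fin.val_castAdd, Fin.val_natAdd] at this
    have := j.2
    omega
  total := by
    refine Matrix.ext fun i j => ?_
    have := congrFun (congrFun (Matrix.one_mul
      (1 : Matrix (Fin (X.rank + Y.rank)) (Fin (X.rank + Y.rank)) R)) i) j
    rw [Matrix.mul_apply, Fin.sum_univ_add] at this
    exact this

theorem isAdditive (R : Type u) [Ring R] : IsAdditive (RowsCat R) where
  zero := ⟨⟨0⟩, Matrix.ext fun i => i.elim0⟩
  sum X Y := ⟨sumDiagram X Y⟩

end RowsCat

namespace CodedRing.Ops

open CodedCategory

variable {R : Type u} [Ring R] {c : CodedRing R} (O : c.Ops)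

/-- The code of a matrix product. -/
def matMul (q : (ℕ × ℕ × ℕ) × List (List c.Code) × List (List c.Code)) : List (List c.Code) :=
  tabulate q.1.1 q.1.2.2 fun i j =>
    O.sum (List.range q.1.2.1) fun k => O.mul (O.entry q.2.1 i k, O.entry q.2.2 k j)

@[fun_prop]
theorem matMul_computable : Computable O.matMul := by
  change Computable fun q => O.matMul q
  unfold matMul
  fun_prop

theorem matrix_matMul (l m n : ℕ) (a b : List (List c.Code)) :
    c.matrix (O.matMul ((l, m, n), a, b)) l n = c.matrix a l m * c.matrix b m n := by
  refine (O.matrix_tabulate l n _).trans ?_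
  ext i j
  simp only [Matrix.mul_apply, O.matrix_apply, O.val_sum, O.val_mul, Matrix.of_apply]
  exact List.sum_map_range_eq m fun k => c.val (O.entry a i k) * c.val (O.entry b k j)

/-- The code of a matrix sum. -/
def matAdd (q : (ℕ × ℕ) × List (List c.Code) × List (List c.Code)) : List (List c.Code) :=
  tabulate q.1.1 q.1.2 fun i j => O.add (O.entry q.2.1 i j, O.entry q.2.2 i j)

theorem matAdd_computable : Computable O.matAdd := by
  change Computable fun q => O.matAdd q
  unfold matAdd
  fun_prop

theorem matrix_matAdd (m n : ℕ) (a b : List (List c.Code)) :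
    c.matrix (O.matAdd ((m, n), a, b)) m n = c.matrix a m n + c.matrix b m n := by
  refine (O.matrix_tabulate m n _).trans ?_
  ext i j
  simp only [Matrix.add_apply, O.matrix_apply, O.val_add, Matrix.of_apply]

/-- The code of the negative of a matrix. -/
def matNeg (q : (ℕ × ℕ) × List (List c.Code)) : List (List c.Code) :=
  tabulate q.1.1 q.1.2 fun i j => O.neg (O.entry q.2 i j)

theorem matNeg_computable : Computable O.matNeg := by
  change Computable fun q => O.matNeg q
  unfold matNeg
  fun_prop

theorem matrix_matNeg (m n : ℕ) (a : List (List c.Code)) :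
    c.matrix (O.matNeg ((m, n), a)) m n = -c.matrix a m n := by
  refine (O.matrix_tabulate m n _).trans ?_
  ext i j
  simp only [Matrix.neg_apply, O.matrix_apply, O.val_neg, Matrix.of_apply]

/-- The code of a matrix with entries zero and one. -/
def indicator (m n : ℕ) (p : ℕ → ℕ → Bool) : List (List c.Code) :=
  tabulate m n fun i j => bif p i j then O.one else O.zero

theorem matrix_indicator (m n : ℕ) (p : ℕ → ℕ → Bool) :
    c.matrix (O.indicator m n p) m n =
      Matrix.of fun (i : Fin m) (j : Fin n) => bif p i j then (1 : R) else 0 := by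
  refine (O.matrix_tabulate m n _).trans ?_
  ext i j
  simp only [Matrix.of_apply]
  cases p i j
  · exact O.val_zero
  · exact O.val_one

@[fun_prop]
theorem indicator_computable {α : Type*} [Primcodable α] {m n : α → ℕ} {p : α → ℕ → ℕ → Bool}
    (hm : Computable m) (hn : Computable n)
    (hp : Computable fun q : α × ℕ × ℕ => p q.1 q.2.1 q.2.2) :
    Computable fun a => O.indicator (m a) (n a) (p a) := by
  unfold indicator
  fun_prop

/-- The code of the identity matrix. -/
def oneMat (n : ℕ) : List (List c.Code) :=
  O.indicator n n fun i j => decide (i = j)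

theorem oneMat_computable : Computable O.oneMat := by
  change Computable fun n => O.oneMat n
  unfold oneMat
  fun_prop

theorem matrix_oneMat (n : ℕ) : c.matrix (O.oneMat n) n n = 1 := by
  refine (O.matrix_indicator n n _).trans ?_
  ext i j
  simp [Matrix.one_apply, Matrix.of_apply, Fin.ext_iff, cond_eq_ite]

/-- The code of the first projection of a direct sum. -/
def fstMat (q : ℕ × ℕ) : List (List c.Code) :=
  O.indicator (q.1 + q.2) q.1 fun i j => decide (i = j)

theorem fstMat_computable : Computable O.fstMat := by
  change Computable fun q => O.fstMat q
  unfold fstMat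
  fun_prop

/-- The code of the second projection of a direct sum. -/
def sndMat (q : ℕ × ℕ) : List (List c.Code) :=
  O.indicator (q.1 + q.2) q.2 fun i j => decide (i = q.1 + j)

theorem sndMat_computable : Computable O.sndMat := by
  change Computable fun q => O.sndMat q
  unfold sndMat
  fun_prop

/-- The code of the first injection of a direct sum. -/
def inlMat (q : ℕ × ℕ) : List (List c.Code) :=
  O.indicator q.1 (q.1 + q.2) fun i j => decide (i = j)

theorem inlMat_computable : Computable O.inlMat := by
  change Computable fun q => O.inlMat q
  unfold inlMat
  fun_prop

/-- The code of the second injection of a direct sum. -/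
def inrMat (q : ℕ × ℕ) : List (List c.Code) :=
  O.indicator q.2 (q.1 + q.2) fun i j => decide (q.1 + i = j)

theorem inrMat_computable : Computable O.inrMat := by
  change Computable fun q => O.inrMat q
  unfold inrMat
  fun_prop

theorem exists_sumDiagram {X Y : RowsCat R} {x y : ℕ} (hx : X.rank = x) (hy : Y.rank = y) :
    ∃ b : SumDiagram X Y, b.pt.rank = x + y ∧
      b.fst = c.matrix (O.fstMat (x, y)) b.pt.rank X.rank ∧
      b.snd = c.matrix (O.sndMat (x, y)) b.pt.rank Y.rank ∧
      b.inl = c.matrix (O.inlMat (x, y)) X.rank b.pt.rank ∧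
      b.inr = c.matrix (O.inrMat (x, y)) Y.rank b.pt.rank := by
  obtain ⟨m⟩ := X
  obtain ⟨n⟩ := Y
  subst hx hy
  refine ⟨RowsCat.sumDiagram _ _, rfl, ?_, ?_, ?_, ?_⟩
  · refine Eq.trans (Matrix.ext fun i j => ?_) (O.matrix_indicator (m + n) m _).symm
    refine (Matrix.one_apply (α := R)).trans ?_
    simp [Fin.ext_iff, cond_eq_ite]
    rfl
  · refine Eq.trans (Matrix.ext fun i j => ?_) (O.matrix_indicator (m + n) n _).symm
    refine (Matrix.one_apply (α := R)).trans ?_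
    simp [Fin.ext_iff, cond_eq_ite]
    rfl
  · refine Eq.trans (Matrix.ext fun i j => ?_) (O.matrix_indicator m (m + n) _).symm
    refine (Matrix.one_apply (α := R)).trans ?_
    simp [Fin.ext_iff, cond_eq_ite]
    rfl
  · refine Eq.trans (Matrix.ext fun i j => ?_) (O.matrix_indicator n (m + n) _).symm
    refine (Matrix.one_apply (α := R)).trans ?_
    simp [Fin.ext_iff, cond_eq_ite]
    rfl

/-- The additive operations of the category of row modules. -/
def rows : c.rows.AdditiveOps where
  comp := O.matMul
  idm := O.oneMat
  zero := ([] : List (List c.Code))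
  add := O.matAdd
  neg := O.matNeg
  zeroOb := (0 : ℕ)
  sum := fun q : ℕ × ℕ => q.1 + q.2
  fst := O.fstMat
  snd := O.sndMat
  inl := O.inlMat
  inr := O.inrMat
  comp_computable := O.matMul_computable
  idm_computable := O.oneMat_computable
  add_computable := O.matAdd_computable
  neg_computable := O.matNeg_computable
  sum_computable := Primrec.nat_add.to_comp
  fst_computable := O.fstMat_computable
  snd_computable := O.sndMat_computable
  inl_computable := O.inlMat_computable
  inr_computable := O.inrMat_computable
  hom_comp := by
    rintro ⟨l⟩ ⟨m⟩ ⟨n⟩ _ _ _ _ _ a b rfl rfl rfl rfl rfl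
    exact (O.matrix_matMul l m n a b).symm
  hom_idm := by
    rintro ⟨n⟩ _ rfl
    exact (O.matrix_oneMat n).symm
  hom_zero := by
    rintro ⟨m⟩ ⟨n⟩
    change (0 : Matrix (Fin m) (Fin n) R) = c.matrix [] m n
    ext i j
    simp [CodedRing.matrix]
  hom_add := by
    rintro ⟨m⟩ ⟨n⟩ _ _ _ _ a b rfl rfl rfl rfl
    exact (O.matrix_matAdd m n a b).symm
  hom_neg := by
    rintro ⟨m⟩ ⟨n⟩ _ _ _ a rfl rfl rfl
    exact (O.matrix_matNeg m n a).symm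
  obj_zeroOb := ⟨⟨0⟩, rfl, Matrix.ext fun i => i.elim0⟩
  exists_sum := O.exists_sumDiagram

end CodedRing.Ops

/-! ### Linear systems of row modules -/

section Grid

variable {κ : Type}

/-- The positions in a list of matrices of given sizes. -/
def List.grid (l : List κ) (d : κ → ℕ × ℕ) : List (κ × ℕ × ℕ) :=
  l.flatMap fun j => (List.range (d j).1).flatMap fun r =>
    (List.range (d j).2).map fun s => (j, r, s)

theorem List.mem_grid {l : List κ} {d : κ → ℕ × ℕ} {j : κ} {r s : ℕ} :
    (j, r, s) ∈ l.grid d ↔ j ∈ l ∧ r < (d j).1 ∧ s < (d j).2 := by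
  simp only [List.grid, List.mem_flatMap, List.mem_map, List.mem_range, Prod.mk.injEq]
  constructor
  · rintro ⟨j, hj, r, hr, s, hs, rfl, rfl, rfl⟩
    exact ⟨hj, hr, hs⟩
  · rintro ⟨hj, hr, hs⟩
    exact ⟨j, hj, r, hr, s, hs, rfl, rfl, rfl⟩

theorem List.nodup_grid {l : List κ} (hl : l.Nodup) (d : κ → ℕ × ℕ) : (l.grid d).Nodup := by
  refine List.nodup_flatMap.2 ⟨fun j _ => List.nodup_flatMap.2 ⟨fun r _ => ?_, ?_⟩, ?_⟩
  · exact List.nodup_range.map fun s s' h => by simpa using h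
  · refine List.nodup_range.imp fun {r r'} hr => ?_
    simp only [Function.onFun, List.disjoint_left, List.mem_map, not_exists, not_and]
    rintro _ ⟨s, _, rfl⟩ s' _ h
    exact hr (congrArg (fun q => q.2.1) h).symm
  · refine hl.imp fun {j j'} hj => ?_
    simp only [Function.onFun, List.disjoint_left, List.mem_flatMap, List.mem_map, not_exists,
      not_and]
    rintro _ ⟨r, _, s, _, rfl⟩ r' _ s' _ h
    exact hj (congrArg (fun q => q.1) h).symm

theorem List.sum_map_flatMap {β γ M : Type*} [AddMonoid M] (l : List β) (g : β → List γ)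
    (f : γ → M) : ((l.flatMap g).map f).sum = (l.map fun b => ((g b).map f).sum).sum := by
  induction l <;> simp_all

theorem List.sum_map_grid {M : Type*} [AddCommMonoid M] (l : List κ) (d : κ → ℕ × ℕ)
    (f : κ × ℕ × ℕ → M) : ((l.grid d).map f).sum =
      (l.map fun j => ∑ r : Fin (d j).1, ∑ s : Fin (d j).2, f (j, r, s)).sum := by
  simp only [List.grid, List.sum_map_flatMap, List.map_map, Function.comp_def,
    List.sum_map_range_eq]

theorem List.sum_map_eq_sum_univ {J M : Type*} [Fintype J] [AddCommMonoid M] {l : List κ}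
    (hl : l.Nodup) {d : J → κ} (hd : Function.Injective d) (h : ∀ j, j ∈ l ↔ ∃ j', d j' = j)
    (f : κ → M) : (l.map f).sum = ∑ j, f (d j) := by
  classical
  rw [← List.sum_toFinset f hl, ← Finset.sum_image (s := Finset.univ) (f := f) hd.injOn]
  refine Finset.sum_congr ?_ fun _ _ => rfl
  ext j
  simp [h]

@[fun_prop]
theorem Computable.listGrid {α : Type*} [Primcodable α] [Primcodable κ] {l : α → List κ}
    {d : α → κ → ℕ × ℕ} (hl : Computable l) (hd : Computable fun q : α × κ => d q.1 q.2) :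
    Computable fun a => (l a).grid (d a) := by
  unfold List.grid
  fun_prop

end Grid

namespace CodedRing

variable {R : Type u}

/-- Over a ring with decidable lifts, computable families of linear systems with named equations
and indeterminates can be solved. -/
theorem HasDecidableLifts.exists_solver [Ring R] {c : CodedRing R} (hL : c.HasDecidableLifts)
    (O : c.Ops) {α ε υ : Type} [Primcodable α] [Primcodable ε] [Primcodable υ]
    {eqs : α → List ε} {vars : α → List υ} {coef : α → ε → υ → c.Code} {rhs : α → ε → c.Code}
    (heqs : Computable eqs) (hvars : Computable vars)
    (hcoef : Computable fun q : α × ε × υ => coef q.1 q.2.1 q.2.2)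
    (hrhs : Computable fun q : α × ε => rhs q.1 q.2) :
    ∃ (φ : α →. Option ℕ) (get : (α × ℕ) × υ → c.Code), Partrec φ ∧ Computable get ∧
      ∀ p, (vars p).Nodup →
        (∃ s, some s ∈ φ p ∧ ∀ e ∈ eqs p,
          ((vars p).map fun n => c.val (get ((p, s), n)) * c.val (coef p e n)).sum =
            c.val (rhs p e)) ∨
        (none ∈ φ p ∧ ¬ ∃ x : υ → R, ∀ e ∈ eqs p,
          ((vars p).map fun n => x n * c.val (coef p e n)).sum = c.val (rhs p e)) := by
  classical
  obtain ⟨φ, hφ, h⟩ := hL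
  -- The unknowns form a single row that is multiplied by `a` from the right, so `a` has a row for
  -- each indeterminate and a column for each equation.
  let a : α → List (List c.Code) := fun p => (vars p).map fun n => (eqs p).map fun e => coef p e n
  let b : α → List (List c.Code) := fun p => [(eqs p).map fun e => rhs p e]
  let inp : α → (ℕ × ℕ × ℕ) × List (List c.Code) × List (List c.Code) := fun p =>
    ((1, (vars p).length, (eqs p).length), a p, b p)
  have hinp : Computable inp := by
    simp only [inp, a, b]
    fun_prop
  -- The number encodes the solution row, read at the position of the indeterminate; the absence of
  -- repetitions makes this position unambiguous.
  let get : (α × ℕ) × υ → c.Code := fun q =>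
    O.entry ((Encodable.decode q.1.2 : Option (List (List c.Code))).elim [] fun x => x) 0
      ((vars q.1.1).idxOf q.2)
  have hget : Computable get := by
    simp only [get]
    fun_prop
  refine ⟨fun p => (φ (inp p)).map fun r => r.map Encodable.encode, get,
    (hφ.comp hinp).map (by
      change Computable fun q : α × Option (List (List c.Code)) => q.2.map Encodable.encode
      fun_prop), hget, fun p hp => ?_⟩
  have ha : ∀ (i : Fin (vars p).length) (j : Fin (eqs p).length),
      c.matrix (a p) (vars p).length (eqs p).length i j =
        c.val (coef p (eqs p)[j] (vars p)[i]) := by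
    intro i j
    rw [O.matrix_apply]
    simp [Ops.entry, a]
  have hb : ∀ (i : Fin 1) (j : Fin (eqs p).length),
      c.matrix (b p) 1 (eqs p).length i j = c.val (rhs p (eqs p)[j]) := by
    intro i j
    rw [O.matrix_apply]
    simp [Ops.entry, b]
  have key : ∀ X : Matrix (Fin 1) (Fin (vars p).length) R, ∀ x : υ → R,
      (∀ i : Fin (vars p).length, X 0 i = x (vars p)[i]) →
      (X * c.matrix (a p) (vars p).length (eqs p).length = c.matrix (b p) 1 (eqs p).length ↔
        ∀ e ∈ eqs p, ((vars p).map fun n => x n * c.val (coef p e n)).sum = c.val (rhs p e)) := by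
    intro X x hX
    have hsum : ∀ j, (X * c.matrix (a p) (vars p).length (eqs p).length) 0 j =
        ((vars p).map fun n => x n * c.val (coef p (eqs p)[j] n)).sum := by
      intro j
      rw [Matrix.mul_apply, ← Fin.sum_univ_fun_getElem]
      exact Finset.sum_congr rfl fun i _ => by rw [hX, ha]; rfl
    constructor
    · intro hXa e he
      obtain ⟨j, hj, rfl⟩ := List.getElem_of_mem he
      have := congrFun (congrFun hXa 0) ⟨j, hj⟩
      rw [hsum, hb] at this
      exact this
    · intro hx
      ext i j
      obtain rfl := Subsingleton.elim i 0
      rw [hsum, hb]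
      exact hx _ (List.getElem_mem _)
  rcases h 1 (vars p).length (eqs p).length (a p) (b p) with ⟨x, hx, hxa⟩ | ⟨hn, hno⟩
  · left
    refine ⟨Encodable.encode x, Part.mem_map_iff _ |>.2 ⟨some x, hx, rfl⟩, ?_⟩
    refine (key _ (fun n => c.val (get ((p, Encodable.encode x), n))) fun i => ?_).1 hxa
    rw [O.matrix_apply]
    simp [get, hp.idxOf_getElem]
  · right
    refine ⟨Part.mem_map_iff _ |>.2 ⟨none, hn, rfl⟩, fun ⟨x, hx⟩ => hno ?_⟩
    exact ⟨Matrix.of fun _ i => x (vars p)[i], (key _ x fun i => rfl).2 hx⟩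

/-- The category of row modules over a commutative ring with decidable lifts has decidable
linear systems. -/
theorem HasDecidableLifts.solvesFamilies [CommRing R] {c : CodedRing R}
    (hL : c.HasDecidableLifts) (O : c.Ops) : c.rows.SolvesFamilies := by
  intro α ι κ _ _ _ F
  let eqOb : α → ι → ℕ × ℕ := F.eqOb
  let varOb : α → κ → ℕ × ℕ := F.varOb
  let coeff : α → ι → κ → List (List c.Code) × List (List c.Code) := F.coeff
  let rhs : α → ι → List (List c.Code) := F.rhs
  have eqs_computable := F.eqs_computable
  have vars_computable := F.vars_computable
  have eqOb_computable : Computable fun q : α × ι => eqOb q.1 q.2 := F.eqOb_computable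
  have varOb_computable : Computable fun q : α × κ => varOb q.1 q.2 := F.varOb_computable
  have coeff_computable : Computable fun q : α × ι × κ => coeff q.1 q.2.1 q.2.2 :=
    F.coeff_computable
  have rhs_computable : Computable fun q : α × ι => rhs q.1 q.2 := F.rhs_computable
  -- The scalar unknown `(j, r', s')` is an entry of `X j`. In the equation for the entry `(r, s)`
  -- of row `i` of the system, its coefficient is the entry `(r, r')` of `α i j` times the entry
  -- `(s', s)` of `β i j`.
  obtain ⟨φ, get, hφ, hget, h⟩ := hL.exists_solver O
    (eqs := fun p => (F.eqs p).grid (eqOb p)) (vars := fun p => (F.vars p).grid (varOb p))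
    (coef := fun p e n => O.mul (O.entry (coeff p e.1 n.1).1 e.2.1 n.2.1,
      O.entry (coeff p e.1 n.1).2 n.2.2 e.2.2))
    (rhs := fun p e => O.entry (rhs p e.1) e.2.1 e.2.2)
    (by fun_prop) (by fun_prop) (by fun_prop) (by fun_prop)
  let get' : (α × ℕ) × κ → List (List c.Code) := fun q =>
    Ops.tabulate (varOb q.1.1 q.2).1 (varOb q.1.1 q.2).2 fun r s => get (q.1, q.2, r, s)
  have hget' : Computable get' := by
    simp only [get']
    fun_prop
  refine ⟨φ, get', hφ, hget', fun p I J _ L ν δ hF => ?_⟩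
  have hA : ∀ i, (L.A i).rank = (eqOb p (ν i)).1 := hF.obj_A
  have hD : ∀ i, (L.D i).rank = (eqOb p (ν i)).2 := hF.obj_D
  have hS : ∀ j, (L.S j).rank = (varOb p (δ j)).1 := hF.obj_S
  have hT : ∀ j, (L.T j).rank = (varOb p (δ j)).2 := hF.obj_T
  have hα : ∀ i j, L.α i j = c.matrix (coeff p (ν i) (δ j)).1 (L.A i).rank (L.S j).rank :=
    hF.hom_α
  have hβ : ∀ i j, L.β i j = c.matrix (coeff p (ν i) (δ j)).2 (L.T j).rank (L.D i).rank :=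
    hF.hom_β
  have hγ : ∀ i, L.γ i = c.matrix (rhs p (ν i)) (L.A i).rank (L.D i).rank := hF.hom_γ
  have key : ∀ (X : ∀ j, Matrix (Fin (L.S j).rank) (Fin (L.T j).rank) R) (x : κ × ℕ × ℕ → R),
      (∀ j r s, X j r s = x (δ j, r, s)) →
      (L.IsSolution X ↔ ∀ e ∈ (F.eqs p).grid (eqOb p), (((F.vars p).grid (varOb p)).map fun n =>
        x n * c.val (O.mul (O.entry (coeff p e.1 n.1).1 e.2.1 n.2.1,
          O.entry (coeff p e.1 n.1).2 n.2.2 e.2.2))).sum =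
            c.val (O.entry (rhs p e.1) e.2.1 e.2.2)) := by
    intro X x hX
    have hsum : ∀ i (r : Fin (L.A i).rank) (s : Fin (L.D i).rank),
        (∑ j, (c.matrix (coeff p (ν i) (δ j)).1 (L.A i).rank (L.S j).rank) * (X j *
          c.matrix (coeff p (ν i) (δ j)).2 (L.T j).rank (L.D i).rank)) r s =
        (((F.vars p).grid (varOb p)).map fun n =>
          x n * c.val (O.mul (O.entry (coeff p (ν i) n.1).1 r n.2.1,
          O.entry (coeff p (ν i) n.1).2 n.2.2 s))).sum := by
      intro i r s
      rw [List.sum_map_grid, List.sum_map_eq_sum_univ hF.nodup_vars hF.inj_vars hF.mem_vars,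
        Matrix.sum_apply]
      refine Finset.sum_congr rfl fun j _ => ?_
      rw [← hS, ← hT]
      simp only [Matrix.mul_apply, O.matrix_apply, hX, Finset.mul_sum, O.val_mul]
      -- Here commutativity is essential: a left and a right coefficient of an unknown merge into
      -- one factor.
      exact Finset.sum_congr rfl fun r' _ => Finset.sum_congr rfl fun s' _ => by ring
    have hsol : L.IsSolution X ↔ ∀ i,
        (∑ j, (c.matrix (coeff p (ν i) (δ j)).1 (L.A i).rank (L.S j).rank) * (X j *
          c.matrix (coeff p (ν i) (δ j)).2 (L.T j).rank (L.D i).rank)) =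
        c.matrix (rhs p (ν i)) (L.A i).rank (L.D i).rank := by
      refine forall_congr' fun i => ?_
      rw [hγ]
      simp only [hα, hβ]
      rfl
    rw [hsol]
    constructor
    · rintro h ⟨e, r, s⟩ he
      obtain ⟨he, hr, hs⟩ := List.mem_grid.1 he
      obtain ⟨i, rfl⟩ := (hF.mem_eqs e).1 he
      rw [← hA] at hr
      rw [← hD] at hs
      have := congrFun (congrFun (h i) ⟨r, hr⟩) ⟨s, hs⟩
      rw [hsum, O.matrix_apply] at this
      exact this
    · intro h i
      ext r s
      rw [hsum, O.matrix_apply]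
      exact h (ν i, r, s) (List.mem_grid.2 ⟨(hF.mem_eqs _).2 ⟨i, rfl⟩, (hA i) ▸ r.2, (hD i) ▸ s.2⟩)
  rcases h p (List.nodup_grid hF.nodup_vars _) with ⟨t, ht, hsol⟩ | ⟨hn, hno⟩
  · left
    refine ⟨t, ht, fun j => c.matrix (get' ((p, t), δ j)) (L.S j).rank (L.T j).rank,
      fun j => rfl, (key _ (fun n => c.val (get ((p, t), n))) fun j r s => ?_).2 hsol⟩
    rw [O.matrix_apply]
    simp only [get']
    rw [O.entry_tabulate _ ((hS j) ▸ r.2) ((hT j) ▸ s.2)]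
  · right
    refine ⟨hn, fun ⟨X, hX⟩ => hno ?_⟩
    classical
    -- The entries of the matrices `X j`, as a function of names, extended by zero; `aux` below
    -- shows that the chosen preimage of a name does not affect the value.
    let x : κ × ℕ × ℕ → R := fun n =>
      if h : ∃ (j : J) (r : Fin (L.S j).rank) (s : Fin (L.T j).rank),
          n = (δ j, (r : ℕ), (s : ℕ)) then
        X h.choose h.choose_spec.choose h.choose_spec.choose_spec.choose
      else 0
    refine ⟨x, (key X x fun j r s => ?_).1 hX⟩
    have h : ∃ (j' : J) (r' : Fin (L.S j').rank) (s' : Fin (L.T j').rank),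
      (δ j, (r : ℕ), (s : ℕ)) = (δ j', (r' : ℕ), (s' : ℕ)) := ⟨j, r, s, rfl⟩
    have hx : x (δ j, r, s) =
      X h.choose h.choose_spec.choose h.choose_spec.choose_spec.choose := dif_pos h
    rw [hx]
    have aux : ∀ (j' : J) (r' : Fin (L.S j').rank) (s' : Fin (L.T j').rank),
        (δ j, (r : ℕ), (s : ℕ)) = (δ j', (r' : ℕ), (s' : ℕ)) →
        (X j : Matrix (Fin (L.S j).rank) (Fin (L.T j).rank) R) r s =
          (X j' : Matrix (Fin (L.S j').rank) (Fin (L.T j').rank) R) r' s' := by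
      intro j' r' s' h
      simp only [Prod.mk.injEq] at h
      obtain ⟨h1, h2, h3⟩ := h
      obtain rfl := hF.inj_vars h1
      obtain rfl := Fin.ext h2
      obtain rfl := Fin.ext h3
      rfl
    exact aux _ _ _ h.choose_spec.choose_spec.choose_spec

end CodedRing

/-! ### Arithmetic of polynomials over a computable field -/

namespace IsComputableField

variable {k : Type u} [Field k] {ν : ℕ → k}

/-- The representation of a computable field by natural numbers. -/
abbrev coded (hν : IsComputableField ν) : CodedRing k where
  Code := ℕ
  val := ν
  surj := hν.surj

/-- The ring operations of a computable field. -/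
noncomputable def ops (hν : IsComputableField ν) : hν.coded.Ops where
  zero := (hν.surj 0).choose
  one := (hν.surj 1).choose
  add := fun p => hν.add.choose p.1 p.2
  neg := hν.neg.choose
  mul := fun p => hν.mul.choose p.1 p.2
  add_computable := hν.add.choose_spec.1
  neg_computable := hν.neg.choose_spec.1
  mul_computable := hν.mul.choose_spec.1
  val_zero := (hν.surj 0).choose_spec
  val_one := (hν.surj 1).choose_spec
  val_add := hν.add.choose_spec.2
  val_neg := hν.neg.choose_spec.2
  val_mul := hν.mul.choose_spec.2

theorem exists_isZero (hν : IsComputableField ν) :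
    ∃ g : ℕ → Bool, Computable g ∧ ∀ a, g a = true ↔ ν a = 0 := by
  obtain ⟨_, hd⟩ := hν.decEq
  obtain ⟨z, hz⟩ := hν.surj 0
  refine ⟨fun a => decide (ν (a, z).1 = ν (a, z).2), ?_, fun a => by simp [hz]⟩
  exact hd.comp (f := fun p : ℕ × ℕ => decide (ν p.1 = ν p.2)) (g := fun a : ℕ => (a, z))
    (by fun_prop)

end IsComputableField

/-! ### Lists of terms and membership in the ideal -/

section Polynomials

variable {k : Type u} [Field k] {ν : ℕ → k}

theorem polyOfTerms_append (l l' : List (ℕ × List (Option ℕ))) :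
    polyOfTerms ν (l ++ l') = polyOfTerms ν l + polyOfTerms ν l' := by
  simp [polyOfTerms]

theorem polyOfTerms_cons (t : ℕ × List (Option ℕ)) (l : List (ℕ × List (Option ℕ))) :
    polyOfTerms ν (t :: l) =
      MvPolynomial.C (ν t.1) * (t.2.map MvPolynomial.X).prod + polyOfTerms ν l := by
  simp [polyOfTerms]

/-- The exponent vector of a list of variables. -/
noncomputable def exponents (t : List (Option ℕ)) : Option ℕ →₀ ℕ :=
  Multiset.toFinsupp (t : Multiset (Option ℕ))

theorem exponents_cons (v : Option ℕ) (t : List (Option ℕ)) :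
    exponents (v :: t) = Finsupp.single v 1 + exponents t := by
  rw [exponents, exponents, ← Multiset.cons_coe, ← Multiset.singleton_add, map_add,
    Multiset.toFinsupp_singleton]

theorem C_mul_prod_map_X (a : k) (t : List (Option ℕ)) :
    MvPolynomial.C a * (t.map MvPolynomial.X).prod = MvPolynomial.monomial (exponents t) a := by
  induction t with
  | nil => simp [exponents]
  | cons v t ih =>
    rw [List.map_cons, List.prod_cons, mul_left_comm, ih, exponents_cons, MvPolynomial.X,
      MvPolynomial.monomial_mul, one_mul]

/-- The multiplicity of a variable in a list. -/
def mult (t : List (Option ℕ)) (v : Option ℕ) : ℕ :=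
  (t.filter fun w => decide (w = v)).length

theorem exponents_apply (t : List (Option ℕ)) (v : Option ℕ) :
    exponents t v = mult t v := by
  induction t with
  | nil => simp [exponents, mult]
  | cons w t ih =>
    rw [exponents_cons, Finsupp.add_apply, ih, mult, mult, List.filter_cons]
    by_cases h : w = v
    · simp [h, add_comm]
    · simp [h]

theorem mult_ne_zero {t : List (Option ℕ)} {v : Option ℕ} :
    mult t v ≠ 0 ↔ v ∈ t := by
  simp [mult, List.filter_eq_nil_iff]

@[fun_prop]
theorem mult_computable {α : Type*} [Primcodable α] {t : α → List (Option ℕ)}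
    {v : α → Option ℕ} (ht : Computable t) (hv : Computable v) :
    Computable fun a => mult (t a) (v a) := by
  unfold mult
  fun_prop

/-- Variables in neither list have multiplicity zero on both sides, so comparing monomials is a
finite test. -/
theorem exponents_eq_iff {s t : List (Option ℕ)} :
    exponents s = exponents t ↔ ∀ v ∈ s ++ t, mult s v = mult t v := by
  simp only [Finsupp.ext_iff, exponents_apply]
  refine ⟨fun h v _ => h v, fun h v => ?_⟩
  by_cases hv : v ∈ s ++ t
  · exact h v hv
  · rw [List.mem_append, ← mult_ne_zero, ← mult_ne_zero] at hv
    omega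

theorem coeff_polyOfTerms (l : List (ℕ × List (Option ℕ))) (m : Option ℕ →₀ ℕ)
    [DecidablePred fun s : ℕ × List (Option ℕ) => exponents s.2 = m] :
    MvPolynomial.coeff m (polyOfTerms ν l) =
      ((l.filter fun s => decide (exponents s.2 = m)).map fun s => ν s.1).sum := by
  induction l with
  | nil => simp [polyOfTerms]
  | cons t l ih =>
    rw [polyOfTerms_cons, MvPolynomial.coeff_add, ih, C_mul_prod_map_X, MvPolynomial.coeff_monomial]
    by_cases h : exponents t.2 = m
    · simp [h]
    · simp [h]

/-- A monomial ideal contains a polynomial exactly if each of its monomials is divisible by a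
generator, here by `z` times some `x_i`. -/
theorem mem_span_X_none_mul_X_iff {p : MvPolynomial (Option ℕ) k} :
    p ∈ Ideal.span (Set.range fun i : ℕ =>
      (MvPolynomial.X none * MvPolynomial.X (some i) : MvPolynomial (Option ℕ) k)) ↔
      ∀ m, MvPolynomial.coeff m p ≠ 0 → m none ≠ 0 ∧ ∃ i, m (some i) ≠ 0 := by
  have hset : (Set.range fun i : ℕ =>
      (MvPolynomial.X none * MvPolynomial.X (some i) : MvPolynomial (Option ℕ) k)) =
      (fun m => MvPolynomial.monomial m (1 : k)) ''
        Set.range fun i : ℕ => Finsupp.single none 1 + Finsupp.single (some i) 1 := by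
    rw [← Set.range_comp]
    refine congrArg Set.range (funext fun i => ?_)
    simp [MvPolynomial.X, MvPolynomial.monomial_mul]
  rw [hset, MvPolynomial.mem_ideal_span_monomial_image]
  refine forall_congr' fun m => ?_
  rw [MvPolynomial.mem_support_iff]
  refine imp_congr_right fun _ => ?_
  simp only [Set.mem_range, exists_exists_eq_and]
  rw [← exists_and_left]
  refine exists_congr fun i => ?_
  constructor
  · intro h
    have h0 := h none
    have h1 := h (some i)
    simp at h0 h1
    omega
  · rintro ⟨h0, h1⟩ v
    by_cases hv : v = none
    · subst hv
      simp
      omega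
    · by_cases hv' : v = some i
      · subst hv'
        simp
        omega
      · simp [Ne.symm hv, Ne.symm hv']

/-- Only monomials that occur in the list can have a nonzero coefficient, and the coefficient is the
sum over the terms with the same monomial. Each alternative can be tested on codes. -/
theorem polyOfTerms_mem_iff (l : List (ℕ × List (Option ℕ))) :
    polyOfTerms ν l ∈ Ideal.span (Set.range fun i : ℕ =>
      (MvPolynomial.X none * MvPolynomial.X (some i) : MvPolynomial (Option ℕ) k)) ↔
      ∀ t ∈ l, (none ∈ t.2 ∧ ∃ v ∈ t.2, v.isSome = true) ∨
        ((l.filter fun s => (s.2 ++ t.2).all fun v => decide (mult s.2 v = mult t.2 v)).map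
          fun s => ν s.1).sum = 0 := by
  classical
  have hfil : ∀ t : ℕ × List (Option ℕ),
      ((l.filter fun s => (s.2 ++ t.2).all fun v => decide (mult s.2 v = mult t.2 v)).map
        fun s => ν s.1).sum = MvPolynomial.coeff (exponents t.2) (polyOfTerms ν l) := by
    intro t
    rw [coeff_polyOfTerms]
    refine congrArg (fun l => (List.map (fun s : ℕ × List (Option ℕ) => ν s.1) l).sum)
      (List.filter_congr fun s _ => ?_)
    rw [Bool.eq_iff_iff]
    simp only [List.all_eq_true, decide_eq_true_eq, exponents_eq_iff]
  have hvar : ∀ t : List (Option ℕ), (none ∈ t ∧ ∃ v ∈ t, v.isSome = true) ↔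
      exponents t none ≠ 0 ∧ ∃ i, exponents t (some i) ≠ 0 := by
    intro t
    simp only [exponents_apply, mult_ne_zero]
    refine and_congr_right fun _ => ⟨?_, ?_⟩
    · rintro ⟨_ | i, hv, h⟩
      · cases h
      · exact ⟨i, hv⟩
    · rintro ⟨i, hi⟩
      exact ⟨some i, hi, by simp⟩
  rw [mem_span_X_none_mul_X_iff]
  constructor
  · intro h t _
    rw [hfil, hvar, or_iff_not_imp_right]
    exact h _
  · intro h m hm
    have : ∃ t ∈ l, exponents t.2 = m := by
      by_contra! hno
      rw [coeff_polyOfTerms, List.filter_eq_nil_iff.2 (by simpa using hno)] at hm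
      simp at hm
    obtain ⟨t, ht, rfl⟩ := this
    have := h t ht
    rw [hfil, hvar] at this
    exact this.resolve_right hm

end Polynomials

namespace ZXRing

variable {k : Type u} [Field k] {ν : ℕ → k}

theorem polyOfTerms_mul {mul : ℕ × ℕ → ℕ} (hmul : ∀ a b, ν (mul (a, b)) = ν a * ν b)
    (l l' : List (ℕ × List (Option ℕ))) :
    polyOfTerms ν (l.flatMap fun t => l'.map fun s => (mul (t.1, s.1), t.2 ++ s.2)) =
      polyOfTerms ν l * polyOfTerms ν l' := by
  simp only [polyOfTerms, List.sum_map_flatMap, List.map_map, Function.comp_def, hmul,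
    List.map_append, List.prod_append, map_mul]
  rw [← List.sum_map_mul_right]
  refine congrArg List.sum (List.map_congr_left fun t _ => ?_)
  rw [← List.sum_map_mul_left]
  refine congrArg List.sum (List.map_congr_left fun s _ => ?_)
  ring

theorem polyOfTerms_neg {neg : ℕ → ℕ} (hneg : ∀ a, ν (neg a) = -ν a)
    (l : List (ℕ × List (Option ℕ))) :
    polyOfTerms ν (l.map fun t => (neg t.1, t.2)) = -polyOfTerms ν l := by
  induction l with
  | nil => simp [polyOfTerms]
  | cons t l ih =>
    rw [List.map_cons, polyOfTerms_cons, polyOfTerms_cons, ih, hneg, map_neg]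
    ring

/-- The ring operations of `ZXRing`. -/
noncomputable def ops (hν : IsComputableField ν) : (ZXRing.coded ν hν.surj).Ops :=
  let mul : ℕ × ℕ → ℕ := hν.ops.mul
  let neg : ℕ → ℕ := hν.ops.neg
  have mul_computable : Computable mul := hν.ops.mul_computable
  have neg_computable : Computable neg := hν.ops.neg_computable
  let mul' : List (ℕ × List (Option ℕ)) × List (ℕ × List (Option ℕ)) →
      List (ℕ × List (Option ℕ)) :=
    fun p => p.1.flatMap fun t => p.2.map fun s => (mul (t.1, s.1), t.2 ++ s.2)
  let neg' : List (ℕ × List (Option ℕ)) → List (ℕ × List (Option ℕ)) :=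
    fun l => l.map fun t => (neg t.1, t.2)
  have mul'_computable : Computable mul' := by
    simp only [mul']
    fun_prop
  have neg'_computable : Computable neg' := by
    simp only [neg']
    fun_prop
  { zero := ([] : List (ℕ × List (Option ℕ)))
    one := [((hν.ops.one : ℕ), ([] : List (Option ℕ)))]
    add := fun p : List (ℕ × List (Option ℕ)) × List (ℕ × List (Option ℕ)) => p.1 ++ p.2
    neg := neg'
    mul := mul'
    add_computable := Computable.list_append
    neg_computable := neg'_computable
    mul_computable := mul'_computable
    val_zero := by simp [ZXRing.coded, polyOfTerms]
    val_one := by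
      have : ν hν.ops.one = 1 := hν.ops.val_one
      simp [ZXRing.coded, polyOfTerms, this]
    val_add := fun a b => congrArg _ (polyOfTerms_append a b)
    val_neg := fun a => congrArg _ (polyOfTerms_neg hν.ops.val_neg a)
    val_mul := fun a b => congrArg _ (polyOfTerms_mul hν.ops.val_mul a b) }

end ZXRing

/-- It is decidable whether a code of an element of `ZXRing` stands for zero. -/
theorem ZXRing.exists_isZero {k : Type u} [Field k] {ν : ℕ → k} (hν : IsComputableField ν) :
    ∃ g : List (ℕ × List (Option ℕ)) → Bool, Computable g ∧
      ∀ l, g l = true ↔ (ZXRing.coded ν hν.surj).val l = 0 := by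
  obtain ⟨z, hz, hz0⟩ := hν.exists_isZero
  let sum : List (ℕ × List (Option ℕ)) → ℕ := fun l => hν.ops.sum l fun s => s.1
  have hsum : Computable sum := hν.ops.sum_computable Computable.id (by
    change Computable fun q : List (ℕ × List (Option ℕ)) × (ℕ × List (Option ℕ)) => q.2.1
    fun_prop)
  have hsum' : ∀ l, ν (sum l) = (l.map fun s => ν s.1).sum := fun l => hν.ops.val_sum l _
  refine ⟨fun l => l.all fun t =>
    ((t.2.any fun v => !v.isSome) && t.2.any fun v => v.isSome) ||
      z (sum (l.filter fun s => (s.2 ++ t.2).all fun v => decide (mult s.2 v = mult t.2 v))),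
    by fun_prop, fun l => ?_⟩
  rw [show (ZXRing.coded ν hν.surj).val l = Ideal.Quotient.mk _ (polyOfTerms ν l) from rfl,
    Ideal.Quotient.eq_zero_iff_mem, polyOfTerms_mem_iff]
  simp [hz0, hsum']

/-! ### Finite dimensional refutations of linear systems -/

section Refutation

variable {k : Type u} [Field k]

/-- A prime of `S ⧸ m ^ n` pulls back to a prime containing `m ^ n`, hence to `m`. So the quotient
has dimension zero, and an algebra of finite type of dimension zero is a finite dimensional vector
space. -/
theorem Ideal.finite_quotient_pow_of_isMaximal (k : Type*) [Field k] {S : Type*} [CommRing S]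
    [Algebra k S] [Algebra.FiniteType k S] (m : Ideal S) [hm : m.IsMaximal] (n : ℕ) :
    Module.Finite k (S ⧸ m ^ n) := by
  rw [Module.finite_iff_krullDimLE_zero]
  refine Ring.KrullDimLE.mk₀ fun P hP => ?_
  have hmP : m ≤ P.comap (Ideal.Quotient.mk (m ^ n)) := by
    refine Ideal.IsPrime.le_of_pow_le (n := n) fun x hx => ?_
    rw [Ideal.mem_comap, Ideal.Quotient.eq_zero_iff_mem.2 hx]
    exact P.zero_mem
  have heq := hm.eq_of_le (Ideal.IsPrime.ne_top inferInstance) hmP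
  have : (P.comap (Ideal.Quotient.mk (m ^ n))).IsMaximal := heq ▸ hm
  rw [← Ideal.map_comap_of_surjective _ Ideal.Quotient.mk_surjective P]
  exact Ideal.IsMaximal.map_of_surjective_of_ker_le Ideal.Quotient.mk_surjective
    (Ideal.comap_mono bot_le)

/-- Nonzero elements of finite modules over an algebra of finite type survive in a finite
dimensional quotient. -/
theorem exists_finite_quotient_of_ne_zero (k : Type*) [Field k] {S : Type*} [CommRing S]
    [Algebra k S] [Algebra.FiniteType k S] {Q : Type*} [AddCommGroup Q] [Module S Q] [Module k Q]
    [IsScalarTower k S Q] [Module.Finite S Q] {b : Q} (hb : b ≠ 0) :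
    ∃ N : Submodule S Q, b ∉ N ∧ Module.Finite k (Q ⧸ N) := by
  have : IsNoetherianRing S := Algebra.FiniteType.isNoetherianRing k S
  -- Since `b ≠ 0`, its annihilator lies in a maximal ideal `m`.
  have hann : Ideal.torsionOf S Q b ≠ ⊤ := by
    rwa [Ne, Ideal.torsionOf_eq_top_iff]
  obtain ⟨m, hm, hle⟩ := Ideal.exists_le_maximal _ hann
  -- By Krull's intersection theorem, membership would give `r ∈ m` with `r • b = b`. Then `1 - r`
  -- annihilates `b` and so lies in `m`, which forces `1 ∈ m`.
  have hnot : b ∉ (⨅ i : ℕ, m ^ i • ⊤ : Submodule S Q) := by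
    rw [Ideal.mem_iInf_smul_pow_eq_bot_iff]
    rintro ⟨r, hr⟩
    have h1 : 1 - (r : S) ∈ m := hle (by
      rw [Ideal.mem_torsionOf_iff, sub_smul, one_smul, hr, sub_self])
    exact hm.ne_top ((Ideal.eq_top_iff_one m).2 (by simpa using m.add_mem h1 r.2))
  simp only [Submodule.mem_iInf, not_forall] at hnot
  obtain ⟨n, hn⟩ := hnot
  refine ⟨_, hn, ?_⟩
  have := Ideal.finite_quotient_pow_of_isMaximal k m n
  -- Finite over `S ⧸ m ^ n`, which is finite over `k`.
  have : Module.Finite (S ⧸ m ^ n) (Q ⧸ (m ^ n • ⊤ : Submodule S Q)) :=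
    Module.Finite.of_restrictScalars_finite S _ _
  have : IsScalarTower k (S ⧸ m ^ n) (Q ⧸ (m ^ n • ⊤ : Submodule S Q)) := by
    refine ⟨fun a s y => ?_⟩
    obtain ⟨s, rfl⟩ := Ideal.Quotient.mk_surjective s
    obtain ⟨y, rfl⟩ := Submodule.mkQ_surjective _ y
    exact congrArg (Submodule.Quotient.mk (p := (m ^ n • ⊤ : Submodule S Q))) (smul_assoc a s y)
  exact Module.Finite.trans (S ⧸ m ^ n) _

/-- A linear system over an algebra of finite type that has no solution is refuted in a finite
dimensional representation. -/
theorem exists_refutation {S : Type*} [CommRing S] [Algebra k S] [Algebra.FiniteType k S]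
    {q r : ℕ} (A : Matrix (Fin q) (Fin r) S) (b : Fin r → S)
    (h : ¬ ∃ x : Fin q → S, Matrix.vecMul x A = b) :
    ∃ (d : ℕ) (ρ : S →ₐ[k] Matrix (Fin d) (Fin d) k) (w : Fin r → Fin d → k),
      (∀ i, ∑ j, (ρ (A i j)).mulVec (w j) = 0) ∧ ∑ j, (ρ (b j)).mulVec (w j) ≠ 0 := by
  let N₀ : Submodule S (Fin r → S) := LinearMap.range A.vecMulLinear
  have hb : N₀.mkQ b ≠ 0 := by
    rw [Ne, Submodule.mkQ_apply, Submodule.Quotient.mk_eq_zero]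
    exact fun ⟨x, hx⟩ => h ⟨x, hx⟩
  obtain ⟨N, hN, hfin⟩ := exists_finite_quotient_of_ne_zero (S := S) k hb
  let V := ((Fin r → S) ⧸ N₀) ⧸ N
  let π : (Fin r → S) →ₗ[S] V := N.mkQ ∘ₗ N₀.mkQ
  let e := Module.finBasis k V
  -- The images of the standard basis determine `π`. In the basis `e`, the action of `S` on `V` is
  -- `ρ`, so the refutation expresses that `π` kills the rows of `A` but not `b`.
  let w' : Fin r → V := fun j => π (Pi.single j 1)
  have hπ : ∀ y : Fin r → S, π y = ∑ j, y j • w' j := by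
    intro y
    conv_lhs => rw [pi_eq_sum_univ' y]
    simp [w', map_sum]
  let ρ : S →ₐ[k] Matrix (Fin (Module.finrank k V)) (Fin (Module.finrank k V)) k :=
    (LinearMap.toMatrixAlgEquiv e).toAlgHom.comp (Algebra.lsmul k k V)
  have hρ : ∀ (s : S) (y : V), (ρ s).mulVec (e.repr y) = e.repr (s • y) := by
    intro s y
    exact LinearMap.toMatrix_mulVec_repr e e (Algebra.lsmul k k V s) y
  have hsum : ∀ y : Fin r → S, ∑ j, (ρ (y j)).mulVec (e.repr (w' j)) = e.repr (π y) := by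
    intro y
    simp only [hρ, hπ, map_sum, Finsupp.coe_finsetSum]
  refine ⟨_, ρ, fun j => e.repr (w' j), fun i => ?_, ?_⟩
  · have : π (A i) = 0 := by
      have hmem : A i ∈ N₀ := ⟨Pi.single i 1, by simp [Matrix.row]⟩
      have h0 : N₀.mkQ (A i) = 0 := (Submodule.Quotient.mk_eq_zero N₀).2 hmem
      simp [π, h0]
    rw [hsum, this]
    simp
  · rw [hsum]
    intro h0
    have : π b = 0 := by simpa using h0
    exact hN ((Submodule.Quotient.mk_eq_zero N).1 this)

end Refutation

/-! ### Checking refutations -/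

namespace CodedRing.Ops

variable {R : Type u} [CommRing R] {c : CodedRing R} (O : c.Ops)

/-- The code of a product of matrices from a list, indexed by a list of variables. -/
def wordMat (d : ℕ) (M : List (List (List c.Code))) (t : List (Option ℕ)) : List (List c.Code) :=
  t.foldr (fun v m => O.matMul ((d, d, d), M.getD (Encodable.encode v) [], m)) (O.oneMat d)

/-- The matrix that a list of codes of matrices assigns to a variable. -/
def varMat (c : CodedRing R) (d : ℕ) (M : List (List (List c.Code))) (v : Option ℕ) :
    Matrix (Fin d) (Fin d) R :=
  c.matrix (M.getD (Encodable.encode v) []) d d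

/-- The value of a polynomial, given by a list of terms, at a list of matrices. -/
def evalMat (c : CodedRing R) (d : ℕ) (M : List (List (List c.Code)))
    (l : List (c.Code × List (Option ℕ))) : Matrix (Fin d) (Fin d) R :=
  (l.map fun t => c.val t.1 • (t.2.map (varMat c d M)).prod).sum

/-- The code of an entry of the value of a polynomial at a list of matrices. -/
def evalEntry (d : ℕ) (M : List (List (List c.Code))) (l : List (c.Code × List (Option ℕ)))
    (s u : ℕ) : c.Code :=
  O.sum l fun t => O.mul (t.1, O.entry (O.wordMat d M t.2) s u)

/-- The code of an entry of the image of the columns of `W` under a row of polynomials. -/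
def pairing (d : ℕ) (M : List (List (List c.Code))) (W : List (List c.Code)) (r : ℕ)
    (row : List (List (c.Code × List (Option ℕ)))) (s : ℕ) : c.Code :=
  O.sum (List.range r) fun j => O.sum (List.range d) fun u =>
    O.mul (O.evalEntry d M (row.getD j []) s u, O.entry W u j)

theorem matrix_wordMat (d : ℕ) (M : List (List (List c.Code))) (t : List (Option ℕ)) :
    c.matrix (O.wordMat d M t) d d = (t.map (varMat c d M)).prod := by
  induction t with
  | nil => exact O.matrix_oneMat d
  | cons v t ih =>
    rw [List.map_cons, List.prod_cons, ← ih]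
    exact O.matrix_matMul d d d _ _

theorem val_evalEntry (d : ℕ) (M : List (List (List c.Code)))
    (l : List (c.Code × List (Option ℕ))) (s u : Fin d) :
    c.val (O.evalEntry d M l s u) = evalMat c d M l s u := by
  rw [evalEntry, O.val_sum, evalMat]
  induction l with
  | nil => simp
  | cons t l ih =>
    rw [List.map_cons, List.sum_cons, ih, List.map_cons, List.sum_cons, Matrix.add_apply, O.val_mul,
      ← O.matrix_apply, O.matrix_wordMat]
    rfl

theorem val_pairing (d : ℕ) (M : List (List (List c.Code))) (W : List (List c.Code)) (r : ℕ)
    (row : List (List (c.Code × List (Option ℕ)))) (s : Fin d) :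
    c.val (O.pairing d M W r row s) =
      (∑ j : Fin r, (evalMat c d M (row.getD j [])).mulVec fun u => c.matrix W d r u j) s := by
  simp only [pairing, O.val_sum, List.sum_map_range_eq, O.val_mul, O.val_evalEntry,
    ← O.matrix_apply W, Finset.sum_apply, Matrix.mulVec, dotProduct]

/-- Equality of matrices, for a test `z` for zero. -/
def matEq (z : c.Code → Bool) (m n : ℕ) (a b : List (List c.Code)) : Bool :=
  (List.range m).all fun s => (List.range n).all fun u =>
    z (O.add (O.entry a s u, O.neg (O.entry b s u)))

theorem matEq_iff {z : c.Code → Bool} (hz : ∀ a, z a = true ↔ c.val a = 0) (m n : ℕ)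
    (a b : List (List c.Code)) :
    O.matEq z m n a b = true ↔ c.matrix a m n = c.matrix b m n := by
  simp only [matEq, List.all_eq_true, List.mem_range, hz, O.val_add, O.val_neg,
    ← sub_eq_add_neg, sub_eq_zero, ← Matrix.ext_iff, O.matrix_apply, Fin.forall_iff]

/-- The test whether the representation of the polynomial ring given by `d × d`-matrices `M` and
the vectors given by the columns of `W` refute the solvability of `X * a = b`. -/
def refutes (z : c.Code → Bool) (q : (ℕ × ℕ × ℕ) ×
      List (List (List (c.Code × List (Option ℕ)))) × List (List (List (c.Code × List (Option ℕ)))))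
    (w : ℕ × List (List (List c.Code)) × List (List c.Code)) : Bool :=
  ((List.range w.2.1.length).all fun i => (List.range w.2.1.length).all fun j =>
    O.matEq z w.1 w.1 (O.matMul ((w.1, w.1, w.1), w.2.1.getD i [], w.2.1.getD j []))
      (O.matMul ((w.1, w.1, w.1), w.2.1.getD j [], w.2.1.getD i []))) &&
  ((List.range w.2.1.length).all fun i =>
    O.matEq z w.1 w.1 (O.matMul ((w.1, w.1, w.1),
      w.2.1.getD (Encodable.encode (none : Option ℕ)) [],
      w.2.1.getD (Encodable.encode (some i)) [])) []) &&
  ((List.range q.1.2.1).all fun i => (List.range w.1).all fun s =>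
    z (O.pairing w.1 w.2.1 w.2.2 q.1.2.2 (q.2.1.getD i []) s)) &&
  (List.range q.1.1).any fun i => (List.range w.1).any fun s =>
    !z (O.pairing w.1 w.2.1 w.2.2 q.1.2.2 (q.2.2.getD i []) s)

section Computability

variable {α : Type*} [Primcodable α]

@[fun_prop]
theorem wordMat_computable {d : α → ℕ} {M : α → List (List (List c.Code))}
    {t : α → List (Option ℕ)} (hd : Computable d) (hM : Computable M) (ht : Computable t) :
    Computable fun a => O.wordMat (d a) (M a) (t a) := by
  have := O.oneMat_computable
  unfold wordMat
  fun_prop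

@[fun_prop]
theorem evalEntry_computable {d : α → ℕ} {M : α → List (List (List c.Code))}
    {l : α → List (c.Code × List (Option ℕ))} {s u : α → ℕ} (hd : Computable d)
    (hM : Computable M) (hl : Computable l) (hs : Computable s) (hu : Computable u) :
    Computable fun a => O.evalEntry (d a) (M a) (l a) (s a) (u a) := by
  unfold evalEntry
  fun_prop

@[fun_prop]
theorem pairing_computable {d r : α → ℕ} {M : α → List (List (List c.Code))}
    {W : α → List (List c.Code)} {l : α → List (List (c.Code × List (Option ℕ)))} {s : α → ℕ}
    (hd : Computable d) (hM : Computable M) (hW : Computable W) (hr : Computable r)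
    (hl : Computable l) (hs : Computable s) :
    Computable fun a => O.pairing (d a) (M a) (W a) (r a) (l a) (s a) := by
  unfold pairing
  fun_prop

@[fun_prop]
theorem matEq_computable {z : c.Code → Bool} (hz : Computable z) {m n : α → ℕ}
    {a b : α → List (List c.Code)} (hm : Computable m) (hn : Computable n) (ha : Computable a)
    (hb : Computable b) : Computable fun x => O.matEq z (m x) (n x) (a x) (b x) := by
  unfold matEq
  fun_prop

theorem refutes_computable {z : c.Code → Bool} (hz : Computable z) :
    Computable fun p : ((ℕ × ℕ × ℕ) × List (List (List (c.Code × List (Option ℕ)))) ×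
        List (List (List (c.Code × List (Option ℕ))))) ×
        (ℕ × List (List (List c.Code)) × List (List c.Code)) => O.refutes z p.1 p.2 := by
  unfold refutes
  refine Computable.boolAnd (Computable.boolAnd (Computable.boolAnd ?_ ?_) ?_) ?_
  · fun_prop
  · fun_prop
  · fun_prop
  · fun_prop

end Computability

/-- A list of matrices assigns zero to every variable beyond its length, so conditions on infinitely
many variables reduce to the finitely many tests made by the program. -/
theorem refutes_iff {z : c.Code → Bool} (hz : ∀ a, z a = true ↔ c.val a = 0) (p q r d : ℕ)
    (a b : List (List (List (c.Code × List (Option ℕ))))) (M : List (List (List c.Code)))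
    (W : List (List c.Code)) :
    O.refutes z ((p, q, r), a, b) (d, M, W) = true ↔
      (∀ v w, varMat c d M v * varMat c d M w = varMat c d M w * varMat c d M v) ∧
      (∀ i, varMat c d M none * varMat c d M (some i) = 0) ∧
      (∀ i : Fin q, ∑ j : Fin r, (evalMat c d M ((a.getD i []).getD j [])).mulVec
        (fun u => c.matrix W d r u j) = 0) ∧
      ∃ i : Fin p, ∑ j : Fin r, (evalMat c d M ((b.getD i []).getD j [])).mulVec
        (fun u => c.matrix W d r u j) ≠ 0 := by
  have hnil : c.matrix ([] : List (List c.Code)) d d = 0 := by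
    ext i j
    simp [CodedRing.matrix]
  have hout : ∀ v, M.length ≤ Encodable.encode v → varMat c d M v = 0 := by
    intro v hv
    rw [varMat, List.getD_eq_default _ _ hv, hnil]
  have hz' : ∀ a, z a = false ↔ c.val a ≠ 0 := fun a => by
    rw [Ne, ← hz, Bool.not_eq_true]
  simp only [refutes, Bool.and_eq_true, and_assoc]
  refine and_congr ?_ (and_congr ?_ (and_congr ?_ ?_))
  · simp only [List.all_eq_true, List.mem_range, O.matEq_iff hz, O.matrix_matMul]
    constructor
    · intro h v w
      by_cases hv : Encodable.encode v < M.length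
      · by_cases hw : Encodable.encode w < M.length
        · exact h _ hv _ hw
        · simp [hout _ (not_lt.1 hw)]
      · simp [hout _ (not_lt.1 hv)]
    · intro h i _ j _
      -- Positions in the list correspond to variables: `z` has code `0` and `x_n` has code `n + 1`.
      have hdec : ∀ n : ℕ, ∃ v : Option ℕ, Encodable.encode v = n := by
        rintro (_ | n)
        · exact ⟨none, rfl⟩
        · exact ⟨some n, rfl⟩
      obtain ⟨v, rfl⟩ := hdec i
      obtain ⟨w, rfl⟩ := hdec j
      exact h v w
  · simp only [List.all_eq_true, List.mem_range, O.matEq_iff hz, O.matrix_matMul, hnil]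
    constructor
    · intro h i
      by_cases hi : i < M.length
      · exact h i hi
      · have : M.length ≤ Encodable.encode (some i) := by
          rw [Encodable.encode_some]
          exact (not_lt.1 hi).trans (Nat.le_succ _)
        simp [hout _ this]
    · exact fun h i _ => h i
  · simp only [List.all_eq_true, List.mem_range, hz, funext_iff]
    constructor
    · intro h i s
      rw [← O.val_pairing]
      exact h i i.2 s s.2
    · intro h i hi s hs
      exact (O.val_pairing d M W r _ ⟨s, hs⟩).trans (h ⟨i, hi⟩ ⟨s, hs⟩)
  · simp only [List.any_eq_true, List.mem_range, Bool.not_eq_true', hz', Ne, funext_iff,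
      not_forall]
    constructor
    · rintro ⟨i, hi, s, hs, h⟩
      exact ⟨⟨i, hi⟩, ⟨s, hs⟩, fun h' => h ((O.val_pairing d M W r _ ⟨s, hs⟩).trans h')⟩
    · rintro ⟨i, s, h⟩
      exact ⟨i, i.2, s, s.2, fun h' => h ((O.val_pairing d M W r _ s).symm.trans h')⟩

end CodedRing.Ops

open scoped IsMulCommutative in
/-- Commuting elements of an algebra define a representation of the polynomial ring. -/
theorem MvPolynomial.exists_algHom_of_commute {σ k A : Type*} [CommRing k] [Ring A] [Algebra k A]
    {M : σ → A} (h : ∀ v w, M v * M w = M w * M v) :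
    ∃ ψ : MvPolynomial σ k →ₐ[k] A, ∀ v, ψ (MvPolynomial.X v) = M v := by
  -- The target need not be commutative, but the subalgebra generated by the given elements is;
  -- polynomials can be evaluated there.
  have := Algebra.isMulCommutative_adjoin k (s := Set.range M) (by
    rintro _ ⟨v, rfl⟩ _ ⟨w, rfl⟩
    exact h v w)
  refine ⟨(Algebra.adjoin k (Set.range M)).val.comp (MvPolynomial.aeval fun v =>
    (⟨M v, Algebra.subset_adjoin ⟨v, rfl⟩⟩ : Algebra.adjoin k (Set.range M))), fun v => ?_⟩
  simp

/-! ### Lifts over the ring -/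

namespace ZXRing

variable {k : Type u} [Field k] {ν : ℕ → k}

open CodedRing.Ops

theorem evalMat_eq (hν : IsComputableField ν) {d : ℕ} {M : List (List (List ℕ))}
    (ψ : MvPolynomial (Option ℕ) k →ₐ[k] Matrix (Fin d) (Fin d) k)
    (hψ : ∀ v, ψ (MvPolynomial.X v) = varMat hν.coded d M v) (l : List (ℕ × List (Option ℕ))) :
    evalMat hν.coded d M l = ψ (polyOfTerms ν l) := by
  unfold evalMat
  rw [polyOfTerms, map_list_sum, List.map_map]
  refine congrArg List.sum (List.map_congr_left fun t _ => ?_)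
  simp only [Function.comp, ← MvPolynomial.smul_eq_C_mul, map_smul, map_list_prod, List.map_map]
  exact congrArg _ (congrArg List.prod (List.map_congr_left fun v _ => (hψ v).symm))

theorem matrix_coded_apply (hν : IsComputableField ν)
    (a : List (List (List (ℕ × List (Option ℕ))))) {m n : ℕ} (i : Fin m) (j : Fin n) :
    (ZXRing.coded ν hν.surj).matrix a m n i j =
      Ideal.Quotient.mk _ (polyOfTerms ν ((a.getD i []).getD j [])) :=
  (ZXRing.ops hν).matrix_apply a i j

/-- A refutation excludes solutions. -/
theorem not_exists_of_refutes (hν : IsComputableField ν) {z : ℕ → Bool}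
    (hz : ∀ a, z a = true ↔ ν a = 0) {p q r : ℕ} {a b : List (List (List (ℕ × List (Option ℕ))))}
    {w : ℕ × List (List (List ℕ)) × List (List ℕ)}
    (h : hν.ops.refutes z ((p, q, r), a, b) w = true) :
    ¬ ∃ X : Matrix (Fin p) (Fin q) (ZXRing k),
      X * (ZXRing.coded ν hν.surj).matrix a q r = (ZXRing.coded ν hν.surj).matrix b p r := by
  obtain ⟨d, M, W⟩ := w
  obtain ⟨hcomm, hzx, hA, i, hB⟩ := (hν.ops.refutes_iff hz p q r d a b M W).1 h
  obtain ⟨ψ, hψ⟩ := MvPolynomial.exists_algHom_of_commute (k := k) hcomm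
  rintro ⟨X, hX⟩
  refine hB ?_
  simp only [evalMat_eq hν ψ hψ] at hA ⊢
  have hker : ∀ f ∈ Ideal.span (Set.range fun i : ℕ =>
      (MvPolynomial.X none * MvPolynomial.X (some i) : MvPolynomial (Option ℕ) k)), ψ f = 0 := by
    intro f hf
    refine Submodule.span_induction (p := fun f _ => ψ f = 0) ?_ (map_zero ψ) ?_ ?_ hf
    · rintro _ ⟨i, rfl⟩
      rw [map_mul, hψ, hψ, hzx]
    · intro f g _ _ hf hg
      rw [map_add, hf, hg, add_zero]
    · intro f g _ hg
      rw [smul_eq_mul, map_mul, hg, mul_zero]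
  choose x hx using fun l => Ideal.Quotient.mk_surjective (X i l)
  -- For representatives, row `i` of the equation `X * a = b` holds modulo the ideal, hence exactly
  -- after applying `ψ`.
  have hrow : ∀ j : Fin r, ψ (polyOfTerms ν ((b.getD i []).getD j [])) =
      ∑ l : Fin q, ψ (x l) * ψ (polyOfTerms ν ((a.getD l []).getD j [])) := by
    intro j
    have := congrFun (congrFun hX i) j
    rw [Matrix.mul_apply, matrix_coded_apply hν] at this
    simp only [matrix_coded_apply hν, ← hx, ← map_mul, ← map_sum] at this
    have := hker _ (Ideal.Quotient.eq.1 this)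
    rw [map_sub, sub_eq_zero] at this
    rw [← this, map_sum]
    simp only [map_mul]
  -- The row of `b` is a combination of rows of `a`, so the vectors of `W` that kill the rows of `a`
  -- would also kill it.
  calc _ = ∑ j : Fin r, ∑ l : Fin q, (ψ (x l)).mulVec
        ((ψ (polyOfTerms ν ((a.getD l []).getD j []))).mulVec
          fun u => hν.coded.matrix W d r u j) := by
        refine Finset.sum_congr rfl fun j _ => ?_
        rw [hrow, Matrix.sum_mulVec]
        exact Finset.sum_congr rfl fun l _ => (Matrix.mulVec_mulVec _ _ _).symm
    _ = ∑ l : Fin q, (ψ (x l)).mulVec (∑ j : Fin r,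
        (ψ (polyOfTerms ν ((a.getD l []).getD j []))).mulVec
          fun u => hν.coded.matrix W d r u j) := by
        rw [Finset.sum_comm]
        exact Finset.sum_congr rfl fun l _ => (Matrix.mulVec_sum _ _ _).symm
    _ = 0 := Finset.sum_eq_zero fun l _ => by rw [hA, Matrix.mulVec_zero]

/-- Setting the variables with codes from `N` on to zero does not affect polynomials without them.
This places the entries of a system in a subalgebra of finite type. -/
theorem aeval_truncate_polyOfTerms {N : ℕ} {l : List (ℕ × List (Option ℕ))}
    (h : ∀ t ∈ l, ∀ v ∈ t.2, Encodable.encode v < N) :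
    MvPolynomial.aeval (fun v : Option ℕ => if Encodable.encode v < N then
      (Ideal.Quotient.mk _ (MvPolynomial.X v) : ZXRing k) else 0) (polyOfTerms ν l) =
      (Ideal.Quotient.mk _ (polyOfTerms ν l) : ZXRing k) := by
  rw [polyOfTerms, map_list_sum, map_list_sum]
  simp only [List.map_map]
  refine congrArg List.sum (List.map_congr_left fun t ht => ?_)
  simp only [Function.comp, map_mul, map_list_prod, List.map_map]
  refine congrArg₂ (· * ·) ?_ (congrArg List.prod (List.map_congr_left fun v hv => ?_))
  · rw [MvPolynomial.aeval_C]
    rfl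
  · simp [h t ht v hv]

/-- Unsolvable systems have refutations. -/
theorem exists_refutes (hν : IsComputableField ν) {z : ℕ → Bool}
    (hz : ∀ a, z a = true ↔ ν a = 0) {p q r : ℕ} {a b : List (List (List (ℕ × List (Option ℕ))))}
    (h : ¬ ∃ X : Matrix (Fin p) (Fin q) (ZXRing k),
      X * (ZXRing.coded ν hν.surj).matrix a q r = (ZXRing.coded ν hν.surj).matrix b p r) :
    ∃ w, hν.ops.refutes z ((p, q, r), a, b) w = true := by
  -- The rows of `X` are independent of each other, so some single row already has no solution.
  obtain ⟨i₀, hi₀⟩ : ∃ i, ¬ ∃ x : Fin q → ZXRing k,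
      Matrix.vecMul x ((ZXRing.coded ν hν.surj).matrix a q r) =
        (ZXRing.coded ν hν.surj).matrix b p r i := by
    by_contra! hall
    choose X hX using hall
    exact h ⟨Matrix.of X, funext hX⟩
  obtain ⟨N, hN⟩ : ∃ N, ∀ v ∈ (a ++ b).flatMap fun row => row.flatMap fun l =>
      l.flatMap fun t => t.2, Encodable.encode v < N := by
    generalize ((a ++ b).flatMap fun row => row.flatMap fun l => l.flatMap fun t => t.2) = vs
    -- The sum of the codes bounds each of them.
    refine ⟨(vs.map Encodable.encode).sum + 1, fun v hv => Nat.lt_succ_of_le ?_⟩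
    exact List.single_le_sum (by simp) _ (List.mem_map_of_mem hv)
  have hmem : ∀ (m : List (List (List (ℕ × List (Option ℕ))))), m ⊆ a ++ b → ∀ i j : ℕ,
      ∀ t ∈ (m.getD i []).getD j [], ∀ v ∈ t.2, Encodable.encode v < N := by
    intro m hm i j t ht v hv
    have hget : ∀ {β : Type} (l : List (List β)) (i : ℕ) {x : β}, x ∈ l.getD i [] →
        l.getD i [] ∈ l := by
      intro β l i x hx
      by_cases hi : i < l.length
      · rw [List.getD_eq_getElem _ _ hi]
        exact List.getElem_mem hi
      · rw [List.getD_eq_default _ _ (not_lt.1 hi)] at hx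
        cases hx
    have hrow := hget _ _ ht
    exact hN v (List.mem_flatMap.2 ⟨_, hm (hget _ _ hrow), List.mem_flatMap.2 ⟨_, hrow,
      List.mem_flatMap.2 ⟨t, ht, hv⟩⟩⟩)
  let f : Option ℕ → ZXRing k := fun v => if Encodable.encode v < N then
    Ideal.Quotient.mk _ (MvPolynomial.X v) else 0
  let S : Subalgebra k (ZXRing k) := (MvPolynomial.aeval (R := k) f).range
  have hfin : Algebra.FiniteType k S := by
    refine Subalgebra.fg_iff_finiteType S |>.1 ?_
    have hrange : (Set.range f).Finite := by
      refine Set.Finite.subset ((((Finset.range N).finite_toSet.preimage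
        Encodable.encode_injective.injOn).image f).insert 0) ?_
      rintro _ ⟨v, rfl⟩
      by_cases hv : Encodable.encode v < N
      · exact Or.inr ⟨v, by simpa using hv, rfl⟩
      · exact Or.inl (if_neg hv)
    refine ⟨hrange.toFinset, ?_⟩
    rw [Set.Finite.coe_toFinset, Algebra.adjoin_range_eq_range_aeval]
  let θ : MvPolynomial (Option ℕ) k →ₐ[k] S := (MvPolynomial.aeval (R := k) f).rangeRestrict
  have hθa : ∀ i j : ℕ, (θ (polyOfTerms ν ((a.getD i []).getD j [])) : ZXRing k) =
      Ideal.Quotient.mk _ (polyOfTerms ν ((a.getD i []).getD j [])) := fun i j =>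
    aeval_truncate_polyOfTerms (hmem a (by simp) i j)
  have hθb : ∀ i j : ℕ, (θ (polyOfTerms ν ((b.getD i []).getD j [])) : ZXRing k) =
      Ideal.Quotient.mk _ (polyOfTerms ν ((b.getD i []).getD j [])) := fun i j =>
    aeval_truncate_polyOfTerms (hmem b (by simp) i j)
  -- A solution over the subalgebra `S` would be one over the whole ring, so the row remains
  -- unsolvable over `S`.
  obtain ⟨d, ρ, w, hA, hB⟩ := exists_refutation (k := k) (S := S)
    (Matrix.of fun (i : Fin q) (j : Fin r) => θ (polyOfTerms ν ((a.getD i []).getD j [])))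
    (fun j => θ (polyOfTerms ν ((b.getD i₀ []).getD j []))) (by
      rintro ⟨x, hx⟩
      refine hi₀ ⟨fun l => x l, funext fun j => ?_⟩
      have := congrArg (Subtype.val) (congrFun hx j)
      rw [hθb] at this
      rw [matrix_coded_apply hν, ← this]
      simp only [Matrix.vecMul, dotProduct, Matrix.of_apply, matrix_coded_apply hν, ← hθa]
      simp)
  let ψ : MvPolynomial (Option ℕ) k →ₐ[k] Matrix (Fin d) (Fin d) k := ρ.comp θ
  choose g hg using fun A : Matrix (Fin d) (Fin d) k => hν.coded.matrix_surj A
  -- It suffices to list the matrices of the variables with codes below `N`: the others are sent to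
  -- zero by `θ`, as they are by the default value of the list.
  let M : List (List (List ℕ)) := (List.range N).map fun n =>
    (Encodable.decode n : Option (Option ℕ)).elim [] fun v => g (ψ (MvPolynomial.X v))
  obtain ⟨W, hW⟩ := hν.coded.matrix_surj (Matrix.of fun (u : Fin d) (j : Fin r) => w j u)
  have hM : ∀ v, ψ (MvPolynomial.X v) = varMat hν.coded d M v := by
    intro v
    by_cases hv : Encodable.encode v < N
    · have : M.getD (Encodable.encode v) [] = g (ψ (MvPolynomial.X v)) := by
        simp [M, hv]
      exact (hg _).symm.trans (congrArg (fun m => hν.coded.matrix m d d) this.symm)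
    · have hM0 : M.getD (Encodable.encode v) [] = [] :=
        List.getD_eq_default _ _ (by simpa [M] using hv)
      have hψ0 : ψ (MvPolynomial.X v) = 0 := by
        have : θ (MvPolynomial.X v) = 0 := by
          refine Subtype.ext ?_
          change MvPolynomial.aeval f (MvPolynomial.X v) = 0
          rw [MvPolynomial.aeval_X]
          exact if_neg hv
        simp [ψ, this]
      rw [hψ0]
      refine Eq.trans ?_ (congrArg (fun m => hν.coded.matrix m d d) hM0.symm)
      ext i j
      simp [CodedRing.matrix]
  refine ⟨(d, M, W), (hν.ops.refutes_iff hz p q r d a b M W).2 ⟨fun v v' => ?_, fun i => ?_,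
    fun i => ?_, i₀, ?_⟩⟩
  · rw [← hM, ← hM, ← map_mul, ← map_mul, mul_comm]
  · rw [← hM, ← hM, ← map_mul]
    have : θ (MvPolynomial.X none * MvPolynomial.X (some i)) = 0 := by
      refine Subtype.ext ?_
      change MvPolynomial.aeval f (MvPolynomial.X none * MvPolynomial.X (some i)) = 0
      have : (Ideal.Quotient.mk _ (MvPolynomial.X none) * Ideal.Quotient.mk _
          (MvPolynomial.X (some i)) : ZXRing k) = 0 := by
        rw [← map_mul, Ideal.Quotient.eq_zero_iff_mem]
        exact Ideal.subset_span ⟨i, rfl⟩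
      rw [map_mul, MvPolynomial.aeval_X, MvPolynomial.aeval_X]
      simp only [f]
      split_ifs <;> simp [this]
    simp [ψ, this]
  · simp only [evalMat_eq hν ψ hM, hW]
    exact hA i
  · simp only [evalMat_eq hν ψ hM, hW]
    exact hB

/-- Solutions and refutations can both be verified by computable tests, and exactly one of the two
kinds exists. An unbounded search through both therefore terminates, and what it finds tells which
case holds. -/
theorem hasDecidableLifts (hν : IsComputableField ν) :
    (ZXRing.coded ν hν.surj).HasDecidableLifts := by
  obtain ⟨z, hz, hz0⟩ := hν.exists_isZero
  obtain ⟨y, hy, hy0⟩ := ZXRing.exists_isZero hν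
  let O := ZXRing.ops hν
  let c := ZXRing.coded ν hν.surj
  let solves : (ℕ × ℕ × ℕ) × List (List c.Code) × List (List c.Code) →
      List (List c.Code) → Bool := fun q x =>
    O.matEq y q.1.1 q.1.2.2 (O.matMul (q.1, x, q.2.1)) q.2.2
  have hsolves : Computable fun p : ((ℕ × ℕ × ℕ) × List (List c.Code) × List (List c.Code)) ×
      List (List c.Code) => solves p.1 p.2 := by
    have : Computable (y : c.Code → Bool) := hy
    simp only [solves]
    fun_prop
  let refutes : (ℕ × ℕ × ℕ) × List (List c.Code) × List (List c.Code) →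
      ℕ × List (List (List ℕ)) × List (List ℕ) → Bool := hν.ops.refutes z
  have hrefutes : Computable fun p : ((ℕ × ℕ × ℕ) × List (List c.Code) × List (List c.Code)) ×
      (ℕ × List (List (List ℕ)) × List (List ℕ)) => refutes p.1 p.2 :=
    hν.ops.refutes_computable hz
  obtain ⟨φ, hφ, hφs⟩ := exists_partrec_search (f := fun q s => Sum.elim (solves q) (refutes q) s)
    (by fun_prop)
  refine ⟨fun q => (φ q).map (Sum.elim some fun _ => none), hφ.map ?_, fun p q r a b => ?_⟩
  · change Computable fun q : ((ℕ × ℕ × ℕ) × List (List c.Code) × List (List c.Code)) ×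
      (List (List c.Code) ⊕ ℕ × List (List (List ℕ)) × List (List ℕ)) =>
      Sum.elim some (fun _ => none) q.2
    fun_prop
  have hsol : ∀ x, solves ((p, q, r), a, b) x = true ↔
      c.matrix x p q * c.matrix a q r = c.matrix b p r := by
    intro x
    rw [← O.matrix_matMul]
    exact O.matEq_iff hy0 p r _ _
  have hex : ∃ s, Sum.elim (solves ((p, q, r), a, b)) (refutes ((p, q, r), a, b)) s = true := by
    by_cases h : ∃ X : Matrix (Fin p) (Fin q) (ZXRing k), X * c.matrix a q r = c.matrix b p r
    · obtain ⟨X, hX⟩ := h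
      obtain ⟨x, rfl⟩ := c.matrix_surj X
      exact ⟨Sum.inl x, (hsol x).2 hX⟩
    · obtain ⟨w, hw⟩ := exists_refutes hν hz0 h
      exact ⟨Sum.inr w, hw⟩
  obtain ⟨x | w, hs, hs'⟩ := hφs _ hex
  · exact Or.inl ⟨x, Part.mem_map_iff _ |>.2 ⟨_, hs, rfl⟩, (hsol x).1 hs'⟩
  · exact Or.inr ⟨Part.mem_map_iff _ |>.2 ⟨_, hs, rfl⟩, not_exists_of_refutes hν hz0 hs'⟩

/-- The annihilator of `z` is not finitely generated. -/
theorem not_isLeftCoherent : ¬ IsLeftCoherent (ZXRing k) := by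
  intro h
  obtain ⟨l, L, hL, hT⟩ := h 1 1 (Matrix.of fun _ _ => Ideal.Quotient.mk _ (MvPolynomial.X none))
  choose p hp using fun i => Ideal.Quotient.mk_surjective (L i 0)
  -- The coefficient of the monomial `z` in `z * p i` is the constant term of `p i`; it vanishes
  -- because this monomial contains no `x_j`.
  have hconst : ∀ i, MvPolynomial.constantCoeff (p i) = 0 := by
    intro i
    have h0 := congrFun (congrFun hL i) 0
    rw [Matrix.mul_apply, Fin.sum_univ_one, ← hp, Matrix.of_apply, ← map_mul, Matrix.zero_apply,
      Ideal.Quotient.eq_zero_iff_mem, mem_span_X_none_mul_X_iff] at h0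
    by_contra hne
    obtain ⟨_, j, hj⟩ := h0 (Finsupp.single none 1) (by
      rw [mul_comm, ← add_zero (Finsupp.single none 1), MvPolynomial.coeff_X_mul]
      exact hne)
    simp at hj
  -- Finitely many representatives leave some `x_n` unused.
  obtain ⟨n, hn⟩ : ∃ n : ℕ, ∀ i, some n ∉ (p i).vars := by
    obtain ⟨n, hn⟩ := Infinite.exists_notMem_finset
      ((Finset.univ.biUnion fun i => (p i).vars).preimage some (Option.some_injective ℕ).injOn)
    exact ⟨n, fun i hi => hn (by simpa using ⟨i, hi⟩)⟩
  obtain ⟨U, hU⟩ := hT 1 (Matrix.of fun _ _ => Ideal.Quotient.mk _ (MvPolynomial.X (some n))) (by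
    ext i j
    rw [Matrix.mul_apply, Fin.sum_univ_one, Matrix.of_apply, Matrix.of_apply, ← map_mul,
      Matrix.zero_apply, Ideal.Quotient.eq_zero_iff_mem, mul_comm]
    exact Ideal.subset_span ⟨n, rfl⟩)
  -- All variables but `x_n` go to zero. Since `z` does, the evaluation descends to the quotient. It
  -- reduces each `p i` to its constant term, which is zero, yet `x_n`, a combination of the `p i`,
  -- goes to `X`.
  let f : Option ℕ → Polynomial k := fun v => if v = some n then Polynomial.X else 0
  let ev : ZXRing k →+* Polynomial k := Ideal.Quotient.lift _
    (MvPolynomial.aeval (R := k) f).toRingHom (fun g hg => by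
      refine Submodule.span_induction (p := fun g _ => MvPolynomial.aeval f g = 0) ?_
        (map_zero _) ?_ ?_ hg
      · rintro _ ⟨i, rfl⟩
        simp [f]
      · intro g g' _ _ hg hg'
        rw [map_add, hg, hg', add_zero]
      · intro g g' _ hg'
        rw [smul_eq_mul, map_mul, hg', mul_zero])
  have hev : ∀ g, ev (Ideal.Quotient.mk _ g) = MvPolynomial.aeval f g := fun g => rfl
  have h1 := congrArg ev (congrFun (congrFun hU 0) 0)
  rw [Matrix.mul_apply, map_sum, Finset.sum_eq_zero, Matrix.of_apply, hev,
    MvPolynomial.aeval_X] at h1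
  · exact Polynomial.X_ne_zero (R := k) (by simpa [f] using h1.symm)
  · intro i _
    have : MvPolynomial.aeval f (p i) = 0 := by
      rw [MvPolynomial.aeval_eq_constantCoeff_of_vars, hconst, map_zero]
      intro v hv
      exact if_neg fun h : v = some n => hn i (h ▸ hv)
    rw [map_mul, ← hp, hev, this, mul_zero]

end ZXRing

theorem mainTheorem9 {k : Type*} [Field k] :
    ¬ IsLeftCoherent (ZXRing k) ∧
    IsAbelianCategory (Freyd (Freyd (RowsCat (ZXRing k)))ᵒᵖ) ∧
    ∀ (ν : ℕ → k) (hν : IsComputableField ν),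
      (ZXRing.coded ν hν.surj).HasDecidableLifts ∧
      (ZXRing.coded ν hν.surj).rows.freyd.op.freyd.IsComputableAbelian ∧
      (ZXRing.coded ν hν.surj).rows.freyd.op.freyd.HasDecidableLinearSystems := by
  have hP := RowsCat.isAdditive (ZXRing k)
  refine ⟨ZXRing.not_isLeftCoherent, Freyd.isAbelianCategory (Freyd.isAdditive hP).op
    (Freyd.exists_isWeakKernel_op hP), fun ν hν => ?_⟩
  have hlifts := ZXRing.hasDecidableLifts hν
  have O := (ZXRing.ops hν).rows
  have hsolves := ((hlifts.solvesFamilies (ZXRing.ops hν)).freyd O).op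
  -- The weak kernels for the outer Freyd category are the computed cokernels of the inner one.
  exact ⟨hlifts, hsolves.isComputableAbelian_freyd O.freyd.op O.freydCokernelOps.op,
    (hsolves.freyd O.freyd.op).hasDecidableLinearSystems O.freyd.op.freyd⟩
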